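/- **Setting.** Let $M$ be a smooth (Hausdorff, $\sigma$-compact) manifold of dimension $n\ge 2$, $LM$ its frame bundle and $J^1LM$ the bundle of $1$-jets of local sections of $LM\to M$. A chart $(x^\mu)$ of $M$ induces jet coordinates $(x^\mu,e_k^\mu,e^\mu_{k\nu})$ on $J^1LM$; let $(e^k_\mu)$ be the inverse matrix of $(e^\mu_k)$. Repeated indices are summed. Let $\eta=\operatorname{diag}(-1,1,\dots,1)$ and $H=SO(1,n-1)=\{A\in GL(n): A\eta A^{T}=\eta,\ \det A=1\}$, acting on $J^1LM$ on the right by $(x^\mu,e_k^\mu,e_{k\nu}^\mu)\cdot A=(x^\mu,A^l_ke_l^\mu,A^l_ke^\mu_{l\nu})$. On $J^1LM$ one has the (chart independent) forms $$\theta^k=e^k_\mu\,dx^\mu,\qquad \omega^k_l=e^k_\mu\,(de^\mu_l-e^\mu_{l\sigma}dx^\sigma),\qquad T^i=d\theta^i+\omega^i_k\wedge\theta^k,\qquad \Omega^i_j=d\omega^i_j+\omega^i_k\wedge\omega^k_j ,$$ $$\theta_{kl}=\tfrac1{(n-2)!}\,\epsilon_{kl i_3\cdots i_n}\theta^{i_3}\wedge\cdots\wedge\theta^{i_n},\qquad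 \lambda_{PG}=\eta^{kp}\,\theta_{kl}\wedge\Omega^l_p ,$$ and the differential ideal (algebraic ideal generated by the listed forms and their differentials) $$\mathcal I_{PG}=\big\langle\, \eta^{ik}\omega^j_k+\eta^{jk}\omega^i_k,\ T^i\,\big\rangle_{\rm diff}\subset\Omega^\bullet(J^1LM).$$ Let $C(LM)$ be the bundle of linear connections and $\Sigma=LM/H$, the bundle whose points over $x$ are the Lorentz metrics on $T_xM$ (signature $(-,+,\dots,+)$) together with an orientation of $T_xM$. A chart of $M$ gives on $C(LM)\times_M\Sigma$ coordinates $(x^\mu,g^{\mu\nu},\Gamma^\sigma_{\rho\gamma})$ and the locally constant function $o=\pm1$ comparing the orientation with the one of the chart. Let $p_H:J^1LM\to C(LM)\times_M\Sigma$ be given by $g^{\mu\nu}=\eta^{kl}e_k^\mu e_l^\nu$, $\Gamma^\sigma_{\rho\gamma}=-e^\sigma_{k\rho}e^k_\gamma$, with the orientation defined by the frame. **Corollary.** 1. The action of $H$ on $J^1LM$ is free and proper, its orbits are vertical over $M$, and $\mathcal I_{PG}$ is $H$-invariant. The map $p_H$ is a smooth surjective submersion whose fibres are exactly the $H$-orbits,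 so that $J^1LM/H=C(LM)\times_M\Sigma$. 2. (Reduced Lagrangian) There is a unique form $\overline{\lambda}_{PG}$ on $C(LM)\times_M\Sigma$ with $p_H^*\overline\lambda_{PG}=\lambda_{PG}$. It is smooth, and over the domain of every chart of $M$ $$\overline{\lambda}_{PG}=-\frac{o}{(n-2)!}\,\epsilon_{\mu_1\cdots\mu_{n-2}\gamma\kappa}\sqrt{-\det g}\;g^{\kappa\phi}\,dx^{\mu_1}\wedge\cdots\wedge dx^{\mu_{n-2}}\wedge\left(d\Gamma^\gamma_{\rho\phi}\wedge dx^\rho+\Gamma^\sigma_{\delta\phi}\Gamma^\gamma_{\beta\sigma}\,dx^\beta\wedge dx^\delta\right),$$ where $\det g=\det(g_{\mu\nu})$. 3. (Reduced EDS) Let $\overline{\mathcal I}_{PG}$ be the set of the smooth forms $\alpha$ on $C(LM)\times_M\Sigma$ with $p_H^*\alpha\in\mathcal I_{PG}$. A smooth form $\alpha$ belongs to $\overline{\mathcal I}_{PG}$ if and only if, over the domain of every chart of $M$, it belongs to the differential ideal $$\Big\langle\, dg^{\mu\nu}+\left(g^{\mu\sigma}\Gamma^\nu_{\gamma\sigma}+g^{\nu\sigma}\Gamma^\mu_{\gamma\sigma}\right)dx^\gamma,\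 \left(\Gamma^\sigma_{\mu\nu}-\Gamma^\sigma_{\nu\mu}\right)dx^\mu\wedge dx^\nu\,\Big\rangle_{\rm diff}.$$ 4. (Levi-Civita EDS) A smooth section $s=(\Gamma,g)$ of $C(LM)\times_M\Sigma$ over an open set $W\subset M$ satisfies $s^*\alpha=0$ on $W$ for all $\alpha\in\overline{\mathcal I}_{PG}$ if and only if, in every chart, $\partial_\gamma g^{\mu\nu}+g^{\mu\sigma}\Gamma^\nu_{\gamma\sigma}+g^{\nu\sigma}\Gamma^\mu_{\gamma\sigma}=0$ and $\Gamma^\sigma_{\mu\nu}-\Gamma^\sigma_{\nu\mu}=0$, i.e. $\Gamma$ is the Levi-Civita connection of $g$. -/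

import Mathlib

open scoped Manifold ContDiff Topology

noncomputable section

namespace PalatiniGravity

/-! ### Differential forms on manifolds modelled on a normed space -/

section Forms

variable {V : Type*} [NormedAddCommGroup V] [NormedSpace ℝ V]
variable {W : Type*} [NormedAddCommGroup W] [NormedSpace ℝ W]

theorem update_castAdd_castAdd {V : Type*} {k l : ℕ} (v : Fin (k + l) → V) (i : Fin k) (z : V) :
    (fun i' => Function.update v (Fin.castAdd l i) z (Fin.castAdd l i'))
      = Function.update (fun i' => v (Fin.castAdd l i')) i z :=
  Function.update_comp_eq_of_injective v (Fin.castAdd_injective k l) i z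

theorem update_castAdd_natAdd {V : Type*} {k l : ℕ} (v : Fin (k + l) → V) (i : Fin k) (z : V) :
    (fun j' => Function.update v (Fin.castAdd l i) z (Fin.natAdd k j'))
      = fun j' => v (Fin.natAdd k j') :=
  Function.update_comp_eq_of_forall_ne v z fun j h => by
    have := congrArg Fin.val h; simp at this; omega

theorem update_natAdd_castAdd {V : Type*} {k l : ℕ} (v : Fin (k + l) → V) (j : Fin l) (z : V) :
    (fun i' => Function.update v (Fin.natAdd k j) z (Fin.castAdd l i'))
      = fun i' => v (Fin.castAdd l i') :=
  Function.update_comp_eq_of_forall_ne v z fun i h => by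
    have := congrArg Fin.val h; simp at this; omega

theorem update_natAdd_natAdd {V : Type*} {k l : ℕ} (v : Fin (k + l) → V) (j : Fin l) (z : V) :
    (fun j' => Function.update v (Fin.natAdd k j) z (Fin.natAdd k j'))
      = Function.update (fun j' => v (Fin.natAdd k j')) j z :=
  Function.update_comp_eq_of_injective v (Fin.natAdd_injective l k) j z

/-- The (not yet antisymmetrised) product `v ↦ a (v₀,…,v_{k-1}) * b (v_k,…,v_{k+l-1})`. -/
def tensorMul {k l : ℕ} (a : V [⋀^Fin k]→L[ℝ] ℝ) (b : V [⋀^Fin l]→L[ℝ] ℝ) :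
    ContinuousMultilinearMap ℝ (fun _ : Fin (k + l) => V) ℝ where
  toFun v := a (fun i => v (Fin.castAdd l i)) * b (fun j => v (Fin.natAdd k j))
  map_update_add' := by
    intro inst v i x y
    obtain rfl := Subsingleton.elim inst (instDecidableEqFin (k + l))
    refine Fin.addCases (fun i => ?_) (fun j => ?_) i
    · simp only [update_castAdd_castAdd, update_castAdd_natAdd,
        ContinuousAlternatingMap.map_update_add, add_mul]
    · simp only [update_natAdd_castAdd, update_natAdd_natAdd,
        ContinuousAlternatingMap.map_update_add, mul_add]
  map_update_smul' := by
    intro inst v i c x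
    obtain rfl := Subsingleton.elim inst (instDecidableEqFin (k + l))
    refine Fin.addCases (fun i => ?_) (fun j => ?_) i
    · simp only [update_castAdd_castAdd, update_castAdd_natAdd,
        ContinuousAlternatingMap.map_update_smul, smul_eq_mul, mul_assoc]
    · simp only [update_natAdd_castAdd, update_natAdd_natAdd,
        ContinuousAlternatingMap.map_update_smul, smul_eq_mul, mul_left_comm]
  cont := by
    refine Continuous.mul (a.cont.comp ?_) (b.cont.comp ?_) <;> fun_prop

/-- The wedge product of alternating forms on a normed space, normalised by
`(a ∧ b)(v) = 1/(k! l!) ∑_σ sgn σ a(v_{σ 1},…,v_{σ k}) b(v_{σ (k+1)},…,v_{σ (k+l)})`,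
so that `dx ∧ dy` is the determinant. -/
def altWedge {k l : ℕ} (a : V [⋀^Fin k]→L[ℝ] ℝ) (b : V [⋀^Fin l]→L[ℝ] ℝ) :
    V [⋀^Fin (k + l)]→L[ℝ] ℝ :=
  ((k.factorial * l.factorial : ℕ) : ℝ)⁻¹ •
    ContinuousMultilinearMap.alternatization (tensorMul a b)

/-- Fields of alternating `k`-forms on the tangent spaces of the manifold `X` modelled on `V`. -/
abbrev DForm (V : Type*) [NormedAddCommGroup V] [NormedSpace ℝ V] (X : Type*)
    [TopologicalSpace X] [ChartedSpace V X] (k : ℕ) :=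
  (x : X) → (TangentSpace 𝓘(ℝ, V) x) [⋀^Fin k]→L[ℝ] ℝ

variable {X : Type*} [TopologicalSpace X] [ChartedSpace V X]
variable {Y : Type*} [TopologicalSpace Y] [ChartedSpace W Y]

namespace DForm

/-- The expression of `α` in the chart `c`, i.e. the pullback of `α` along `c⁻¹`. -/
def rep {k : ℕ} (α : DForm V X k) (c : OpenPartialHomeomorph X V) : V → V [⋀^Fin k]→L[ℝ] ℝ :=
  fun y => (α (c.symm y)).compContinuousLinearMap (mfderiv 𝓘(ℝ, V) 𝓘(ℝ, V) c.symm y)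

/-- `α` is a smooth differential form on the open set `S`. -/
def IsSmoothOn {k : ℕ} (α : DForm V X k) (S : Set X) : Prop :=
  ∀ c ∈ atlas V X, ContDiffOn ℝ ∞ (α.rep c) (c.target ∩ c.symm ⁻¹' S)

/-- `α` is a smooth differential form. -/
def IsSmooth {k : ℕ} (α : DForm V X k) : Prop := α.IsSmoothOn Set.univ

/-- Wedge product of forms. -/
def wedge {k l : ℕ} (α : DForm V X k) (β : DForm V X l) : DForm V X (k + l) :=
  fun x => altWedge (V := V) (α x) (β x)

/-- Exterior derivative, computed at `x` in the chart at `x`. -/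
def ext {k : ℕ} (α : DForm V X k) : DForm V X (k + 1) :=
  fun x => (extDeriv (α.rep (chartAt V x)) (chartAt V x x)).compContinuousLinearMap
    (mfderiv 𝓘(ℝ, V) 𝓘(ℝ, V) (chartAt V x) x)

/-- Pullback of forms along a map. -/
def pullback {k : ℕ} (f : X → Y) (α : DForm W Y k) : DForm V X k :=
  fun x => (α (f x)).compContinuousLinearMap (mfderiv 𝓘(ℝ, V) 𝓘(ℝ, W) f x)

/-- A function, as a form of degree zero. -/
def ofFun (f : X → ℝ) : DForm V X 0 :=
  fun x => ContinuousAlternatingMap.constOfIsEmpty ℝ (TangentSpace 𝓘(ℝ, V) x) (Fin 0) (f x)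

/-- The differential of a function, as a form of degree one. -/
def dFun (f : X → ℝ) : DForm V X 1 := (ofFun (V := V) f).ext

/-- The product `f α` of a function and a form. -/
def fmul {k : ℕ} (f : X → ℝ) (α : DForm V X k) : DForm V X k := fun x => f x • α x

/-- `α₀ ∧ α₁ ∧ ⋯ ∧ α_{k-1}` for forms `αᵢ` of degree one. -/
def wedgeProd : (k : ℕ) → (Fin k → DForm V X 1) → DForm V X k
  | 0, _ => ofFun fun _ => 1
  | k + 1, α => (wedgeProd k fun i => α i.castSucc).wedge (α (Fin.last k))

end DForm

/-- The differential ideal `⟨G⟩_diff` generated in `Ω^•(S)`, `S ⊆ X` open, by a set `G` of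
homogeneous forms: the sums of terms `γ ∧ β` and `γ ∧ dβ` with `β` in `G` and `γ` a smooth form
on `S`. (By graded commutativity and the Leibniz rule this is a two-sided ideal closed under `d`.)
Forms are regarded only over `S`. -/
inductive DiffIdeal (S : Set X) (G : (k : ℕ) → DForm V X k → Prop) :
    (k : ℕ) → DForm V X k → Prop
  | zero (k : ℕ) : DiffIdeal S G k 0
  | add {k : ℕ} {ξ ζ : DForm V X k} :
      DiffIdeal S G k ξ → DiffIdeal S G k ζ → DiffIdeal S G k (ξ + ζ)
  | gen {a b : ℕ} (γ : DForm V X a) (β : DForm V X b) :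
      γ.IsSmoothOn S → G b β → DiffIdeal S G (a + b) (γ.wedge β)
  | dgen {a b : ℕ} (γ : DForm V X a) (β : DForm V X b) :
      γ.IsSmoothOn S → G b β → DiffIdeal S G (a + (b + 1)) (γ.wedge β.ext)
  | congr {k : ℕ} {ξ ζ : DForm V X k} :
      DiffIdeal S G k ξ → (∀ x ∈ S, ζ x = ξ x) → DiffIdeal S G k ζ

/-- The reduction along `p : X → Y` of an exterior differential system `I` on `X`: the forms on `Y`
whose pullback along `p` belongs to `I`. -/
def ReducedEDS (p : X → Y) (I : (k : ℕ) → DForm V X k → Prop) (k : ℕ) (α : DForm W Y k) : Prop :=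
  α.IsSmooth ∧ I k (α.pullback (V := V) p)

end Forms

/-! ### Transition functions of a manifold -/

/-- The model space `ℝⁿ`. -/
abbrev E (n : ℕ) := EuclideanSpace ℝ (Fin n)

/-- The algebra `𝔤𝔩(n)` of linear endomorphisms of `ℝⁿ`; multiplication is composition and `star`
is transposition. -/
abbrev L (n : ℕ) := E n →L[ℝ] E n

/-- The matrix entry `A^i_j`, as a linear function of the endomorphism `A`. -/
def entry {n : ℕ} (i j : Fin n) : L n →L[ℝ] ℝ :=
  (EuclideanSpace.proj i).comp (ContinuousLinearMap.apply ℝ (E n) (EuclideanSpace.single j (1 : ℝ)))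

/-- The determinant. -/
def det {n : ℕ} (A : L n) : ℝ := LinearMap.det (A : E n →ₗ[ℝ] E n)

/-- The sign of a (nonzero) real number. -/
def sgn (r : ℝ) : ℤˣ := if 0 < r then 1 else -1

theorem sgn_mul {r s : ℝ} (hr : r ≠ 0) (hs : s ≠ 0) : sgn (r * s) = sgn r * sgn s := by
  unfold sgn
  rcases lt_or_gt_of_ne hr with h | h <;> rcases lt_or_gt_of_ne hs with h' | h'
  · simp [h.not_gt, h'.not_gt, mul_pos_of_neg_of_neg h h']
  · simp [h.not_gt, h', (mul_neg_of_neg_of_pos h h').not_gt]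
  · simp [h, h'.not_gt, (mul_neg_of_pos_of_neg h h').not_gt]
  · simp [h, h', mul_pos h h']

theorem det_mul {n : ℕ} (A B : L n) : det (A * B) = det A * det B :=
  LinearMap.det_comp (A : E n →ₗ[ℝ] E n) (B : E n →ₗ[ℝ] E n)

theorem det_one {n : ℕ} : det (1 : L n) = 1 := LinearMap.det_id

theorem det_ne_zero {n : ℕ} {A : L n} (h : IsUnit A) : det A ≠ 0 := by
  obtain ⟨u, rfl⟩ := h
  intro h0
  have : det ((u : L n) * (↑u⁻¹ : L n)) = 1 := by rw [Units.mul_inv, det_one]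
  rw [det_mul, h0, zero_mul] at this
  exact zero_ne_one this

theorem continuous_det {n : ℕ} : Continuous (det : L n → ℝ) :=
  ContinuousLinearMap.continuous_det

section Transition

variable {n : ℕ} {M : Type*} [TopologicalSpace M]

/-- The change of coordinates from the chart `φ` to the chart `ψ`. -/
def tr (φ ψ : OpenPartialHomeomorph M (E n)) (y : E n) : E n := ψ (φ.symm y)

/-- The Jacobian `∂x̄^μ/∂x^ν` of the change of coordinates from `φ` to `ψ`. -/
def jac (φ ψ : OpenPartialHomeomorph M (E n)) (y : E n) : L n := fderiv ℝ (tr φ ψ) y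

/-- The second derivative `∂²x̄^μ/∂x^ρ∂x^σ` of the change of coordinates from `φ` to `ψ`. -/
def hess (φ ψ : OpenPartialHomeomorph M (E n)) (y : E n) : E n →L[ℝ] L n :=
  fderiv ℝ (jac φ ψ) y

/-- The smooth coordinate charts of `M`. -/
abbrev Charts (n : ℕ) (M : Type*) [TopologicalSpace M] [ChartedSpace (E n) M] :
    Set (OpenPartialHomeomorph M (E n)) :=
  IsManifold.maximalAtlas (𝓡 n) ∞ M

theorem isOpen_overlap (φ ψ : OpenPartialHomeomorph M (E n)) :
    IsOpen (φ.target ∩ φ.symm ⁻¹' ψ.source) :=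
  φ.symm.isOpen_inter_preimage ψ.open_source

theorem jac_self {φ : OpenPartialHomeomorph M (E n)} {x : M} (hx : x ∈ φ.source) :
    jac φ φ (φ x) = 1 := by
  have : tr φ φ =ᶠ[𝓝 (φ x)] id := by
    filter_upwards [φ.open_target.mem_nhds (φ.map_source hx)] with y hy
    simp [tr, φ.right_inv hy]
  rw [jac, this.fderiv_eq, fderiv_id]; rfl

theorem hess_self {φ : OpenPartialHomeomorph M (E n)} {x : M} (hx : x ∈ φ.source) :
    hess φ φ (φ x) = 0 := by
  have : jac φ φ =ᶠ[𝓝 (φ x)] fun _ => 1 := by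
    filter_upwards [φ.open_target.mem_nhds (φ.map_source hx)] with y hy
    have := jac_self (φ := φ) (φ.map_target hy)
    rwa [φ.right_inv hy] at this
  rw [hess, this.fderiv_eq]; simp

theorem mem_overlap {φ ψ : OpenPartialHomeomorph M (E n)} {x : M} (hx : x ∈ φ.source)
    (hx' : x ∈ ψ.source) : φ x ∈ φ.target ∩ φ.symm ⁻¹' ψ.source :=
  ⟨φ.map_source hx, by simpa [φ.left_inv hx] using hx'⟩

variable [ChartedSpace (E n) M]

theorem contDiffOn_tr {φ ψ : OpenPartialHomeomorph M (E n)} [IsManifold (𝓡 n) ∞ M]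
    (hφ : φ ∈ Charts n M) (hψ : ψ ∈ Charts n M) :
    ContDiffOn ℝ ∞ (tr φ ψ) (φ.target ∩ φ.symm ⁻¹' ψ.source) := by
  have h := (contDiffGroupoid ∞ (𝓡 n)).compatible_of_mem_maximalAtlas hφ hψ
  rw [contDiffGroupoid, mem_groupoid_of_pregroupoid] at h
  have := h.1
  change ContDiffOn ℝ ∞ (fun y => ψ (φ.symm y)) _
  simpa [contDiffPregroupoid, OpenPartialHomeomorph.trans_source, Function.comp_def] using this

variable [IsManifold (𝓡 n) ∞ M]

theorem contDiffOn_jac {φ ψ : OpenPartialHomeomorph M (E n)}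
    (hφ : φ ∈ Charts n M) (hψ : ψ ∈ Charts n M) :
    ContDiffOn ℝ ∞ (jac φ ψ) (φ.target ∩ φ.symm ⁻¹' ψ.source) :=
  (contDiffOn_tr hφ hψ).fderiv_of_isOpen (isOpen_overlap φ ψ) (by simp)

theorem contDiffOn_hess {φ ψ : OpenPartialHomeomorph M (E n)}
    (hφ : φ ∈ Charts n M) (hψ : ψ ∈ Charts n M) :
    ContDiffOn ℝ ∞ (hess φ ψ) (φ.target ∩ φ.symm ⁻¹' ψ.source) :=
  (contDiffOn_jac hφ hψ).fderiv_of_isOpen (isOpen_overlap φ ψ) (by simp)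

theorem jac_comp {φ ψ χ : OpenPartialHomeomorph M (E n)}
    (hφ : φ ∈ Charts n M) (hψ : ψ ∈ Charts n M) (hχ : χ ∈ Charts n M) {x : M}
    (h1 : x ∈ φ.source) (h2 : x ∈ ψ.source) (h3 : x ∈ χ.source) :
    jac φ χ (φ x) = jac ψ χ (ψ x) * jac φ ψ (φ x) := by
  have e : tr φ χ =ᶠ[𝓝 (φ x)] tr ψ χ ∘ tr φ ψ := by
    filter_upwards [(isOpen_overlap φ ψ).mem_nhds (mem_overlap h1 h2)] with y hy
    simp [tr, ψ.left_inv hy.2]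
  have t : tr φ ψ (φ x) = ψ x := by simp [tr, φ.left_inv h1]
  have d1 : DifferentiableAt ℝ (tr φ ψ) (φ x) :=
    ((contDiffOn_tr hφ hψ).contDiffAt
      ((isOpen_overlap φ ψ).mem_nhds (mem_overlap h1 h2))).differentiableAt (by simp)
  have d2 : DifferentiableAt ℝ (tr ψ χ) (tr φ ψ (φ x)) := by
    rw [t]
    exact ((contDiffOn_tr hψ hχ).contDiffAt
      ((isOpen_overlap ψ χ).mem_nhds (mem_overlap h2 h3))).differentiableAt (by simp)
  rw [jac, e.fderiv_eq, fderiv_comp _ d2 d1, t]; rfl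

theorem hess_comp {φ ψ χ : OpenPartialHomeomorph M (E n)}
    (hφ : φ ∈ Charts n M) (hψ : ψ ∈ Charts n M) (hχ : χ ∈ Charts n M) {x : M}
    (h1 : x ∈ φ.source) (h2 : x ∈ ψ.source) (h3 : x ∈ χ.source) (v : E n) :
    hess φ χ (φ x) v = hess ψ χ (ψ x) (jac φ ψ (φ x) v) * jac φ ψ (φ x)
      + jac ψ χ (ψ x) * hess φ ψ (φ x) v := by
  have t : tr φ ψ (φ x) = ψ x := by simp [tr, φ.left_inv h1]
  have e : jac φ χ =ᶠ[𝓝 (φ x)] fun y => jac ψ χ (tr φ ψ y) * jac φ ψ y := by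
    filter_upwards [(isOpen_overlap φ ψ).mem_nhds (mem_overlap h1 h2),
      (isOpen_overlap φ χ).mem_nhds (mem_overlap h1 h3)] with y hy hy'
    have := jac_comp hφ hψ hχ (φ.map_target hy.1) hy.2 hy'.2
    rw [φ.right_inv hy.1] at this
    exact this
  have d1 : DifferentiableAt ℝ (tr φ ψ) (φ x) :=
    ((contDiffOn_tr hφ hψ).contDiffAt
      ((isOpen_overlap φ ψ).mem_nhds (mem_overlap h1 h2))).differentiableAt (by simp)
  have d1' : DifferentiableAt ℝ (jac φ ψ) (φ x) :=
    ((contDiffOn_jac hφ hψ).contDiffAt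
      ((isOpen_overlap φ ψ).mem_nhds (mem_overlap h1 h2))).differentiableAt (by simp)
  have d2 : DifferentiableAt ℝ (jac ψ χ) (tr φ ψ (φ x)) := by
    rw [t]
    exact ((contDiffOn_jac hψ hχ).contDiffAt
      ((isOpen_overlap ψ χ).mem_nhds (mem_overlap h2 h3))).differentiableAt (by simp)
  have d3 := (d2.hasFDerivAt.comp (φ x) d1.hasFDerivAt).mul' d1'.hasFDerivAt
  rw [hess, e.fderiv_eq]
  have d4 : HasFDerivAt (fun y => jac ψ χ (tr φ ψ y) * jac φ ψ y) _ (φ x) := d3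
  rw [d4.fderiv]
  simp [hess, t, jac, add_comm]

theorem jac_mul_jac {φ ψ : OpenPartialHomeomorph M (E n)}
    (hφ : φ ∈ Charts n M) (hψ : ψ ∈ Charts n M) {x : M}
    (h1 : x ∈ φ.source) (h2 : x ∈ ψ.source) :
    jac ψ φ (ψ x) * jac φ ψ (φ x) = 1 := by
  rw [← jac_comp hφ hψ hφ h1 h2 h1, jac_self h1]

theorem isUnit_jac {φ ψ : OpenPartialHomeomorph M (E n)}
    (hφ : φ ∈ Charts n M) (hψ : ψ ∈ Charts n M) {x : M}
    (h1 : x ∈ φ.source) (h2 : x ∈ ψ.source) : IsUnit (jac φ ψ (φ x)) :=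
  ⟨⟨_, _, jac_mul_jac hψ hφ h2 h1, jac_mul_jac hφ hψ h1 h2⟩, rfl⟩

end Transition

/-! ### The jet bundle of the frame bundle -/

/-- The model of the jet bundle: `(x^μ, e^μ_k, e^μ_{kν})`, with `e^μ_k = (u e_k)^μ` and
`e^μ_{kν} = (ρ e_ν e_k)^μ`. -/
abbrev VJ (n : ℕ) := E n × (L n × (E n →L[ℝ] L n))

/-- Change of the coordinates `e^μ_{kν}` of a jet:
`ē^μ_{kν} = (∂x̄^μ/∂x^σ e^σ_{kρ} + ∂²x̄^μ/∂x^ρ∂x^σ e^σ_k) ∂x^ρ/∂x̄^ν`.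
Here `A = ∂x̄/∂x`, `D = ∂x/∂x̄`, `B = ∂²x̄/∂x∂x`, `u = (e^μ_k)`. -/
def jetChange {n : ℕ} (A D : L n) (B : E n →L[ℝ] L n) (u : L n) (ρ : E n →L[ℝ] L n) :
    E n →L[ℝ] L n :=
  ((ContinuousLinearMap.compL ℝ (E n) (E n) (E n) A).comp ρ
    + ((ContinuousLinearMap.compL ℝ (E n) (E n) (E n)).flip u).comp B).comp D

/-- Change of the coordinates of a connection:
`Γ̄^μ_{νδ} = ∂x̄^μ/∂x^σ ∂x^ρ/∂x̄^ν ∂x^γ/∂x̄^δ Γ^σ_{ργ} - ∂²x̄^μ/∂x^ρ∂x^γ ∂x^ρ/∂x̄^ν ∂x^γ/∂x̄^δ`. -/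
def connChange {n : ℕ} (A D : L n) (B Γ : E n →L[ℝ] L n) : E n →L[ℝ] L n :=
  (((ContinuousLinearMap.compL ℝ (E n) (E n) (E n)).flip D).comp
    ((ContinuousLinearMap.compL ℝ (E n) (E n) (E n) A).comp Γ - B)).comp D

theorem jetChange_apply {n : ℕ} (A D : L n) (B : E n →L[ℝ] L n) (u : L n) (ρ : E n →L[ℝ] L n)
    (v : E n) : jetChange A D B u ρ v = A * ρ (D v) + B (D v) * u := by
  simp [jetChange]; rfl

theorem connChange_apply {n : ℕ} (A D : L n) (B Γ : E n →L[ℝ] L n) (v : E n) :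
    connChange A D B Γ v = (A * Γ (D v) - B (D v)) * D := by
  simp [connChange]; rfl

/-- The bundle `J¹LM` of one-jets of local sections of the frame bundle `LM` of `M`. As for the
tangent bundle in Mathlib, a point over `x ∈ M` is given by its jet coordinates in the preferred
chart at `x`: the frame `u = (e^μ_k)` and the derivatives `ρ = (e^μ_{kν})`. The coordinates in any
other chart are obtained by the transformation rule of jet coordinates. -/
@[ext] structure J1LM (n : ℕ) (M : Type*) where
  /-- the base point -/
  base : M
  /-- the frame `ℝⁿ → T_x M` -/
  frame : L n
  /-- the derivatives of the frame: `jet v k` is the derivative of the `k`-th vector along `v` -/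
  jet : E n →L[ℝ] L n
  isUnit_frame : IsUnit frame

section Spaces

variable {n : ℕ}

theorem jetChange_jetChange (A D A' D' u : L n) (B B' B'' ρ : E n →L[ℝ] L n) 
    (hB : ∀ v, B'' v = B' (A v) * A + A' * B v) (hAD : A * D = 1) :
    jetChange A' D' B' (A * u) (jetChange A D B u ρ) = jetChange (A' * A) (D * D') B'' u ρ := by
  ext1 v
  have h : A (D (D' v)) = D' v := congrArg (fun T : L n => T (D' v)) hAD
  simp only [jetChange_apply, hB, mul_apply_eq_comp, h]
  noncomm_ring

theorem connChange_connChange (A D A' D' : L n) (B B' B'' Γ : E n →L[ℝ] L n)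
    (hB : ∀ v, B'' v = B' (A v) * A + A' * B v) (hAD : A * D = 1) :
    connChange A' D' B' (connChange A D B Γ) = connChange (A' * A) (D * D') B'' Γ := by
  ext1 v
  have h : A (D (D' v)) = D' v := congrArg (fun T : L n => T (D' v)) hAD
  have h2 : B' (D' v) * (A * (D * D')) = B' (D' v) * D' := by
    rw [← mul_assoc A, hAD, one_mul]
  simp only [connChange_apply, hB, mul_apply_eq_comp, h]
  simp only [sub_mul, add_mul, mul_sub, mul_assoc, h2]
  abel

theorem jetChange_one (u : L n) (ρ : E n →L[ℝ] L n) : jetChange 1 1 0 u ρ = ρ := by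
  ext1 v; simp [jetChange_apply]

theorem connChange_one (Γ : E n →L[ℝ] L n) : connChange 1 1 0 Γ = Γ := by
  ext1 v; simp [connChange_apply]

end Spaces

theorem exists_of_mem_atlas {H X : Type*} [TopologicalSpace H] (c : ChartedSpaceCore H X)
    {e : @OpenPartialHomeomorph X H c.toTopologicalSpace _}
    (he : e ∈ @atlas H _ X c.toTopologicalSpace c.toChartedSpace) :
    ∃ e₀, ∃ he₀ : e₀ ∈ c.atlas, e = c.openPartialHomeomorph e₀ he₀ := by
  have he' : e ∈ ⋃ (e : PartialEquiv X H) (he : e ∈ c.atlas),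
    {c.openPartialHomeomorph e he} := he
  simpa only [Set.mem_iUnion, Set.mem_singleton_iff] using he'

namespace J1LM

variable {n : ℕ} {M : Type*} [TopologicalSpace M] [ChartedSpace (E n) M]

/-- The jet coordinates `(x^μ, e^μ_k, e^μ_{kν})` of a point in the chart `φ` of `M`. -/
def coord (φ : OpenPartialHomeomorph M (E n)) (p : J1LM n M) : VJ n :=
  let c := chartAt (E n) p.base
  (φ p.base, jac c φ (c p.base) * p.frame,
    jetChange (jac c φ (c p.base)) (jac φ c (φ p.base)) (hess c φ (c p.base)) p.frame p.jet)

open Classical in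
/-- The point with given jet coordinates in the chart `φ`. -/
def ofCoord (φ : OpenPartialHomeomorph M (E n)) (z : VJ n) : J1LM n M :=
  let x := φ.symm z.1
  let c := chartAt (E n) x
  if h : IsUnit (jac φ c z.1 * z.2.1) then
    ⟨x, jac φ c z.1 * z.2.1,
      jetChange (jac φ c z.1) (jac c φ (c x)) (hess φ c z.1) z.2.1 z.2.2, h⟩
  else ⟨x, 1, 0, isUnit_one⟩

variable [IsManifold (𝓡 n) ∞ M]

theorem ofCoord_eq {φ : OpenPartialHomeomorph M (E n)} (hφ : φ ∈ Charts n M) {x : M}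
    (hx : x ∈ φ.source) {u : L n} (hu : IsUnit u) (ρ : E n →L[ℝ] L n) :
    ofCoord φ (φ x, u, ρ) = ⟨x, jac φ (chartAt (E n) x) (φ x) * u,
      jetChange (jac φ (chartAt (E n) x) (φ x)) (jac (chartAt (E n) x) φ (chartAt (E n) x x))
        (hess φ (chartAt (E n) x) (φ x)) u ρ,
      (isUnit_jac hφ (IsManifold.chart_mem_maximalAtlas x) hx (mem_chart_source _ x)).mul hu⟩ := by
  have h := (isUnit_jac hφ (IsManifold.chart_mem_maximalAtlas x) hx
    (mem_chart_source (E n) x)).mul hu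
  simp only [ofCoord]
  rw [dif_pos (by rw [φ.left_inv hx]; exact h)]
  simp only [φ.left_inv hx]

/-- Jet coordinates change by the transformation rule of jets. -/
theorem coord_ofCoord {φ ψ : OpenPartialHomeomorph M (E n)} (hφ : φ ∈ Charts n M)
    (hψ : ψ ∈ Charts n M) {x : M} (hx : x ∈ φ.source) (hx' : x ∈ ψ.source) {u : L n}
    (hu : IsUnit u) (ρ : E n →L[ℝ] L n) :
    coord ψ (ofCoord φ (φ x, u, ρ)) = (ψ x, jac φ ψ (φ x) * u,
      jetChange (jac φ ψ (φ x)) (jac ψ φ (ψ x)) (hess φ ψ (φ x)) u ρ) := by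
  have hc := IsManifold.chart_mem_maximalAtlas (I := 𝓡 n) (n := ∞) x
  have hcx := mem_chart_source (E n) x
  rw [ofCoord_eq hφ hx hu]
  simp only [coord]
  rw [jetChange_jetChange (hB := hess_comp hφ hc hψ hx hcx hx')
    (hAD := jac_mul_jac hc hφ hcx hx), ← mul_assoc, ← jac_comp hφ hc hψ hx hcx hx',
    ← jac_comp hψ hc hφ hx' hcx hx]

theorem ofCoord_coord {φ : OpenPartialHomeomorph M (E n)} (hφ : φ ∈ Charts n M)
    {p : J1LM n M} (hp : p.base ∈ φ.source) : ofCoord φ (coord φ p) = p := by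
  have hc := IsManifold.chart_mem_maximalAtlas (I := 𝓡 n) (n := ∞) p.base
  have hcx := mem_chart_source (E n) p.base
  simp only [coord]
  rw [ofCoord_eq hφ hp ((isUnit_jac hc hφ hcx hp).mul p.isUnit_frame)]
  ext1
  · rfl
  · simp only [← mul_assoc, jac_mul_jac hc hφ hcx hp, one_mul]
  · simp only
    rw [jetChange_jetChange (hB := hess_comp hc hφ hc hcx hp hcx)
      (hAD := jac_mul_jac hφ hc hp hcx), jac_mul_jac hc hφ hcx hp, hess_self hcx, jetChange_one]

/-- The chart of `J¹LM` given by the jet coordinates associated with a chart of `M`. -/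
def chart (φ : OpenPartialHomeomorph M (E n)) (hφ : φ ∈ Charts n M) :
    PartialEquiv (J1LM n M) (VJ n) where
  toFun := coord φ
  invFun := ofCoord φ
  source := {p | p.base ∈ φ.source}
  target := {z | z.1 ∈ φ.target ∧ IsUnit z.2.1}
  map_source' := fun p hp => ⟨φ.map_source hp, (isUnit_jac (IsManifold.chart_mem_maximalAtlas _) hφ
    (mem_chart_source _ _) hp).mul p.isUnit_frame⟩
  map_target' := by
    rintro ⟨y, u, ρ⟩ ⟨hy, hu⟩
    obtain ⟨x, hx, rfl⟩ : ∃ x ∈ φ.source, φ x = y := ⟨_, φ.map_target hy, φ.right_inv hy⟩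
    rw [ofCoord_eq hφ hx hu]; exact hx
  left_inv' := fun p hp => ofCoord_coord hφ hp
  right_inv' := by
    rintro ⟨y, u, ρ⟩ ⟨hy, hu⟩
    obtain ⟨x, hx, rfl⟩ : ∃ x ∈ φ.source, φ x = y := ⟨_, φ.map_target hy, φ.right_inv hy⟩
    rw [coord_ofCoord hφ hφ hx hx hu, jac_self hx, hess_self hx, jetChange_one, one_mul]

theorem trans_source (φ ψ : OpenPartialHomeomorph M (E n)) (hφ : φ ∈ Charts n M)
    (hψ : ψ ∈ Charts n M) : ((chart φ hφ).symm.trans (chart ψ hψ)).source =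
      {z | z.1 ∈ φ.target ∩ φ.symm ⁻¹' ψ.source ∧ IsUnit z.2.1} := by
  ext ⟨y, u, ρ⟩
  constructor
  · rintro ⟨⟨hy, hu⟩, h⟩
    obtain ⟨x, hx, rfl⟩ : ∃ x ∈ φ.source, φ x = y := ⟨_, φ.map_target hy, φ.right_inv hy⟩
    refine ⟨⟨hy, ?_⟩, hu⟩
    change (ofCoord φ (φ x, u, ρ)).base ∈ ψ.source at h
    rw [ofCoord_eq hφ hx hu] at h
    simpa [φ.left_inv hx] using h
  · rintro ⟨⟨hy, h⟩, hu⟩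
    obtain ⟨x, hx, rfl⟩ : ∃ x ∈ φ.source, φ x = y := ⟨_, φ.map_target hy, φ.right_inv hy⟩
    refine ⟨⟨hy, hu⟩, ?_⟩
    change (ofCoord φ (φ x, u, ρ)).base ∈ ψ.source
    rw [ofCoord_eq hφ hx hu]
    simpa [φ.left_inv hx] using h

theorem isOpen_trans_source (φ ψ : OpenPartialHomeomorph M (E n)) (hφ : φ ∈ Charts n M)
    (hψ : ψ ∈ Charts n M) : IsOpen ((chart φ hφ).symm.trans (chart ψ hψ)).source := by
  rw [trans_source]
  exact ((isOpen_overlap φ ψ).preimage continuous_fst).inter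
    (Units.isOpen.preimage (continuous_fst.comp continuous_snd))

theorem contDiffOn_trans (φ ψ : OpenPartialHomeomorph M (E n)) (hφ : φ ∈ Charts n M)
    (hψ : ψ ∈ Charts n M) : ContDiffOn ℝ ∞ ((chart φ hφ).symm.trans (chart ψ hψ))
      ((chart φ hφ).symm.trans (chart ψ hψ)).source := by
  have hO := (isOpen_overlap φ ψ)
  have key : ContDiffOn ℝ ∞ (fun z : VJ n => ((tr φ ψ z.1, jac φ ψ z.1 * z.2.1,
      jetChange (jac φ ψ z.1) (jac ψ φ (tr φ ψ z.1)) (hess φ ψ z.1) z.2.1 z.2.2) : VJ n))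
      {z | z.1 ∈ φ.target ∩ φ.symm ⁻¹' ψ.source ∧ IsUnit z.2.1} := by
    have hm : Set.MapsTo (fun z : VJ n => z.1)
        {z | z.1 ∈ φ.target ∩ φ.symm ⁻¹' ψ.source ∧ IsUnit z.2.1}
        (φ.target ∩ φ.symm ⁻¹' ψ.source) := fun z hz => hz.1
    have h1 := (contDiffOn_tr hφ hψ).comp contDiff_fst.contDiffOn hm
    have h2 := (contDiffOn_jac hφ hψ).comp contDiff_fst.contDiffOn hm
    have h3 := (contDiffOn_hess hφ hψ).comp contDiff_fst.contDiffOn hm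
    have h4 := (contDiffOn_jac hψ hφ).comp h1 (fun z hz =>
      ⟨ψ.map_source hz.1.2, by simpa [tr, ψ.left_inv hz.1.2] using φ.map_target hz.1.1⟩)
    have hu : ContDiffOn ℝ ∞ (fun z : VJ n => z.2.1)
      {z | z.1 ∈ φ.target ∩ φ.symm ⁻¹' ψ.source ∧ IsUnit z.2.1} :=
      (contDiff_fst.comp contDiff_snd).contDiffOn
    have hρ : ContDiffOn ℝ ∞ (fun z : VJ n => z.2.2)
      {z | z.1 ∈ φ.target ∩ φ.symm ⁻¹' ψ.source ∧ IsUnit z.2.1} :=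
      (contDiff_snd.comp contDiff_snd).contDiffOn
    refine h1.prodMk ((h2.clm_comp hu).prodMk ?_)
    unfold jetChange
    refine ContDiffOn.clm_comp (ContDiffOn.add ?_ ?_) h4
    · exact ((ContinuousLinearMap.contDiff _).comp_contDiffOn h2).clm_comp hρ
    · exact ((ContinuousLinearMap.contDiff _).comp_contDiffOn hu).clm_comp h3
  rw [trans_source]
  refine key.congr ?_
  rintro ⟨y, u, ρ⟩ ⟨⟨hy, h⟩, hu⟩
  obtain ⟨x, hx, rfl⟩ : ∃ x ∈ φ.source, φ x = y := ⟨_, φ.map_target hy, φ.right_inv hy⟩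
  have hx' : x ∈ ψ.source := by simpa [φ.left_inv hx] using h
  refine (coord_ofCoord hφ hψ hx hx' hu ρ).trans ?_
  simp [tr, φ.left_inv hx]

/-- The atlas of `J¹LM`. -/
def core (n : ℕ) (M : Type*) [TopologicalSpace M] [ChartedSpace (E n) M]
    [IsManifold (𝓡 n) ∞ M] : ChartedSpaceCore (VJ n) (J1LM n M) where
  atlas := {e | ∃ φ, ∃ hφ : φ ∈ Charts n M, e = chart φ hφ}
  chartAt p := chart (chartAt (E n) p.base) (IsManifold.chart_mem_maximalAtlas p.base)
  mem_chart_source p := mem_chart_source (E n) p.base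
  chart_mem_atlas p := ⟨_, _, rfl⟩
  open_source := by
    rintro _ _ ⟨φ, hφ, rfl⟩ ⟨ψ, hψ, rfl⟩
    exact isOpen_trans_source φ ψ hφ hψ
  continuousOn_toFun := by
    rintro _ _ ⟨φ, hφ, rfl⟩ ⟨ψ, hψ, rfl⟩
    exact (contDiffOn_trans φ ψ hφ hψ).continuousOn

instance : TopologicalSpace (J1LM n M) := (core n M).toTopologicalSpace

instance : ChartedSpace (VJ n) (J1LM n M) := (core n M).toChartedSpace

instance : IsManifold 𝓘(ℝ, VJ n) ∞ (J1LM n M) := by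
  refine isManifold_of_contDiffOn _ _ _ ?_
  intro e e' he he'
  obtain ⟨_, ⟨φ, hφ, rfl⟩, rfl⟩ := exists_of_mem_atlas (core n M) he
  obtain ⟨_, ⟨ψ, hψ, rfl⟩, rfl⟩ := exists_of_mem_atlas (core n M) he'
  have := contDiffOn_trans φ ψ hφ hψ
  simpa using! this

end J1LM

/-! ### The bundle of metrics and connections -/

section Metric

variable {n : ℕ}

/-- The entries `η^{ij} = η_{ij}` of the Lorentz metric of signature `(-,+,…,+)` on `ℝⁿ`. -/
def etaMatrix (n : ℕ) : Matrix (Fin n) (Fin n) ℝ :=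
  Matrix.diagonal fun i => if i.val = 0 then -1 else 1

/-- The Lorentz metric of `ℝⁿ` as an endomorphism. -/
def eta (n : ℕ) : L n := Matrix.toEuclideanCLM (n := Fin n) (𝕜 := ℝ) (etaMatrix n)

/-- The contravariant metric `g^{μν} = η^{kl} e_k^μ e_l^ν` for which the frame `u = (e_k^μ)` is
orthonormal. -/
def metricOf (u : L n) : L n := u * eta n * star u

/-- `g^{μν}` is the contravariant form of a metric of signature `(-,+,…,+)`. -/
def IsLorentz (g : L n) : Prop := ∃ u : L n, IsUnit u ∧ g = metricOf u

/-- The space of symmetric endomorphisms (matrices) of `ℝⁿ`. -/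
def SymOp (n : ℕ) : Type := selfAdjoint.submodule ℝ (L n)

instance : NormedAddCommGroup (SymOp n) :=
  inferInstanceAs (NormedAddCommGroup (selfAdjoint.submodule ℝ (L n)))

instance : NormedSpace ℝ (SymOp n) :=
  inferInstanceAs (NormedSpace ℝ (selfAdjoint.submodule ℝ (L n)))

instance : FiniteDimensional ℝ (SymOp n) :=
  inferInstanceAs (FiniteDimensional ℝ (selfAdjoint.submodule ℝ (L n)))

/-- The inclusion of the symmetric endomorphisms. -/
def SymOp.op : SymOp n →L[ℝ] L n :=
  LinearMap.toContinuousLinearMap (selfAdjoint.submodule ℝ (L n)).subtype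

/-- A symmetric endomorphism, as an element of `SymOp n`. -/
def SymOp.mk (A : L n) (hA : star A = A) : SymOp n := ⟨A, hA⟩

theorem SymOp.op_mk (A : L n) (hA : star A = A) : (SymOp.mk A hA).op = A := rfl

theorem SymOp.ext {g h : SymOp n} (e : g.op = h.op) : g = h := Subtype.ext e

theorem SymOp.star_op (g : SymOp n) : star g.op = g.op := g.2

theorem star_eta : star (eta n) = eta n := by
  rw [eta, ← map_star]
  congr 1
  rw [etaMatrix, Matrix.star_eq_conjTranspose, Matrix.diagonal_conjTranspose]
  congr 1

theorem eta_mul_eta : eta n * eta n = 1 := by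
  rw [eta, ← map_mul, etaMatrix, Matrix.diagonal_mul_diagonal, ← map_one
    (Matrix.toEuclideanCLM (n := Fin n) (𝕜 := ℝ)), ← Matrix.diagonal_one]
  congr 2
  ext i
  split_ifs <;> norm_num

theorem star_metricOf (u : L n) : star (metricOf u) = metricOf u := by
  simp [metricOf, star_eta, mul_assoc]

theorem IsLorentz.star_eq {g : L n} (h : IsLorentz g) : star g = g := by
  obtain ⟨u, -, rfl⟩ := h
  exact star_metricOf u

theorem IsLorentz.change {g : L n} (h : IsLorentz g) {A : L n} (hA : IsUnit A) :
    IsLorentz (A * g * star A) := by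
  obtain ⟨u, hu, rfl⟩ := h
  exact ⟨A * u, hA.mul hu, by simp [metricOf, mul_assoc]⟩

theorem isLorentz_eta : IsLorentz (eta n) := ⟨1, isUnit_one, by simp [metricOf]⟩

/-- Transposition as a continuous linear map. -/
def starL (n : ℕ) : L n →L[ℝ] L n :=
  (ContinuousLinearMap.adjoint (𝕜 := ℝ) (E := E n) (F := E n)).toContinuousLinearEquiv.toContinuousLinearMap

theorem starL_apply (A : L n) : starL n A = star A := rfl

theorem contDiff_metricOf : ContDiff ℝ ∞ (metricOf : L n → L n) := by
  have h : ContDiff ℝ ∞ fun u : L n => starL n u := (starL n).contDiff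
  exact (contDiff_id.clm_comp contDiff_const).clm_comp h

/-- The projection onto the symmetric endomorphisms. -/
def symL (n : ℕ) : L n →L[ℝ] SymOp n :=
  LinearMap.toContinuousLinearMap
    { toFun := fun A => SymOp.mk ((2⁻¹ : ℝ) • (A + starL n A)) (by
        have h1 : starL n (starL n A) = A := star_star A
        have h : starL n ((2⁻¹ : ℝ) • (A + starL n A)) = (2⁻¹ : ℝ) • (A + starL n A) := by
          rw [map_smul, map_add, h1, add_comm]
        exact h)
      map_add' := fun A B => SymOp.ext (by
        change (2⁻¹ : ℝ) • (A + B + starL n (A + B))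
          = (2⁻¹ : ℝ) • (A + starL n A) + (2⁻¹ : ℝ) • (B + starL n B)
        rw [map_add]; module)
      map_smul' := fun c A => SymOp.ext (by
        change (2⁻¹ : ℝ) • (c • A + starL n (c • A)) = c • ((2⁻¹ : ℝ) • (A + starL n A))
        rw [map_smul]; module) }

theorem symL_eq {A : L n} (hA : star A = A) : symL n A = SymOp.mk A hA := by
  refine SymOp.ext ?_
  change (2⁻¹ : ℝ) • (A + star A) = A
  rw [hA, ← two_smul ℝ A, smul_smul]
  norm_num

theorem isOpen_isLorentz : IsOpen {g : SymOp n | IsLorentz g.op} := by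
  rw [isOpen_iff_mem_nhds]
  rintro g ⟨u, ⟨v, rfl⟩, hg⟩
  have h1 : HasStrictFDerivAt (fun w : L n => w * eta n * starL n w) _ (v : L n) :=
    ((hasStrictFDerivAt_id (v : L n)).clm_comp (hasStrictFDerivAt_const (eta n) _)).clm_comp
      (starL n).hasStrictFDerivAt
  have h2 := (symL n).hasStrictFDerivAt.comp (v : L n) h1
  have hs := h2.map_nhds_eq_of_surj (by
    rw [LinearMap.range_eq_top]
    intro s
    have hss := s.star_op
    set t : L n := (2⁻¹ : ℝ) • s.op with ht
    have ht' : star t = t := by simp [ht, hss]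
    have htt : t + t = s.op := by rw [ht, ← two_smul ℝ, smul_smul]; norm_num
    have e1 : star (↑v⁻¹ : L n) * star (v : L n) = 1 := by rw [← star_mul]; simp
    refine ⟨t * star (↑v⁻¹ : L n) * eta n, ?_⟩
    have e2 : (v : L n) * eta n * star (t * star (↑v⁻¹ : L n) * eta n) = t := by
      simp only [star_mul, star_star, star_eta, ht', mul_assoc]
      rw [← mul_assoc (eta n) (eta n), eta_mul_eta, one_mul, ← mul_assoc, Units.mul_inv, one_mul]
    have e3 : t * star (↑v⁻¹ : L n) * eta n * eta n * star (v : L n) = t := by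
      rw [mul_assoc (t * star (↑v⁻¹ : L n)), eta_mul_eta, mul_one, mul_assoc, e1, mul_one]
    have e4 : symL n ((v : L n) * eta n * star (t * star (↑v⁻¹ : L n) * eta n) +
        t * star (↑v⁻¹ : L n) * eta n * eta n * star (v : L n)) = s := by
      rw [e2, e3, htt]; exact symL_eq s.star_op
    refine Eq.trans ?_ e4
    simp [starL_apply]
    rfl)
  have h3 : g = (symL n ∘ metricOf) (v : L n) := by
    rw [Function.comp_apply, ← hg, symL_eq g.star_op]; rfl
  have h4 : Filter.map (symL n ∘ metricOf) (𝓝 (v : L n)) = 𝓝 ((symL n ∘ metricOf) (v : L n)) := hs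
  rw [h3, ← h4]
  refine Filter.mem_map.2 ?_
  filter_upwards [Units.isOpen.mem_nhds v.isUnit] with w hw
  change IsLorentz (symL n (metricOf w)).op
  rw [symL_eq (star_metricOf w)]
  exact ⟨w, hw, rfl⟩

end Metric

/-- The model of `C(LM) ×_M Σ`: the coordinates `(x^μ, g^{μν}, Γ^σ_{ργ})`, with
`g^{μν} = (g e_ν)^μ` and `Γ^σ_{ργ} = (Γ e_ρ e_γ)^σ`. -/
abbrev VQ (n : ℕ) := E n × (SymOp n × (E n →L[ℝ] L n))

/-- The bundle `C(LM) ×_M Σ` where `C(LM)` is the bundle of (linear) connections of `M` and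
`Σ = LM/SO(1,n-1)`. A point over `x ∈ M` is given, in the preferred chart at `x`, by the
coefficients `Γ^σ_{ργ} = (conn e_ρ e_γ)^σ` of a connection (`ρ` is the index of differentiation), by
the contravariant components `g^{μν} = (metric e_ν)^μ` of a Lorentz metric, and by an orientation of
`T_x M` (`1` for the orientation of the chart). Two frames are related by an element of `SO(1,n-1)`
if and only if they define the same metric and the same orientation. -/
@[ext] structure CSigma (n : ℕ) (M : Type*) where
  /-- the base point -/
  base : M
  /-- the connection -/
  conn : E n →L[ℝ] L n
  /-- the metric -/
  metric : L n
  /-- the orientation -/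
  orient : ℤˣ
  isLorentz_metric : IsLorentz metric

namespace CSigma

variable {n : ℕ} {M : Type*} [TopologicalSpace M] [ChartedSpace (E n) M]

/-- The connection coefficients `Γ^σ_{ργ}` in the chart `φ`. -/
def connIn (φ : OpenPartialHomeomorph M (E n)) (q : CSigma n M) : E n →L[ℝ] L n :=
  let c := chartAt (E n) q.base
  connChange (jac c φ (c q.base)) (jac φ c (φ q.base)) (hess c φ (c q.base)) q.conn

/-- The contravariant metric components `g^{μν}` in the chart `φ`. -/
def metricIn (φ : OpenPartialHomeomorph M (E n)) (q : CSigma n M) : L n :=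
  let c := chartAt (E n) q.base
  jac c φ (c q.base) * q.metric * star (jac c φ (c q.base))

/-- The orientation, relative to the one of the chart `φ`. -/
def orientIn (φ : OpenPartialHomeomorph M (E n)) (q : CSigma n M) : ℤˣ :=
  let c := chartAt (E n) q.base
  sgn (det (jac c φ (c q.base))) * q.orient

theorem star_metricIn (φ : OpenPartialHomeomorph M (E n)) (q : CSigma n M) :
    star (metricIn φ q) = metricIn φ q := by
  have h : star q.metric = q.metric := q.isLorentz_metric.star_eq
  simp [metricIn, h, mul_assoc]

/-- The coordinates `(x^μ, g^{μν}, Γ^σ_{ργ})` of a point in the chart `φ` of `M`. -/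
def coord (φ : OpenPartialHomeomorph M (E n)) (q : CSigma n M) : VQ n :=
  (φ q.base, SymOp.mk (metricIn φ q) (star_metricIn φ q), connIn φ q)

open Classical in
/-- The point with given coordinates and given orientation `o` in the chart `φ`. -/
def ofCoord (φ : OpenPartialHomeomorph M (E n)) (o : ℤˣ) (z : VQ n) : CSigma n M :=
  let x := φ.symm z.1
  let c := chartAt (E n) x
  if h : IsLorentz (jac φ c z.1 * z.2.1.op * star (jac φ c z.1)) then
    ⟨x, connChange (jac φ c z.1) (jac c φ (c x)) (hess φ c z.1) z.2.2,
      jac φ c z.1 * z.2.1.op * star (jac φ c z.1), sgn (det (jac φ c z.1)) * o, h⟩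
  else ⟨x, 0, eta n, 1, isLorentz_eta⟩

variable [IsManifold (𝓡 n) ∞ M]

theorem ofCoord_eq {φ : OpenPartialHomeomorph M (E n)} (hφ : φ ∈ Charts n M) (o : ℤˣ) {x : M}
    (hx : x ∈ φ.source) {g : SymOp n} (hg : IsLorentz g.op) (Γ : E n →L[ℝ] L n) :
    ofCoord φ o (φ x, g, Γ) = ⟨x,
      connChange (jac φ (chartAt (E n) x) (φ x)) (jac (chartAt (E n) x) φ (chartAt (E n) x x))
        (hess φ (chartAt (E n) x) (φ x)) Γ,
      jac φ (chartAt (E n) x) (φ x) * g.op * star (jac φ (chartAt (E n) x) (φ x)),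
      sgn (det (jac φ (chartAt (E n) x) (φ x))) * o,
      hg.change
        (isUnit_jac hφ (IsManifold.chart_mem_maximalAtlas x) hx (mem_chart_source _ x))⟩ := by
  have h := hg.change (isUnit_jac hφ (IsManifold.chart_mem_maximalAtlas x) hx
    (mem_chart_source (E n) x))
  simp only [ofCoord]
  rw [dif_pos (by rw [φ.left_inv hx]; exact h)]
  simp only [φ.left_inv hx]

theorem coord_ofCoord {φ ψ : OpenPartialHomeomorph M (E n)} (hφ : φ ∈ Charts n M)
    (hψ : ψ ∈ Charts n M) (o : ℤˣ) {x : M} (hx : x ∈ φ.source) (hx' : x ∈ ψ.source)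
    {g : SymOp n} (hg : IsLorentz g.op) (Γ : E n →L[ℝ] L n) :
    coord ψ (ofCoord φ o (φ x, g, Γ)) =
      (ψ x, SymOp.mk (jac φ ψ (φ x) * g.op * star (jac φ ψ (φ x)))
        (hg.change (isUnit_jac hφ hψ hx hx')).star_eq,
      connChange (jac φ ψ (φ x)) (jac ψ φ (ψ x)) (hess φ ψ (φ x)) Γ) := by
  have hc := IsManifold.chart_mem_maximalAtlas (I := 𝓡 n) (n := ∞) x
  have hcx := mem_chart_source (E n) x
  rw [ofCoord_eq hφ o hx hg]
  refine Prod.ext rfl (Prod.ext (SymOp.ext ?_) ?_)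
  · simp only [coord, metricIn, SymOp.op_mk]
    rw [jac_comp hφ hc hψ hx hcx hx', star_mul]
    simp only [mul_assoc]
  · simp only [coord, connIn]
    rw [connChange_connChange (hB := hess_comp hφ hc hψ hx hcx hx')
      (hAD := jac_mul_jac hc hφ hcx hx), ← jac_comp hφ hc hψ hx hcx hx',
      ← jac_comp hψ hc hφ hx' hcx hx]

theorem orientIn_ofCoord {φ ψ : OpenPartialHomeomorph M (E n)} (hφ : φ ∈ Charts n M)
    (hψ : ψ ∈ Charts n M) (o : ℤˣ) {x : M} (hx : x ∈ φ.source) (hx' : x ∈ ψ.source)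
    {g : SymOp n} (hg : IsLorentz g.op) (Γ : E n →L[ℝ] L n) :
    orientIn ψ (ofCoord φ o (φ x, g, Γ)) = sgn (det (jac φ ψ (φ x))) * o := by
  have hc := IsManifold.chart_mem_maximalAtlas (I := 𝓡 n) (n := ∞) x
  have hcx := mem_chart_source (E n) x
  rw [ofCoord_eq hφ o hx hg]
  simp only [orientIn]
  rw [jac_comp hφ hc hψ hx hcx hx', det_mul, sgn_mul (det_ne_zero (isUnit_jac hc hψ hcx hx'))
    (det_ne_zero (isUnit_jac hφ hc hx hcx)), mul_assoc]

theorem ofCoord_coord {φ : OpenPartialHomeomorph M (E n)} (hφ : φ ∈ Charts n M)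
    {q : CSigma n M} (hq : q.base ∈ φ.source) : ofCoord φ (orientIn φ q) (coord φ q) = q := by
  have hc := IsManifold.chart_mem_maximalAtlas (I := 𝓡 n) (n := ∞) q.base
  have hcx := mem_chart_source (E n) q.base
  have h1 := jac_mul_jac hc hφ hcx hq
  simp only [coord]
  rw [ofCoord_eq hφ _ hq (q.isLorentz_metric.change (isUnit_jac hc hφ hcx hq))]
  ext1
  · rfl
  · simp only [connIn]
    rw [connChange_connChange (hB := hess_comp hc hφ hc hcx hq hcx)
      (hAD := jac_mul_jac hφ hc hq hcx), h1, hess_self hcx, connChange_one]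
  · simp only [metricIn, SymOp.op_mk]
    calc _ = (jac φ (chartAt (E n) q.base) (φ q.base) *
          jac (chartAt (E n) q.base) φ (chartAt (E n) q.base q.base)) * q.metric *
          star (jac φ (chartAt (E n) q.base) (φ q.base) *
          jac (chartAt (E n) q.base) φ (chartAt (E n) q.base q.base)) := by
            rw [star_mul]; simp only [mul_assoc]
      _ = q.metric := by rw [h1]; simp
  · simp only [orientIn]
    rw [← mul_assoc, ← sgn_mul (det_ne_zero (isUnit_jac hφ hc hq hcx))
      (det_ne_zero (isUnit_jac hc hφ hcx hq)), ← det_mul, h1, det_one]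
    simp [sgn]

/-- The chart of `C(LM) ×_M Σ` given by the coordinates associated with a chart `φ` of `M`, on the
set of the points with orientation `o` relative to `φ`. -/
def chart (φ : OpenPartialHomeomorph M (E n)) (hφ : φ ∈ Charts n M) (o : ℤˣ) :
    PartialEquiv (CSigma n M) (VQ n) where
  toFun := coord φ
  invFun := ofCoord φ o
  source := {q | q.base ∈ φ.source ∧ orientIn φ q = o}
  target := {z | z.1 ∈ φ.target ∧ IsLorentz z.2.1.op}
  map_source' := fun q hq => ⟨φ.map_source hq.1, q.isLorentz_metric.change
    (isUnit_jac (IsManifold.chart_mem_maximalAtlas _) hφ (mem_chart_source _ _) hq.1)⟩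
  map_target' := by
    rintro ⟨y, g, Γ⟩ ⟨hy, hg⟩
    obtain ⟨x, hx, rfl⟩ : ∃ x ∈ φ.source, φ x = y := ⟨_, φ.map_target hy, φ.right_inv hy⟩
    refine ⟨by rw [ofCoord_eq hφ o hx hg]; exact hx, ?_⟩
    rw [orientIn_ofCoord hφ hφ o hx hx hg, jac_self hx, det_one]; simp [sgn]
  left_inv' := by
    rintro q ⟨hq, rfl⟩
    exact ofCoord_coord hφ hq
  right_inv' := by
    rintro ⟨y, g, Γ⟩ ⟨hy, hg⟩
    obtain ⟨x, hx, rfl⟩ : ∃ x ∈ φ.source, φ x = y := ⟨_, φ.map_target hy, φ.right_inv hy⟩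
    rw [coord_ofCoord hφ hφ o hx hx hg]
    simp only [jac_self hx, hess_self hx, connChange_one, one_mul, star_one, mul_one]
    rfl

theorem trans_source (φ ψ : OpenPartialHomeomorph M (E n)) (hφ : φ ∈ Charts n M)
    (hψ : ψ ∈ Charts n M) (o o' : ℤˣ) : ((chart φ hφ o).symm.trans (chart ψ hψ o')).source =
      {z | (z.1 ∈ φ.target ∩ φ.symm ⁻¹' ψ.source ∧ sgn (det (jac φ ψ z.1)) * o = o')
        ∧ IsLorentz z.2.1.op} := by
  ext ⟨y, g, Γ⟩
  constructor
  · rintro ⟨⟨hy, hg⟩, h, h'⟩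
    obtain ⟨x, hx, rfl⟩ : ∃ x ∈ φ.source, φ x = y := ⟨_, φ.map_target hy, φ.right_inv hy⟩
    change (ofCoord φ o (φ x, g, Γ)).base ∈ ψ.source at h
    change orientIn ψ (ofCoord φ o (φ x, g, Γ)) = o' at h'
    rw [ofCoord_eq hφ o hx hg] at h
    rw [orientIn_ofCoord hφ hψ o hx h hg] at h'
    exact ⟨⟨⟨hy, by simpa [φ.left_inv hx] using h⟩, h'⟩, hg⟩
  · rintro ⟨⟨⟨hy, h⟩, h'⟩, hg⟩
    obtain ⟨x, hx, rfl⟩ : ∃ x ∈ φ.source, φ x = y := ⟨_, φ.map_target hy, φ.right_inv hy⟩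
    have hx' : x ∈ ψ.source := by simpa [φ.left_inv hx] using h
    refine ⟨⟨hy, hg⟩, ?_, ?_⟩
    · change (ofCoord φ o (φ x, g, Γ)).base ∈ ψ.source
      rw [ofCoord_eq hφ o hx hg]; exact hx'
    · change orientIn ψ (ofCoord φ o (φ x, g, Γ)) = o'
      rw [orientIn_ofCoord hφ hψ o hx hx' hg]; exact h'

theorem isOpen_trans_source (φ ψ : OpenPartialHomeomorph M (E n)) (hφ : φ ∈ Charts n M)
    (hψ : ψ ∈ Charts n M) (o o' : ℤˣ) :
    IsOpen ((chart φ hφ o).symm.trans (chart ψ hψ o')).source := by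
  rw [trans_source]
  refine IsOpen.inter (IsOpen.preimage (f := fun z : VQ n => z.1) (t := {y |
    y ∈ φ.target ∩ φ.symm ⁻¹' ψ.source ∧ sgn (det (jac φ ψ y)) * o = o'}) continuous_fst ?_)
    (isOpen_isLorentz.preimage (continuous_fst.comp continuous_snd))
  rw [isOpen_iff_mem_nhds]
  rintro y ⟨hy, rfl⟩
  have hd : ContinuousAt (fun y => det (jac φ ψ y)) y :=
    continuous_det.continuousAt.comp
      ((contDiffOn_jac hφ hψ).continuousOn.continuousAt ((isOpen_overlap φ ψ).mem_nhds hy))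
  have hne : det (jac φ ψ y) ≠ 0 := by
    have := det_ne_zero (isUnit_jac hφ hψ (φ.map_target hy.1) hy.2)
    rwa [φ.right_inv hy.1] at this
  have hs : ∀ᶠ y' in 𝓝 y, sgn (det (jac φ ψ y')) = sgn (det (jac φ ψ y)) := by
    rcases lt_or_gt_of_ne hne with h | h
    · filter_upwards [hd.eventually_lt continuousAt_const h] with y' hy'
      simp [sgn, h.not_gt, hy'.not_gt]
    · filter_upwards [continuousAt_const.eventually_lt hd h] with y' hy'
      simp [sgn, h, hy']
  filter_upwards [hs, (isOpen_overlap φ ψ).mem_nhds hy] with y' h1 h2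
  exact ⟨h2, by rw [h1]⟩

theorem contDiffOn_trans (φ ψ : OpenPartialHomeomorph M (E n)) (hφ : φ ∈ Charts n M)
    (hψ : ψ ∈ Charts n M) (o o' : ℤˣ) :
    ContDiffOn ℝ ∞ ((chart φ hφ o).symm.trans (chart ψ hψ o'))
      ((chart φ hφ o).symm.trans (chart ψ hψ o')).source := by
  rw [trans_source]
  set S : Set (VQ n) := {z | (z.1 ∈ φ.target ∩ φ.symm ⁻¹' ψ.source ∧
    sgn (det (jac φ ψ z.1)) * o = o') ∧ IsLorentz z.2.1.op} with hS
  have key : ContDiffOn ℝ ∞ (fun z : VQ n => ((tr φ ψ z.1,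
      symL n (jac φ ψ z.1 * z.2.1.op * starL n (jac φ ψ z.1)),
      connChange (jac φ ψ z.1) (jac ψ φ (tr φ ψ z.1)) (hess φ ψ z.1) z.2.2) : VQ n)) S := by
    have hm : Set.MapsTo (fun z : VQ n => z.1) S (φ.target ∩ φ.symm ⁻¹' ψ.source) :=
      fun z hz => hz.1.1
    have h1 := (contDiffOn_tr hφ hψ).comp contDiff_fst.contDiffOn hm
    have h2 := (contDiffOn_jac hφ hψ).comp contDiff_fst.contDiffOn hm
    have h3 := (contDiffOn_hess hφ hψ).comp contDiff_fst.contDiffOn hm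
    have h4 := (contDiffOn_jac hψ hφ).comp h1 (fun z hz =>
      ⟨ψ.map_source hz.1.1.2, by simpa [tr, ψ.left_inv hz.1.1.2] using φ.map_target hz.1.1.1⟩)
    have hg : ContDiffOn ℝ ∞ (fun z : VQ n => z.2.1.op) S :=
      (SymOp.op.contDiff.comp (contDiff_fst.comp contDiff_snd)).contDiffOn
    have hΓ : ContDiffOn ℝ ∞ (fun z : VQ n => z.2.2) S :=
      (contDiff_snd.comp contDiff_snd).contDiffOn
    refine h1.prodMk (((symL n).contDiff.comp_contDiffOn
      ((h2.clm_comp hg).clm_comp ((starL n).contDiff.comp_contDiffOn h2))).prodMk ?_)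
    unfold connChange
    refine ContDiffOn.clm_comp (ContDiffOn.clm_comp ?_ (ContDiffOn.sub ?_ h3)) h4
    · exact (ContinuousLinearMap.contDiff _).comp_contDiffOn h4
    · exact ((ContinuousLinearMap.contDiff _).comp_contDiffOn h2).clm_comp hΓ
  refine key.congr ?_
  rintro ⟨y, g, Γ⟩ ⟨⟨⟨hy, h⟩, h'⟩, hg⟩
  obtain ⟨x, hx, rfl⟩ : ∃ x ∈ φ.source, φ x = y := ⟨_, φ.map_target hy, φ.right_inv hy⟩
  have hx' : x ∈ ψ.source := by simpa [φ.left_inv hx] using h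
  refine (coord_ofCoord hφ hψ o hx hx' hg Γ).trans ?_
  simp only [tr, φ.left_inv hx, starL_apply,
    symL_eq (hg.change (isUnit_jac hφ hψ hx hx')).star_eq]

/-- The atlas of `C(LM) ×_M Σ`. -/
def core (n : ℕ) (M : Type*) [TopologicalSpace M] [ChartedSpace (E n) M]
    [IsManifold (𝓡 n) ∞ M] : ChartedSpaceCore (VQ n) (CSigma n M) where
  atlas := {e | ∃ φ, ∃ hφ : φ ∈ Charts n M, ∃ o, e = chart φ hφ o}
  chartAt q := chart (chartAt (E n) q.base) (IsManifold.chart_mem_maximalAtlas q.base)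
    (orientIn (chartAt (E n) q.base) q)
  mem_chart_source q := ⟨mem_chart_source (E n) q.base, rfl⟩
  chart_mem_atlas q := ⟨_, _, _, rfl⟩
  open_source := by
    rintro _ _ ⟨φ, hφ, o, rfl⟩ ⟨ψ, hψ, o', rfl⟩
    exact isOpen_trans_source φ ψ hφ hψ o o'
  continuousOn_toFun := by
    rintro _ _ ⟨φ, hφ, o, rfl⟩ ⟨ψ, hψ, o', rfl⟩
    exact (contDiffOn_trans φ ψ hφ hψ o o').continuousOn

instance : TopologicalSpace (CSigma n M) := (core n M).toTopologicalSpace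

instance : ChartedSpace (VQ n) (CSigma n M) := (core n M).toChartedSpace

instance : IsManifold 𝓘(ℝ, VQ n) ∞ (CSigma n M) := by
  refine isManifold_of_contDiffOn _ _ _ ?_
  intro e e' he he'
  obtain ⟨_, ⟨φ, hφ, o, rfl⟩, rfl⟩ := exists_of_mem_atlas (core n M) he
  obtain ⟨_, ⟨ψ, hψ, o', rfl⟩, rfl⟩ := exists_of_mem_atlas (core n M) he'
  have := contDiffOn_trans φ ψ hφ hψ o o'
  simpa using! this

end CSigma

/-! ### The Lorentz group and its action -/

/-- The Lorentz group `SO(1,n-1)`. -/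
def lorentzGroup (n : ℕ) : Subgroup (L n)ˣ where
  carrier := {A | metricOf (A : L n) = eta n ∧ det (A : L n) = 1}
  mul_mem' := by
    rintro A B ⟨hA, hA'⟩ ⟨hB, hB'⟩
    refine ⟨?_, by rw [Units.val_mul, det_mul, hA', hB', one_mul]⟩
    have : metricOf ((A * B : (L n)ˣ) : L n) = A * metricOf (B : L n) * star (A : L n) := by
      simp [metricOf, mul_assoc]
    rw [this, hB]; exact hA
  one_mem' := ⟨by simp [metricOf], by rw [Units.val_one, det_one]⟩
  inv_mem' := by
    rintro A ⟨hA, hA'⟩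
    have e1 : star (A : L n) * star (↑A⁻¹ : L n) = 1 := by rw [← star_mul]; simp
    constructor
    · calc metricOf (↑A⁻¹ : L n) = ↑A⁻¹ * metricOf (A : L n) * star (↑A⁻¹ : L n) := by
            rw [hA]; rfl
        _ = eta n := by
            simp only [metricOf, mul_assoc, e1, mul_one, Units.inv_mul_cancel_left]
    · have h : det ((A : L n) * (↑A⁻¹ : L n)) = 1 := by rw [Units.mul_inv, det_one]
      rwa [det_mul, hA', one_mul] at h

namespace J1LM

variable {n : ℕ} {M : Type*}

/-- The right action of `GL(n)` on `J¹LM`: `(x^μ, e_k^μ, e_{kν}^μ) ↦ (x^μ, A^l_k e_l^μ, A^l_k e_{lν}^μ)`. -/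
def rmul (p : J1LM n M) (A : (L n)ˣ) : J1LM n M :=
  ⟨p.base, p.frame * A, ((ContinuousLinearMap.compL ℝ (E n) (E n) (E n)).flip (A : L n)).comp p.jet,
    p.isUnit_frame.mul A.isUnit⟩

/-- The projection `p_H : J¹LM → J¹LM/H = C(LM) ×_M Σ`,
`g^{μν} = η^{kl} e_k^μ e_l^ν`, `Γ^σ_{ργ} = -e^σ_{kρ} e^k_γ`; the orientation is the one of the
frame. -/
def toCSigma (p : J1LM n M) : CSigma n M :=
  ⟨p.base,
    -((ContinuousLinearMap.compL ℝ (E n) (E n) (E n)).flip (Ring.inverse p.frame)).comp p.jet,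
    metricOf p.frame, sgn (det p.frame), ⟨p.frame, p.isUnit_frame, rfl⟩⟩

end J1LM

/-! ### The canonical forms, the Palatini Lagrangian and the differential system on `J¹LM` -/

/-- A field of linear functionals, as a form of degree one. -/
def oneForm {V : Type*} [NormedAddCommGroup V] [NormedSpace ℝ V] {X : Type*} [TopologicalSpace X]
    [ChartedSpace V X] (a : (x : X) → TangentSpace 𝓘(ℝ, V) x →L[ℝ] ℝ) : DForm V X 1 :=
  fun x => ContinuousAlternatingMap.ofSubsingleton ℝ (TangentSpace 𝓘(ℝ, V) x) ℝ (0 : Fin 1) (a x)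

/-- The Levi-Civita symbol `ε_{f(1) ⋯ f(n)}`. -/
def leviCivita {n : ℕ} (f : Fin n → Fin n) : ℝ := ((1 : Matrix (Fin n) (Fin n) ℝ).submatrix f id).det

section Forms

variable (n : ℕ) (M : Type*) [TopologicalSpace M] [ChartedSpace (E n) M] [IsManifold (𝓡 n) ∞ M]

/-- Differential forms on `J¹LM`. -/
abbrev FormJ (k : ℕ) := DForm (VJ n) (J1LM n M) k

/-- Differential forms on `C(LM) ×_M Σ`. -/
abbrev FormQ (k : ℕ) := DForm (VQ n) (CSigma n M) k

variable {n M}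

/-- The tautological form `θ` of `J¹LM`, with values in `ℝⁿ`, in the jet coordinates of a chart `φ`:
`θ^k = e^k_μ dx^μ`. -/
def thetaIn (φ : OpenPartialHomeomorph M (E n)) (p : J1LM n M) :
    TangentSpace 𝓘(ℝ, VJ n) p →L[ℝ] E n :=
  let z : VJ n := J1LM.coord φ p
  let dz : TangentSpace 𝓘(ℝ, VJ n) p →L[ℝ] VJ n :=
    mfderiv 𝓘(ℝ, VJ n) 𝓘(ℝ, VJ n) (J1LM.coord φ) p
  (Ring.inverse z.2.1).comp ((ContinuousLinearMap.fst ℝ (E n) (L n × (E n →L[ℝ] L n))).comp dz)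

/-- The canonical connection form `ω` of `J¹LM`, with values in `𝔤𝔩(n)`, in the jet coordinates of a
chart `φ`: `ω^k_l = e^k_μ (de^μ_l - e^μ_{lσ} dx^σ)`. -/
def omegaIn (φ : OpenPartialHomeomorph M (E n)) (p : J1LM n M) :
    TangentSpace 𝓘(ℝ, VJ n) p →L[ℝ] L n :=
  let z : VJ n := J1LM.coord φ p
  let dz : TangentSpace 𝓘(ℝ, VJ n) p →L[ℝ] VJ n :=
    mfderiv 𝓘(ℝ, VJ n) 𝓘(ℝ, VJ n) (J1LM.coord φ) p
  let dx := (ContinuousLinearMap.fst ℝ (E n) (L n × (E n →L[ℝ] L n))).comp dz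
  let de := ((ContinuousLinearMap.fst ℝ (L n) (E n →L[ℝ] L n)).comp
    (ContinuousLinearMap.snd ℝ (E n) (L n × (E n →L[ℝ] L n)))).comp dz
  (ContinuousLinearMap.compL ℝ (E n) (E n) (E n) (Ring.inverse z.2.1)).comp (de - z.2.2.comp dx)

/-- The component `θ^i` of the tautological form of `J¹LM` (computed in the preferred charts; it does
not depend on the chart). -/
def theta (i : Fin n) : FormJ n M 1 :=
  oneForm fun p => (EuclideanSpace.proj i).comp (thetaIn (chartAt (E n) p.base) p)

/-- The component `ω^i_j` of the canonical connection form of `J¹LM` (computed in the preferred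
charts; it does not depend on the chart). -/
def omega (i j : Fin n) : FormJ n M 1 :=
  oneForm fun p => (entry i j).comp (omegaIn (chartAt (E n) p.base) p)

/-- The universal torsion `T^i = dθ^i + ω^i_k ∧ θ^k`. -/
def torsion (i : Fin n) : FormJ n M 2 :=
  (theta i).ext + ∑ k, (omega i k).wedge (theta k)

/-- The curvature `Ω^i_j = dω^i_j + ω^i_k ∧ ω^k_j`. -/
def curvature (i j : Fin n) : FormJ n M 2 :=
  (omega i j).ext + ∑ k, (omega i k).wedge (omega k j)

/-- The metricity forms `(π_𝔭 ω)^{ij} = η^{ik} ω^j_k + η^{jk} ω^i_k`. -/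
def metricity (i j : Fin n) : FormJ n M 1 :=
  ∑ k, (etaMatrix n i k • omega j k + etaMatrix n j k • omega i k)

/-- The generators of the differential system `I_PG`. -/
inductive PGGenerator : (k : ℕ) → FormJ n M k → Prop
  | metricity (i j : Fin n) : PGGenerator 1 (metricity i j)
  | torsion (i : Fin n) : PGGenerator 2 (torsion i)

variable (n M) in
/-- The differential system `I_PG = ⟨π_𝔭 ω, T⟩_diff` on `J¹LM`. -/
def IPG (k : ℕ) (ξ : FormJ n M k) : Prop := DiffIdeal Set.univ PGGenerator k ξ

/-! ### Coordinate expressions on `C(LM) ×_M Σ` -/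

namespace CSigma

variable (φ : OpenPartialHomeomorph M (E n))

/-- The coordinate `x^γ`. -/
def x (γ : Fin n) (q : CSigma n M) : ℝ := φ q.base γ

/-- The coordinate `g^{μν}`. -/
def g (μ ν : Fin n) (q : CSigma n M) : ℝ := entry μ ν (metricIn φ q)

/-- The coordinate `Γ^σ_{ργ}`. -/
def Γ (σ ρ γ : Fin n) (q : CSigma n M) : ℝ :=
  entry σ γ (connIn φ q (EuclideanSpace.single ρ (1 : ℝ)))

/-- `dx^γ` -/
def dx (γ : Fin n) : FormQ n M 1 := DForm.dFun (x φ γ)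

/-- `dg^{μν} + (g^{μσ} Γ^ν_{γσ} + g^{νσ} Γ^μ_{γσ}) dx^γ` -/
def metricityForm (μ ν : Fin n) : FormQ n M 1 :=
  DForm.dFun (g φ μ ν) + ∑ γ, ∑ σ, DForm.fmul
    (fun q => g φ μ σ q * Γ φ ν γ σ q + g φ ν σ q * Γ φ μ γ σ q) (dx φ γ)

/-- The torsion form `(Γ^σ_{μν} - Γ^σ_{νμ}) dx^μ ∧ dx^ν`. -/
def torsionForm (σ : Fin n) : FormQ n M 2 :=
  ∑ μ, ∑ ν, DForm.fmul (fun q => Γ φ σ μ ν q - Γ φ σ ν μ q) ((dx φ μ).wedge (dx φ ν))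

/-- `dΓ^γ_{ρκ} ∧ dx^ρ + Γ^σ_{δκ} Γ^γ_{βσ} dx^β ∧ dx^δ` -/
def curvatureForm (γ κ : Fin n) : FormQ n M 2 :=
  ∑ ρ, (DForm.dFun (Γ φ γ ρ κ)).wedge (dx φ ρ)
    + ∑ σ, ∑ β, ∑ δ, DForm.fmul (fun q => Γ φ σ δ κ q * Γ φ γ β σ q) ((dx φ β).wedge (dx φ δ))

/-- The generators of the Levi-Civita differential system in the chart `φ`. -/
inductive LCGenerator : (k : ℕ) → FormQ n M k → Prop
  | metricity (μ ν : Fin n) : LCGenerator 1 (metricityForm φ μ ν)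
  | torsion (σ : Fin n) : LCGenerator 2 (torsionForm φ σ)

/-- `√(-det g)`, where `det g = det (g_{μν})` is the inverse of `det (g^{μν})`. -/
def sqrtNegDet (q : CSigma n M) : ℝ := √(-(det (metricIn φ q))⁻¹)

end CSigma

end Forms

section Lagrangian

variable {m : ℕ} {M : Type*} [TopologicalSpace M] [ChartedSpace (E (m + 2)) M]
  [IsManifold (𝓡 (m + 2)) ∞ M]

/-- The `(n-2)`-forms `θ_{kl} = 1/(n-2)! ε_{kl i_3 ⋯ i_n} θ^{i_3} ∧ ⋯ ∧ θ^{i_n}`, for `n = m + 2`. -/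
def thetaLow (k l : Fin (m + 2)) : FormJ (m + 2) M m :=
  ((m.factorial : ℝ)⁻¹) • ∑ i : Fin m → Fin (m + 2),
    leviCivita (Matrix.vecCons k (Matrix.vecCons l i)) • DForm.wedgeProd m fun a => theta (i a)

variable (m M) in
/-- The Palatini Lagrangian `λ_PG = η^{kp} θ_{kl} ∧ Ω^l_p`, of degree `n = m + 2`. -/
def lambdaPG : FormJ (m + 2) M (m + 2) :=
  ∑ k, ∑ l, ∑ p, etaMatrix (m + 2) k p • (thetaLow k l).wedge (curvature l p)

/-- In the chart `φ`, with `o = ±1` the orientation relative to `φ`, the form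
`-(o/(n-2)!) ε_{μ_1 ⋯ μ_{n-2} γ κ} √(-det g) g^{κτ} dx^{μ_1} ∧ ⋯ ∧ dx^{μ_{n-2}} ∧
  (dΓ^γ_{ρτ} ∧ dx^ρ + Γ^σ_{δτ} Γ^γ_{βσ} dx^β ∧ dx^δ)`. -/
def CSigma.lagrangian (φ : OpenPartialHomeomorph M (E (m + 2))) : FormQ (m + 2) M (m + 2) :=
  ∑ μ : Fin m → Fin (m + 2), ∑ γ, ∑ κ, ∑ τ, DForm.fmul
    (fun q => -(((CSigma.orientIn φ q : ℤˣ) : ℤ) : ℝ) * (m.factorial : ℝ)⁻¹ *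
      leviCivita (Fin.append μ ![γ, κ]) * CSigma.sqrtNegDet φ q * CSigma.g φ κ τ q)
    ((DForm.wedgeProd m fun a => CSigma.dx φ (μ a)).wedge (CSigma.curvatureForm φ γ τ))

end Lagrangian

end PalatiniGravity

end

open PalatiniGravity

open scoped Manifold ContDiff Topology

noncomputable section

namespace PalatiniGravity

/-! In the jet coordinates of a chart write u for the matrix of the frame and ρ for its derivatives.
Then θ = u⁻¹ dx, ω = u⁻¹(du − ρ dx), and p_H is (x, u, ρ) ↦ (x, uηuᵀ, −ρu⁻¹), which is `projModel`.
Three matrix identities carry the theorem. Pulled back along p_H, the metricity form of the quotient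
is u(ωη + ηωᵀ)uᵀ (`metricity_model`), its torsion form is 2uT (`torsion_model`), and its curvature
form is uΩu⁻¹ (`curvature_model`). As u is invertible, over the domain of a chart the generators of
`IPG` and the pulled-back Levi-Civita generators are combinations of each other with smooth
functions as coefficients.

The quotient. The action is free because frames are invertible. It is proper because A = u⁻¹(uA)
converges whenever u and uA converge to frames. Two frames with the same metric differ by some A
with AηAᵀ = η, hence det A = ±1, and the orientation selects det A = 1 (`toCSigma_eq_iff`). Right
multiplication of a frame by η keeps the metric and reverses the orientation, so p_H is onto. Its
differential is onto by an explicit solution (`dprojModel_surjective`), so p_H has smooth local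
sections (`exists_local_section`).

The differential system. If the generators of one ideal pull back to function combinations of the
generators of another, the whole differential ideal pulls back into the other, by the Leibniz rule
(`DiffIdeal.pullback`). This gives the invariance under H, since p_H ∘ R_A = p_H, and one half of
the description of the reduced system. For the other half take a local section s of p_H. Then α =
s^*(p_H^*α), and s^* sends the generators of `IPG` to combinations of the Levi-Civita generators.
These arguments are local, and they become global because membership in a finitely generated
differential ideal is a local property, by a partition of unity (`DiffIdeal.of_local`).

The Lagrangian. Expanding θ and Ω in the pulled-back forms dx and curvature forms leaves a
comparison of coefficients (`palatini_coefficient`). It is the expansion of a determinant with one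
factor missing (`sum_leviCivita_minor`), together with det u⁻¹ = o√(−det g), which holds because
det(g^{μν}) = −(det u)². Uniqueness holds because p_H is a surjective submersion, and smoothness is
read off from local sections.

Integral sections. A Levi-Civita generator cut off by a bump function of the base point lies in the
reduced system, so an integral section satisfies the equations at every point
(`exists_reducedEDS_eq`). Conversely, if all generators vanish along a section, the ideal pulls back
into the ideal without generators, which is zero. -/

set_option maxSynthPendingDepth 3

/-! ### Algebra of the wedge product -/

section WedgeAlgebra

open Equiv

/-- A permutation of the first `k` of `k + l` indices. -/
def permCastAdd {k : ℕ} (l : ℕ) (σ : Perm (Fin k)) : Perm (Fin (k + l)) :=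
  finSumFinEquiv.permCongr (Perm.sumCongr σ 1)

/-- A permutation of the last `l` of `k + l` indices. -/
def permNatAdd (k : ℕ) {l : ℕ} (σ : Perm (Fin l)) : Perm (Fin (k + l)) :=
  finSumFinEquiv.permCongr (Perm.sumCongr 1 σ)

theorem permCastAdd_castAdd {k l : ℕ} (σ : Perm (Fin k)) (i : Fin k) :
    permCastAdd l σ (Fin.castAdd l i) = Fin.castAdd l (σ i) := by
  simp [permCastAdd, Equiv.permCongr_apply]

theorem permCastAdd_natAdd {k l : ℕ} (σ : Perm (Fin k)) (i : Fin l) :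
    permCastAdd l σ (Fin.natAdd k i) = Fin.natAdd k i := by
  simp [permCastAdd, Equiv.permCongr_apply]

theorem permNatAdd_castAdd {k l : ℕ} (σ : Perm (Fin l)) (i : Fin k) :
    permNatAdd k σ (Fin.castAdd l i) = Fin.castAdd l i := by
  simp [permNatAdd, Equiv.permCongr_apply]

theorem permNatAdd_natAdd {k l : ℕ} (σ : Perm (Fin l)) (i : Fin l) :
    permNatAdd k σ (Fin.natAdd k i) = Fin.natAdd k (σ i) := by
  simp [permNatAdd, Equiv.permCongr_apply]

theorem sign_permCastAdd {k l : ℕ} (σ : Perm (Fin k)) :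
    Perm.sign (permCastAdd l σ) = Perm.sign σ := by
  rw [permCastAdd, Perm.sign_permCongr, Perm.sign_sumCongr]; simp

theorem sign_permNatAdd {k l : ℕ} (σ : Perm (Fin l)) :
    Perm.sign (permNatAdd k σ) = Perm.sign σ := by
  rw [permNatAdd, Perm.sign_permCongr, Perm.sign_sumCongr]; simp

/-- The signed sum of `F` over all permutations of the arguments. -/
def altSum {V : Type*} {N : ℕ} (F : (Fin N → V) → ℝ) (v : Fin N → V) : ℝ :=
  ∑ σ : Perm (Fin N), ((Perm.sign σ : ℤ) : ℝ) * F (v ∘ σ)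

/-- Reindexing by σ ↦ στ turns the product of the two signs into the sign of στ. -/
theorem altSum_comp_perm {V : Type*} {N : ℕ} (F : (Fin N → V) → ℝ) (v : Fin N → V)
    (τ : Perm (Fin N)) :
    ∑ σ : Perm (Fin N), ((Perm.sign σ : ℤ) : ℝ) * (((Perm.sign τ : ℤ) : ℝ) * F ((v ∘ σ) ∘ τ))
      = altSum F v := by
  conv_rhs => rw [altSum, ← Equiv.sum_comp (Equiv.mulRight τ)]
  refine Finset.sum_congr rfl fun σ _ => ?_
  simp only [coe_mulRight, Perm.sign_mul, Units.val_mul, Int.cast_mul, mul_assoc]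
  rfl

/-- An inner antisymmetrisation under an outer one is redundant. Each inner permutation, extended by
the identity, is absorbed by the outer sum, so there are l! equal copies. This factor makes the
normalised wedge product associative. -/
theorem altSum_mul_altSum_right {V : Type*} {k l : ℕ} (A : (Fin k → V) → ℝ) (B : (Fin l → V) → ℝ)
    (v : Fin (k + l) → V) :
    altSum (fun v => A (fun i => v (Fin.castAdd l i)) * altSum B (fun j => v (Fin.natAdd k j))) v
      = (l.factorial : ℝ) *
        altSum (fun v => A (fun i => v (Fin.castAdd l i)) * B (fun j => v (Fin.natAdd k j))) v := by
  have h := fun τ : Perm (Fin l) => altSum_comp_perm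
    (fun v : Fin (k + l) → V => A (fun i => v (Fin.castAdd l i)) * B (fun j => v (Fin.natAdd k j)))
    v (permNatAdd k τ)
  simp only [sign_permNatAdd] at h
  have h2 := Finset.sum_congr (rfl : (Finset.univ : Finset (Perm (Fin l))) = _) fun τ _ => h τ
  rw [Finset.sum_const, Finset.card_univ, Fintype.card_perm, Fintype.card_fin, nsmul_eq_mul] at h2
  rw [← h2, Finset.sum_comm]
  conv_lhs => rw [altSum]
  refine Finset.sum_congr rfl fun σ _ => ?_
  rw [← Finset.mul_sum]
  congr 1
  rw [altSum, Finset.mul_sum]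
  refine Finset.sum_congr rfl fun τ _ => ?_
  simp only [Function.comp_apply, permNatAdd_castAdd, permNatAdd_natAdd]
  rw [mul_left_comm]
  rfl

theorem altSum_mul_altSum_left {V : Type*} {k l : ℕ} (A : (Fin k → V) → ℝ) (B : (Fin l → V) → ℝ)
    (v : Fin (k + l) → V) :
    altSum (fun v => altSum A (fun i => v (Fin.castAdd l i)) * B (fun j => v (Fin.natAdd k j))) v
      = (k.factorial : ℝ) *
        altSum (fun v => A (fun i => v (Fin.castAdd l i)) * B (fun j => v (Fin.natAdd k j))) v := by
  have h := fun τ : Perm (Fin k) => altSum_comp_perm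
    (fun v : Fin (k + l) → V => A (fun i => v (Fin.castAdd l i)) * B (fun j => v (Fin.natAdd k j)))
    v (permCastAdd l τ)
  simp only [sign_permCastAdd] at h
  have h2 := Finset.sum_congr (rfl : (Finset.univ : Finset (Perm (Fin k))) = _) fun τ _ => h τ
  rw [Finset.sum_const, Finset.card_univ, Fintype.card_perm, Fintype.card_fin, nsmul_eq_mul] at h2
  rw [← h2, Finset.sum_comm]
  conv_lhs => rw [altSum]
  refine Finset.sum_congr rfl fun σ _ => ?_
  rw [← Finset.mul_sum]
  congr 1
  rw [altSum, Finset.sum_mul]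
  refine Finset.sum_congr rfl fun τ _ => ?_
  simp only [Function.comp_apply, permCastAdd_castAdd, permCastAdd_natAdd]
  rw [mul_assoc]
  rfl

theorem altSum_const_mul {V : Type*} {N : ℕ} (c : ℝ) (F : (Fin N → V) → ℝ) (v : Fin N → V) :
    altSum (fun v => c * F v) v = c * altSum F v := by
  simp only [altSum, Finset.mul_sum, mul_left_comm]

theorem altSum_cast {V : Type*} {N N' : ℕ} (h : N = N') (F : (Fin N → V) → ℝ) (v : Fin N' → V) :
    altSum F (v ∘ Fin.cast h) = altSum (fun w => F (w ∘ Fin.cast h)) v := by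
  subst h; rfl

variable {V : Type*} [NormedAddCommGroup V] [NormedSpace ℝ V]
variable {W : Type*} [NormedAddCommGroup W] [NormedSpace ℝ W]

theorem altWedge_apply {k l : ℕ} (a : V [⋀^Fin k]→L[ℝ] ℝ) (b : V [⋀^Fin l]→L[ℝ] ℝ)
    (v : Fin (k + l) → V) : altWedge a b v = ((k.factorial * l.factorial : ℕ) : ℝ)⁻¹ *
      altSum (fun v => a (fun i => v (Fin.castAdd l i)) * b (fun j => v (Fin.natAdd k j))) v := by
  rw [altWedge, ContinuousAlternatingMap.smul_apply,
    ContinuousMultilinearMap.alternatization_apply_apply, smul_eq_mul, altSum]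
  congr 1
  refine Finset.sum_congr rfl fun σ _ => ?_
  rw [Units.smul_def, zsmul_eq_mul]
  rfl

/-- Both sides are 1/(k! l! m!) times the antisymmetrisation of a ⊗ b ⊗ c. The cast is needed
because the degrees (k + l) + m and k + (l + m) give different types. -/
theorem altWedge_assoc {k l m : ℕ} (a : V [⋀^Fin k]→L[ℝ] ℝ) (b : V [⋀^Fin l]→L[ℝ] ℝ)
    (c : V [⋀^Fin m]→L[ℝ] ℝ) (v : Fin (k + (l + m)) → V) :
    altWedge (altWedge a b) c (v ∘ Fin.cast (add_assoc k l m)) = altWedge a (altWedge b c) v := by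
  rw [altWedge_apply, altWedge_apply]
  have e1 : (fun v : Fin (k + l + m) → V => altWedge a b (fun i => v (Fin.castAdd m i)) *
      c (fun j => v (Fin.natAdd (k + l) j))) = fun v => ((k.factorial * l.factorial : ℕ) : ℝ)⁻¹ *
      (altSum (fun v => a (fun i => v (Fin.castAdd l i)) * b (fun j => v (Fin.natAdd k j)))
        (fun i => v (Fin.castAdd m i)) * c (fun j => v (Fin.natAdd (k + l) j))) := by
    funext v; rw [altWedge_apply, mul_assoc]
  have e2 : (fun v : Fin (k + (l + m)) → V => a (fun i => v (Fin.castAdd (l + m) i)) *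
      altWedge b c (fun j => v (Fin.natAdd k j))) = fun v => ((l.factorial * m.factorial : ℕ) : ℝ)⁻¹ *
      (a (fun i => v (Fin.castAdd (l + m) i)) * altSum (fun v => b (fun i => v (Fin.castAdd m i)) *
        c (fun j => v (Fin.natAdd l j))) (fun j => v (Fin.natAdd k j))) := by
    funext v; rw [altWedge_apply, mul_left_comm]
  rw [e1, e2, altSum_const_mul, altSum_const_mul,
    altSum_mul_altSum_left (V := V) (k := k + l) (l := m) _ (fun v => c v),
    altSum_mul_altSum_right (V := V) (k := k) (l := l + m) (fun v => a v), altSum_cast]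
  have e3 : (fun w : Fin (k + (l + m)) → V =>
      (a fun i => (w ∘ Fin.cast (add_assoc k l m)) (Fin.castAdd m (Fin.castAdd l i))) *
        (b fun j => (w ∘ Fin.cast (add_assoc k l m)) (Fin.castAdd m (Fin.natAdd k j))) *
        c fun j => (w ∘ Fin.cast (add_assoc k l m)) (Fin.natAdd (k + l) j)) =
      fun v => a (fun i => v (Fin.castAdd (l + m) i)) *
        (b (fun i => v (Fin.natAdd k (Fin.castAdd m i))) *
          c (fun j => v (Fin.natAdd k (Fin.natAdd l j)))) := by
    funext w
    rw [mul_assoc]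
    have h1 : ∀ i : Fin k, Fin.cast (add_assoc k l m) (Fin.castAdd m (Fin.castAdd l i))
        = Fin.castAdd (l + m) i := fun i => rfl
    have h2 : ∀ i : Fin l, Fin.cast (add_assoc k l m) (Fin.castAdd m (Fin.natAdd k i))
        = Fin.natAdd k (Fin.castAdd m i) := fun i => rfl
    have h3 : ∀ i : Fin m, Fin.cast (add_assoc k l m) (Fin.natAdd (k + l) i)
        = Fin.natAdd k (Fin.natAdd l i) := fun i => by ext; simp [add_assoc]
    simp only [Function.comp_apply, h1, h2, h3]
  rw [e3]
  have f1 := Nat.cast_ne_zero (R := ℝ).2 k.factorial_ne_zero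
  have f2 := Nat.cast_ne_zero (R := ℝ).2 l.factorial_ne_zero
  have f3 := Nat.cast_ne_zero (R := ℝ).2 m.factorial_ne_zero
  have f4 := Nat.cast_ne_zero (R := ℝ).2 (k + l).factorial_ne_zero
  have f5 := Nat.cast_ne_zero (R := ℝ).2 (l + m).factorial_ne_zero
  push_cast
  field_simp

theorem altWedge_add_left {k l : ℕ} (a a' : V [⋀^Fin k]→L[ℝ] ℝ) (b : V [⋀^Fin l]→L[ℝ] ℝ) :
    altWedge (a + a') b = altWedge a b + altWedge a' b := by
  ext v
  simp [altWedge_apply, altSum, add_mul, mul_add, Finset.sum_add_distrib]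

theorem altWedge_add_right {k l : ℕ} (a : V [⋀^Fin k]→L[ℝ] ℝ) (b b' : V [⋀^Fin l]→L[ℝ] ℝ) :
    altWedge a (b + b') = altWedge a b + altWedge a b' := by
  ext v
  simp [altWedge_apply, altSum, mul_add, Finset.sum_add_distrib]

theorem altWedge_smul_left {k l : ℕ} (c : ℝ) (a : V [⋀^Fin k]→L[ℝ] ℝ) (b : V [⋀^Fin l]→L[ℝ] ℝ) :
    altWedge (c • a) b = c • altWedge a b := by
  ext v
  simp only [altWedge_apply, ContinuousAlternatingMap.smul_apply, smul_eq_mul, mul_assoc]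
  rw [altSum_const_mul, mul_left_comm]

theorem altWedge_smul_right {k l : ℕ} (c : ℝ) (a : V [⋀^Fin k]→L[ℝ] ℝ)
    (b : V [⋀^Fin l]→L[ℝ] ℝ) : altWedge a (c • b) = c • altWedge a b := by
  ext v
  simp only [altWedge_apply, ContinuousAlternatingMap.smul_apply, smul_eq_mul]
  simp only [mul_left_comm _ c]
  rw [altSum_const_mul, mul_left_comm]

/-- The wedge product as a bilinear map. -/
def altWedgeL (V : Type*) [NormedAddCommGroup V] [NormedSpace ℝ V] (k l : ℕ) :
    (V [⋀^Fin k]→L[ℝ] ℝ) →ₗ[ℝ] (V [⋀^Fin l]→L[ℝ] ℝ) →ₗ[ℝ] (V [⋀^Fin (k + l)]→L[ℝ] ℝ) :=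
  LinearMap.mk₂ ℝ altWedge altWedge_add_left altWedge_smul_left altWedge_add_right
    altWedge_smul_right

theorem altWedge_zero_right {k l : ℕ} (a : V [⋀^Fin k]→L[ℝ] ℝ) :
    altWedge a (0 : V [⋀^Fin l]→L[ℝ] ℝ) = 0 := (altWedgeL V k l a).map_zero

theorem altWedge_sum_left {k l : ℕ} {ι : Type*} (s : Finset ι) (a : ι → V [⋀^Fin k]→L[ℝ] ℝ)
    (b : V [⋀^Fin l]→L[ℝ] ℝ) : altWedge (∑ i ∈ s, a i) b = ∑ i ∈ s, altWedge (a i) b :=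
  (altWedgeL V k l).map_sum₂ s a b

theorem altWedge_sum_right {k l : ℕ} {ι : Type*} (s : Finset ι) (a : V [⋀^Fin k]→L[ℝ] ℝ)
    (b : ι → V [⋀^Fin l]→L[ℝ] ℝ) : altWedge a (∑ i ∈ s, b i) = ∑ i ∈ s, altWedge a (b i) :=
  map_sum (altWedgeL V k l a) b s

theorem altWedge_comp {k l : ℕ} (a : V [⋀^Fin k]→L[ℝ] ℝ) (b : V [⋀^Fin l]→L[ℝ] ℝ)
    (A : W →L[ℝ] V) : (altWedge a b).compContinuousLinearMap A
      = altWedge (a.compContinuousLinearMap A) (b.compContinuousLinearMap A) := by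
  ext v
  rw [ContinuousAlternatingMap.compContinuousLinearMap_apply, altWedge_apply, altWedge_apply]
  rfl

theorem map_comp_perm {l : ℕ} (b : V [⋀^Fin l]→L[ℝ] ℝ) (v : Fin l → V) (σ : Perm (Fin l)) :
    b (v ∘ σ) = ((Perm.sign σ : ℤ) : ℝ) * b v := by
  have := b.toAlternatingMap.map_perm v σ
  simpa [Units.smul_def] using this

theorem sign_mul_sign {l : ℕ} (σ : Perm (Fin l)) (x : ℝ) :
    ((Perm.sign σ : ℤ) : ℝ) * (((Perm.sign σ : ℤ) : ℝ) * x) = x := by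
  rw [← mul_assoc, ← Int.cast_mul, ← Units.val_mul, Int.units_mul_self, Units.val_one,
    Int.cast_one, one_mul]

theorem altSum_coe {l : ℕ} (b : V [⋀^Fin l]→L[ℝ] ℝ) (v : Fin l → V) :
    altSum (fun v => b v) v = (l.factorial : ℝ) * b v := by
  simp [altSum, map_comp_perm, sign_mul_sign, Fintype.card_perm]

theorem altWedge_const {l : ℕ} (c : ℝ) (b : V [⋀^Fin l]→L[ℝ] ℝ) (v : Fin (0 + l) → V) :
    altWedge (ContinuousAlternatingMap.constOfIsEmpty ℝ V (Fin 0) c) b v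
      = c * b (v ∘ Fin.cast (zero_add l).symm) := by
  have hl : (l.factorial : ℝ) ≠ 0 := Nat.cast_ne_zero.2 l.factorial_ne_zero
  have h := altSum_cast (zero_add l).symm (fun v => b v) v
  rw [altSum_coe] at h
  have e : ∀ w : Fin (0 + l) → V, (fun j => w (Fin.natAdd 0 j)) = w ∘ Fin.cast (zero_add l).symm :=
    fun w => funext fun j => congrArg w (by ext; simp)
  rw [altWedge_apply]
  simp only [ContinuousAlternatingMap.constOfIsEmpty_apply, e]
  rw [altSum_const_mul, ← h]
  simp
  field_simp

/-- The permutations of l + 1 arguments are grouped by the argument p that reaches the first place.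
The l! members of a group contribute equally and cancel the factor 1/l!. The resulting alternating
sum has the shape of the formula for the exterior derivative, so it serves the Leibniz rule. -/
theorem altWedge_ofSubsingleton {l : ℕ} (a : V →L[ℝ] ℝ) (b : V [⋀^Fin l]→L[ℝ] ℝ)
    (v : Fin (l + 1) → V) :
    altWedge (ContinuousAlternatingMap.ofSubsingleton ℝ V ℝ (0 : Fin 1) a) b
      (v ∘ Fin.cast (add_comm 1 l)) = ∑ i : Fin (l + 1), (-1) ^ (i : ℕ) * (a (v i) *
        b (i.removeNth v)) := by
  have hl : (l.factorial : ℝ) ≠ 0 := Nat.cast_ne_zero.2 l.factorial_ne_zero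
  have e : (fun w : Fin (l + 1) → V => ContinuousAlternatingMap.ofSubsingleton ℝ V ℝ (0 : Fin 1) a
      (fun i => (w ∘ Fin.cast (add_comm 1 l)) (Fin.castAdd l i)) *
        b (fun j => (w ∘ Fin.cast (add_comm 1 l)) (Fin.natAdd 1 j)))
      = fun w => a (w 0) * b (w ∘ Fin.succ) := by
    funext w
    congr 1
    exact congrArg b (funext fun j => congrArg w (by ext; simp))
  rw [altWedge_apply, altSum_cast, e, altSum, Finset.univ_perm_fin_succ, ← Finset.univ_product_univ]
  simp only [Finset.sum_map, Equiv.toEmbedding_apply, Finset.sum_product]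
  rw [Finset.mul_sum]
  refine Finset.sum_congr rfl fun p _ => ?_
  have h1 : ∀ τ : Perm (Fin l), (v ∘ Perm.decomposeFin.symm (p, τ)) ∘ Fin.succ
      = (fun j => v (Equiv.swap 0 p j.succ)) ∘ τ := fun τ => by
    funext j; simp
  have h2 : (if p = 0 then (1 : ℝ) else -1) * b (fun j => v (Equiv.swap 0 p j.succ))
      = (-1) ^ (p : ℕ) * b (p.removeNth v) := by
    refine Fin.cases ?_ (fun q => ?_) p
    · simp; rfl
    · rw [if_neg (Fin.succ_ne_zero q)]
      -- Swapping 0 with p and deleting p order the remaining arguments differently. The two orders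
      -- differ by a cycle of sign (−1)^q, and the swap supplies the missing factor −1.
      have : (fun j : Fin l => v (Equiv.swap 0 q.succ j.succ)) = (q.succ.removeNth v) ∘ q.cycleRange :=
        funext fun j => by rw [← Fin.succAbove_cycleRange]; rfl
      rw [this, map_comp_perm, Fin.sign_cycleRange]
      push_cast
      rw [Fin.val_succ, pow_succ]
      ring
  have h3 : ∀ τ : Perm (Fin l), ((Perm.sign (Perm.decomposeFin.symm (p, τ)) : ℤ) : ℝ) *
      (a ((v ∘ Perm.decomposeFin.symm (p, τ)) 0) *
        b ((v ∘ Perm.decomposeFin.symm (p, τ)) ∘ Fin.succ))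
      = (-1) ^ (p : ℕ) * (a (v p) * b (p.removeNth v)) := fun τ => by
    rw [h1, map_comp_perm, Perm.decomposeFin.symm_sign]
    rw [mul_left_comm _ (a (v p)), ← h2]
    have := sign_mul_sign τ (b fun j => v (Equiv.swap 0 p j.succ))
    simp only [Function.comp_apply, Perm.decomposeFin_symm_apply_zero]
    split_ifs <;> simp only [Units.val_mul, Units.val_neg, Units.val_one, Int.cast_mul,
      Int.cast_neg, Int.cast_one]
    · linear_combination a (v p) * this
    · linear_combination -a (v p) * this
  rw [Finset.sum_congr rfl fun τ _ => h3 τ]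
  simp [Fintype.card_perm]
  field_simp

theorem altWedge_one_one (a b : V →L[ℝ] ℝ) (v w : V) :
    altWedge (ContinuousAlternatingMap.ofSubsingleton ℝ V ℝ (0 : Fin 1) a)
      (ContinuousAlternatingMap.ofSubsingleton ℝ V ℝ (0 : Fin 1) b) ![v, w] = a v * b w - a w * b v := by
  have := altWedge_ofSubsingleton a (ContinuousAlternatingMap.ofSubsingleton ℝ V ℝ (0 : Fin 1) b) ![v, w]
  simp [Fin.sum_univ_two, Fin.removeNth] at this
  refine Eq.trans ?_ (this.trans ?_)
  · congr 1
  · ring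

end WedgeAlgebra

/-! ### Calculus of differential forms on manifolds -/

section AltSmooth

theorem contDiffAt_extDeriv {V : Type*} [NormedAddCommGroup V] [NormedSpace ℝ V] {k : ℕ}
    {f : V → V [⋀^Fin k]→L[ℝ] ℝ} {y : V}
    (hf : ContDiffAt ℝ ∞ f y) : ContDiffAt ℝ ∞ (extDeriv f) y := by
  have e : extDeriv f =
    ContinuousAlternatingMap.alternatizeUncurryFinCLM (n := k) ℝ V ℝ ∘ fderiv ℝ f := rfl
  rw [e]
  exact (ContinuousAlternatingMap.alternatizeUncurryFinCLM (n := k) ℝ V ℝ).contDiff.contDiffAt.comp y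
    (hf.fderiv_right (m := ∞) (by simp))

/-- The term df ∧ a is left as an alternating sum, to be matched with `altWedge_ofSubsingleton`. -/
theorem extDeriv_mul {V : Type*} [NormedAddCommGroup V] [NormedSpace ℝ V] {k : ℕ} {f : V → ℝ}
    {a : V → V [⋀^Fin k]→L[ℝ] ℝ} {y : V} (hf : DifferentiableAt ℝ f y)
    (ha : DifferentiableAt ℝ a y) (w : Fin (k + 1) → V) :
    extDeriv (fun z => f z • a z) y w = f y * extDeriv a y w +
      ∑ i : Fin (k + 1), (-1) ^ (i : ℕ) * (fderiv ℝ f y (w i) * a y (i.removeNth w)) := by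
  rw [extDeriv, fderiv_fun_smul hf ha, ContinuousAlternatingMap.alternatizeUncurryFin_add,
    ContinuousAlternatingMap.alternatizeUncurryFin_smul, ContinuousAlternatingMap.add_apply]
  congr 1
  rw [ContinuousAlternatingMap.alternatizeUncurryFin_apply]
  simp

variable {V : Type*} [NormedAddCommGroup V] [NormedSpace ℝ V] [FiniteDimensional ℝ V]
variable {W : Type*} [NormedAddCommGroup W] [NormedSpace ℝ W]
variable {Y : Type*} [NormedAddCommGroup Y] [NormedSpace ℝ Y]

/-- The values of an alternating form on the tuples of basis vectors. -/
def altValues (V : Type*) [NormedAddCommGroup V] [NormedSpace ℝ V] [FiniteDimensional ℝ V] (k : ℕ) :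
    (V [⋀^Fin k]→L[ℝ] ℝ) →ₗ[ℝ] ((Fin k → Fin (Module.finrank ℝ V)) → ℝ) where
  toFun a r := a fun i => Module.finBasis ℝ V (r i)
  map_add' _ _ := rfl
  map_smul' _ _ := rfl

theorem altValues_injective (k : ℕ) : Function.Injective (altValues V k) := by
  intro a b h
  apply ContinuousAlternatingMap.toAlternatingMap_injective
  exact Module.Basis.ext_alternating (Module.finBasis ℝ V) fun r _ => congrFun h r

/-- In finite dimension a form is recovered linearly from its finitely many values on tuples of
basis vectors, so regularity can be tested on values. -/
theorem contDiffAt_alt_iff {k : ℕ} {n : WithTop ℕ∞} {f : Y → V [⋀^Fin k]→L[ℝ] ℝ} {y : Y} :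
    ContDiffAt ℝ n f y ↔ ∀ v, ContDiffAt ℝ n (fun z => f z v) y := by
  constructor
  · intro h v
    exact (ContinuousAlternatingMap.apply ℝ V ℝ v).contDiff.contDiffAt.comp y h
  · intro h
    obtain ⟨g, hg⟩ := (altValues V k).exists_leftInverse_of_injective
      (LinearMap.ker_eq_bot.2 (altValues_injective k))
    have e : f = fun z => LinearMap.toContinuousLinearMap g (altValues V k (f z)) := by
      funext z; exact (LinearMap.congr_fun hg (f z)).symm
    rw [e]
    refine (LinearMap.toContinuousLinearMap g).contDiff.contDiffAt.comp y ?_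
    exact contDiffAt_pi.2 fun r => h _

/-- Expanding the arguments in a basis gives a polynomial in their coordinates with the values of
the form as coefficients. -/
theorem contDiffAt_alt_apply {k : ℕ} {n : WithTop ℕ∞} {f : Y → V [⋀^Fin k]→L[ℝ] ℝ}
    {w : Fin k → Y → V} {y : Y} (hf : ContDiffAt ℝ n f y) (hw : ∀ i, ContDiffAt ℝ n (w i) y) :
    ContDiffAt ℝ n (fun z => f z fun i => w i z) y := by
  have e : (fun z => f z fun i => w i z) = fun z => ∑ r : Fin k → Fin (Module.finrank ℝ V),
      (∏ i, LinearMap.toContinuousLinearMap ((Module.finBasis ℝ V).coord (r i)) (w i z)) *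
        f z (fun i => Module.finBasis ℝ V (r i)) := by
    funext z
    have h := (f z).toMultilinearMap.map_sum
      (g := fun i j => (Module.finBasis ℝ V).repr (w i z) j • Module.finBasis ℝ V j)
    simp only [Module.Basis.sum_repr] at h
    refine h.trans (Finset.sum_congr rfl fun r _ => ?_)
    exact (f z).toMultilinearMap.map_smul_univ _ _
  rw [e]
  refine ContDiffAt.sum fun r _ => ContDiffAt.mul (contDiffAt_prod fun i _ => ?_)
    (contDiffAt_alt_iff.1 hf _)
  exact (ContinuousLinearMap.contDiff _).contDiffAt.comp y (hw i)

theorem contDiffAt_alt_comp [FiniteDimensional ℝ W] {k : ℕ} {n : WithTop ℕ∞}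
    {f : Y → V [⋀^Fin k]→L[ℝ] ℝ}
    {A : Y → W →L[ℝ] V} {y : Y} (hf : ContDiffAt ℝ n f y) (hA : ContDiffAt ℝ n A y) :
    ContDiffAt ℝ n (fun z => (f z).compContinuousLinearMap (A z)) y :=
  contDiffAt_alt_iff.2 fun v => contDiffAt_alt_apply (w := fun i z => A z (v i)) hf
    fun _ => hA.clm_apply contDiffAt_const

theorem contDiffAt_altWedge {k l : ℕ} {n : WithTop ℕ∞} {f : Y → V [⋀^Fin k]→L[ℝ] ℝ}
    {g : Y → V [⋀^Fin l]→L[ℝ] ℝ} {y : Y} (hf : ContDiffAt ℝ n f y) (hg : ContDiffAt ℝ n g y) :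
    ContDiffAt ℝ n (fun z => altWedge (f z) (g z)) y := by
  refine contDiffAt_alt_iff.2 fun v => ?_
  simp only [altWedge_apply, altSum]
  exact contDiffAt_const.mul (ContDiffAt.sum fun σ _ => contDiffAt_const.mul
    ((contDiffAt_alt_iff.1 hf _).mul (contDiffAt_alt_iff.1 hg _)))

end AltSmooth

/-! ### Functoriality of the pullback, and its expression in charts. -/

section Charts

variable {V : Type*} [NormedAddCommGroup V] [NormedSpace ℝ V]
variable {W : Type*} [NormedAddCommGroup W] [NormedSpace ℝ W]
variable {X : Type*} [TopologicalSpace X] [ChartedSpace V X]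
variable {Y : Type*} [TopologicalSpace Y] [ChartedSpace W Y]

theorem eventually_symm {X V : Type*} [TopologicalSpace X] [TopologicalSpace V]
    {c : OpenPartialHomeomorph X V} {x : X} (hx : x ∈ c.source) {P : X → Prop}
    (h : ∀ᶠ x' in 𝓝 x, P x') : ∀ᶠ y in 𝓝 (c x), P (c.symm y) := by
  have := c.continuousAt_symm (c.map_source hx)
  rw [ContinuousAt, c.left_inv hx] at this
  exact this.eventually h

namespace DForm

/-- All tangent spaces are copies of the model space. With the two base points as variables, an
equality between them can be substituted without transporting the form. -/
theorem compContinuousLinearMap_congr {k : ℕ} (α : DForm W Y k) {q q' : Y} (h : q = q')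
    {A A' : V →L[ℝ] W} (hA : A = A') :
    ContinuousAlternatingMap.compContinuousLinearMap (α q : W [⋀^Fin k]→L[ℝ] ℝ) A
      = ContinuousAlternatingMap.compContinuousLinearMap (α q' : W [⋀^Fin k]→L[ℝ] ℝ) A' := by
  subst h hA; rfl

theorem pullback_congr {k : ℕ} (α : DForm W Y k) {f g : X → Y} {x : X} (h : f =ᶠ[𝓝 x] g) :
    α.pullback (V := V) f x = α.pullback (V := V) g x :=
  compContinuousLinearMap_congr (V := V) α h.self_of_nhds h.mfderiv_eq

theorem pullback_id {k : ℕ} (α : DForm V X k) : α.pullback (V := V) id = α := by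
  funext x
  ext v
  change α x (fun i => mfderiv 𝓘(ℝ, V) 𝓘(ℝ, V) id x (v i)) = α x v
  rw [mfderiv_id]; rfl

variable {U : Type*} [NormedAddCommGroup U] [NormedSpace ℝ U]
  {Z : Type*} [TopologicalSpace Z] [ChartedSpace U Z]

theorem pullback_pullback {k : ℕ} (α : DForm U Z k) {f : X → Y} {g : Y → Z} {x : X}
    (hg : MDifferentiableAt 𝓘(ℝ, W) 𝓘(ℝ, U) g (f x))
    (hf : MDifferentiableAt 𝓘(ℝ, V) 𝓘(ℝ, W) f x) :
    (α.pullback (V := W) g).pullback (V := V) f x = α.pullback (V := V) (g ∘ f) x := by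
  refine Eq.trans ?_ (compContinuousLinearMap_congr (V := V) α rfl (mfderiv_comp x hg hf).symm)
  rfl

/-- A chart expression is itself a pullback, so a change of chart is a case of functoriality. -/
theorem rep_eq_pullback {k : ℕ} (α : DForm V X k) (c : OpenPartialHomeomorph X V) (y : V) :
    α.rep c y = α.pullback (V := V) (X := V) c.symm y := rfl

end DForm

variable [IsManifold 𝓘(ℝ, V) ∞ X] [IsManifold 𝓘(ℝ, W) ∞ Y]

theorem contMDiffAt_atlas {c : OpenPartialHomeomorph X V} (hc : c ∈ atlas V X) {x : X}
    (hx : x ∈ c.source) : ContMDiffAt 𝓘(ℝ, V) 𝓘(ℝ, V) ∞ c x :=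
  contMDiffAt_of_mem_maximalAtlas (IsManifold.subset_maximalAtlas hc) hx

theorem contMDiffAt_atlas_symm {c : OpenPartialHomeomorph X V} (hc : c ∈ atlas V X) {y : V}
    (hy : y ∈ c.target) : ContMDiffAt 𝓘(ℝ, V) 𝓘(ℝ, V) ∞ c.symm y :=
  contMDiffAt_symm_of_mem_maximalAtlas (IsManifold.subset_maximalAtlas hc) hy

theorem mfderiv_symm_comp_mfderiv {c : OpenPartialHomeomorph X V} (hc : c ∈ atlas V X) {x : X}
    (hx : x ∈ c.source) (v : TangentSpace 𝓘(ℝ, V) x) :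
    (mfderiv 𝓘(ℝ, V) 𝓘(ℝ, V) c.symm (c x) : V →L[ℝ] V)
      ((mfderiv 𝓘(ℝ, V) 𝓘(ℝ, V) c x : V →L[ℝ] V) v) = v := by
  have h1 := (contMDiffAt_atlas hc hx).mdifferentiableAt (by simp)
  have h2 := (contMDiffAt_atlas_symm hc (c.map_source hx)).mdifferentiableAt (by simp)
  have h3 := mfderiv_comp x h2 h1
  have h4 : c.symm ∘ c =ᶠ[𝓝 x] id := by
    filter_upwards [c.open_source.mem_nhds hx] with y hy using c.left_inv hy
  rw [h4.mfderiv_eq, mfderiv_id] at h3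
  exact (congrArg (fun A : V →L[ℝ] V => A v) h3).symm

theorem mfderiv_comp_mfderiv_symm {c : OpenPartialHomeomorph X V} (hc : c ∈ atlas V X) {y : V}
    (hy : y ∈ c.target) (v : V) :
    (mfderiv 𝓘(ℝ, V) 𝓘(ℝ, V) c (c.symm y) : V →L[ℝ] V)
      ((mfderiv 𝓘(ℝ, V) 𝓘(ℝ, V) c.symm y : V →L[ℝ] V) v) = v := by
  have h1 := (contMDiffAt_atlas hc (c.map_target hy)).mdifferentiableAt (by simp)
  have h2 := (contMDiffAt_atlas_symm hc hy).mdifferentiableAt (by simp)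
  have h3 := mfderiv_comp y h1 h2
  have h4 : c ∘ c.symm =ᶠ[𝓝 y] id := by
    filter_upwards [c.open_target.mem_nhds hy] with y hy using c.right_inv hy
  rw [h4.mfderiv_eq, mfderiv_id] at h3
  exact (congrArg (fun A : V →L[ℝ] V => A v) h3).symm

theorem contDiffAt_chartRep {f : X → Y} {x : X} (hf : ContMDiffAt 𝓘(ℝ, V) 𝓘(ℝ, W) ∞ f x)
    {c : OpenPartialHomeomorph X V} (hc : c ∈ atlas V X) (hx : x ∈ c.source)
    {c' : OpenPartialHomeomorph Y W} (hc' : c' ∈ atlas W Y) (hx' : f x ∈ c'.source) :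
    ContDiffAt ℝ ∞ (fun y => c' (f (c.symm y))) (c x) := by
  rw [← contMDiffAt_iff_contDiffAt]
  have h1 := contMDiffAt_atlas_symm hc (c.map_source hx)
  have h2 : ContMDiffAt 𝓘(ℝ, V) 𝓘(ℝ, W) ∞ f (c.symm (c x)) := by rwa [c.left_inv hx]
  have h3 : ContMDiffAt 𝓘(ℝ, W) 𝓘(ℝ, W) ∞ c' (f (c.symm (c x))) := by
    rw [c.left_inv hx]; exact contMDiffAt_atlas hc' hx'
  exact h3.comp (c x) (h2.comp (c x) h1)

namespace DForm

/-- The expression of a pullback in charts. -/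
theorem rep_pullback {k : ℕ} (α : DForm W Y k) {f : X → Y} {x : X}
    (hf : ContMDiffAt 𝓘(ℝ, V) 𝓘(ℝ, W) ∞ f x)
    {c : OpenPartialHomeomorph X V} (hc : c ∈ atlas V X) (hx : x ∈ c.source)
    {c' : OpenPartialHomeomorph Y W} (hc' : c' ∈ atlas W Y) (hx' : f x ∈ c'.source) :
    (α.pullback (V := V) f).rep c =ᶠ[𝓝 (c x)] fun y =>
      (α.rep c' (c' (f (c.symm y)))).compContinuousLinearMap
        (fderiv ℝ (fun y => c' (f (c.symm y))) y) := by
  -- The order is lowered to 1 because finite regularity at a point spreads to a neighbourhood,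
  -- whereas order ∞ need not. Only differentiability nearby is used.
  have h1 : ∀ᶠ x' in 𝓝 x, ContMDiffAt 𝓘(ℝ, V) 𝓘(ℝ, W) 1 f x' ∧ f x' ∈ c'.source :=
    (contMDiffAt_iff_contMDiffAt_nhds (by simp) |>.1 (hf.of_le (m := 1) (by simp))).and
      (hf.continuousAt.eventually (c'.open_source.mem_nhds hx'))
  filter_upwards [c.open_target.mem_nhds (c.map_source hx),
    (eventually_symm hx h1).eventually_nhds] with y hy hy'
  have d1 := (contMDiffAt_atlas_symm hc hy).mdifferentiableAt (by simp)
  have d2 := hy'.self_of_nhds.1.mdifferentiableAt (by simp)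
  have d3 := (contMDiffAt_atlas hc' hy'.self_of_nhds.2).mdifferentiableAt (by simp)
  have d4 := (contMDiffAt_atlas_symm hc'
    (c'.map_source hy'.self_of_nhds.2)).mdifferentiableAt (by simp)
  have d5 : MDifferentiableAt 𝓘(ℝ, V) 𝓘(ℝ, W) (fun y => c' (f (c.symm y))) y :=
    d3.comp y (d2.comp y d1)
  rw [rep_eq_pullback, pullback_pullback _ d2 d1]
  have h2 : f ∘ c.symm =ᶠ[𝓝 y] c'.symm ∘ fun y => c' (f (c.symm y)) := by
    filter_upwards [hy'] with z hz using (c'.left_inv hz.2).symm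
  rw [pullback_congr α h2, ← pullback_pullback α (f := fun y => c' (f (c.symm y)))
    (g := c'.symm) d4 d5]
  change ContinuousAlternatingMap.compContinuousLinearMap _ (mfderiv _ _ _ y) = _
  rw [mfderiv_eq_fderiv]
  rfl

end DForm

end Charts

/-! ### Smoothness at a point, chart independence of d, naturality and the Leibniz rule. -/

section FormCalculus

variable {V : Type*} [NormedAddCommGroup V] [NormedSpace ℝ V]
variable {W : Type*} [NormedAddCommGroup W] [NormedSpace ℝ W]
variable {X : Type*} [TopologicalSpace X] [ChartedSpace V X]
variable {Y : Type*} [TopologicalSpace Y] [ChartedSpace W Y]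

/-- Over ℝ, regularity C² suffices for the symmetry of second derivatives, which is what makes d
commute with pullbacks. -/
theorem minSmoothness_two_le : minSmoothness ℝ 2 ≤ (∞ : WithTop ℕ∞) := by
  rw [minSmoothness_of_isRCLikeNormedField]
  exact WithTop.coe_le_coe.2 (le_top : (2 : ℕ∞) ≤ ⊤)

namespace DForm

/-- `α` is smooth at the point `x`. -/
def SmoothAt {k : ℕ} (α : DForm V X k) (x : X) : Prop :=
  ContDiffAt ℝ ∞ (α.rep (chartAt V x)) (chartAt V x x)

theorem rep_congr {k : ℕ} {α β : DForm V X k} {c : OpenPartialHomeomorph X V} {x : X}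
    (hx : x ∈ c.source) (h : ∀ᶠ y in 𝓝 x, α y = β y) : α.rep c =ᶠ[𝓝 (c x)] β.rep c := by
  filter_upwards [eventually_symm hx h] with y hy
  simp only [rep, hy]

theorem SmoothAt.congr {k : ℕ} {α β : DForm V X k} {x : X} (hα : α.SmoothAt x)
    (h : ∀ᶠ y in 𝓝 x, β y = α y) : β.SmoothAt x :=
  ContDiffAt.congr_of_eventuallyEq hα (rep_congr (mem_chart_source V x) h)

theorem ext_congr {k : ℕ} {α β : DForm V X k} {x : X} (h : ∀ᶠ y in 𝓝 x, α y = β y) :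
    α.ext x = β.ext x := by
  simp only [ext, (rep_congr (mem_chart_source V x) h).extDeriv_eq]

theorem rep_ofFun (f : X → ℝ) (c : OpenPartialHomeomorph X V) :
    (ofFun (V := V) f).rep c = fun y =>
      ContinuousAlternatingMap.constOfIsEmpty ℝ V (Fin 0) (f (c.symm y)) := rfl

theorem smoothAt_zero (k : ℕ) (x : X) : (0 : DForm V X k).SmoothAt x :=
  (contDiffAt_const (c := 0)).congr_of_eventuallyEq (Filter.Eventually.of_forall fun _ => rfl)

theorem SmoothAt.add {k : ℕ} {α β : DForm V X k} {x : X} (hα : α.SmoothAt x)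
    (hβ : β.SmoothAt x) : (α + β).SmoothAt x := ContDiffAt.add hα hβ

theorem SmoothAt.smul {k : ℕ} {α : DForm V X k} {x : X} (c : ℝ) (hα : α.SmoothAt x) :
    (c • α).SmoothAt x := ContDiffAt.const_smul c hα

theorem SmoothAt.sum {k : ℕ} {ι : Type*} {s : Finset ι} {α : ι → DForm V X k} {x : X}
    (hα : ∀ i ∈ s, (α i).SmoothAt x) : (∑ i ∈ s, α i).SmoothAt x := by
  classical
  induction s using Finset.induction_on with
  | empty => simpa using smoothAt_zero k x
  | insert i s hi ih =>
    rw [Finset.sum_insert hi]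
    exact (hα i (Finset.mem_insert_self i s)).add
      (ih fun j hj => hα j (Finset.mem_insert_of_mem hj))

theorem ext_add {k : ℕ} {α β : DForm V X k} {x : X} (hα : α.SmoothAt x) (hβ : β.SmoothAt x) :
    (α + β).ext x = α.ext x + β.ext x := by
  have := extDeriv_add (hα.differentiableAt (by simp)) (hβ.differentiableAt (by simp))
  exact congrArg (fun a : V [⋀^Fin (k + 1)]→L[ℝ] ℝ => a.compContinuousLinearMap
    (mfderiv 𝓘(ℝ, V) 𝓘(ℝ, V) (chartAt V x) x : V →L[ℝ] V)) this

theorem ext_zero {k : ℕ} (x : X) : (0 : DForm V X k).ext x = 0 := by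
  have h : extDeriv (fun _ : V => (0 : V [⋀^Fin k]→L[ℝ] ℝ)) (chartAt V x x) = 0 := by
    have := extDeriv_smul (x := chartAt V x x) (0 : ℝ) (fun _ : V => (0 : V [⋀^Fin k]→L[ℝ] ℝ))
    rwa [zero_smul, zero_smul] at this
  exact congrArg (fun a : V [⋀^Fin (k + 1)]→L[ℝ] ℝ => a.compContinuousLinearMap
    (mfderiv 𝓘(ℝ, V) 𝓘(ℝ, V) (chartAt V x) x : V →L[ℝ] V)) h

theorem wedge_pullback {k l : ℕ} (α : DForm W Y k) (β : DForm W Y l) (f : X → Y) :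
    (α.wedge β).pullback (V := V) f = (α.pullback (V := V) f).wedge (β.pullback (V := V) f) :=
  funext fun x => altWedge_comp (V := W) (W := V) (α (f x)) (β (f x)) _

theorem rep_wedge {k l : ℕ} (α : DForm V X k) (β : DForm V X l) (c : OpenPartialHomeomorph X V) :
    (α.wedge β).rep c = fun y => altWedge (α.rep c y) (β.rep c y) :=
  funext fun _ => altWedge_comp (V := V) (W := V) _ _ _

theorem SmoothAt.wedge [FiniteDimensional ℝ V] {k l : ℕ} {α : DForm V X k} {β : DForm V X l} {x : X}
    (hα : α.SmoothAt x) (hβ : β.SmoothAt x) : (α.wedge β).SmoothAt x := by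
  rw [SmoothAt, rep_wedge]
  exact contDiffAt_altWedge hα hβ

variable [IsManifold 𝓘(ℝ, V) ∞ X] [IsManifold 𝓘(ℝ, W) ∞ Y]

theorem contDiffAt_comp_symm {F : Type*} [NormedAddCommGroup F] [NormedSpace ℝ F] {f : X → F}
    {x : X} (hf : ContMDiffAt 𝓘(ℝ, V) 𝓘(ℝ, F) ∞ f x) {c : OpenPartialHomeomorph X V}
    (hc : c ∈ atlas V X) (hx : x ∈ c.source) :
    ContDiffAt ℝ ∞ (fun y => f (c.symm y)) (c x) := by
  have := contDiffAt_chartRep hf hc hx (c' := OpenPartialHomeomorph.refl F)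
    (by simp) (by simp)
  simpa using this

theorem smoothAt_ofFun [FiniteDimensional ℝ V] {f : X → ℝ} {x : X}
    (hf : ContMDiffAt 𝓘(ℝ, V) 𝓘(ℝ) ∞ f x) : (ofFun (V := V) f).SmoothAt x := by
  rw [SmoothAt, rep_ofFun]
  refine contDiffAt_alt_iff.2 fun v => ?_
  exact contDiffAt_comp_symm hf (chart_mem_atlas V x) (mem_chart_source V x)

theorem SmoothAt.fmul {k : ℕ} {f : X → ℝ} {α : DForm V X k} {x : X}
    (hf : ContMDiffAt 𝓘(ℝ, V) 𝓘(ℝ) ∞ f x) (hα : α.SmoothAt x) : (DForm.fmul f α).SmoothAt x :=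
  (contDiffAt_comp_symm hf (chart_mem_atlas V x) (mem_chart_source V x)).smul hα

theorem contDiffAt_rep_pullback [FiniteDimensional ℝ V] [FiniteDimensional ℝ W] {k : ℕ}
    {α : DForm W Y k} {f : X → Y} {x : X} (hf : ContMDiffAt 𝓘(ℝ, V) 𝓘(ℝ, W) ∞ f x)
    {c : OpenPartialHomeomorph X V} (hc : c ∈ atlas V X) (hx : x ∈ c.source)
    {c' : OpenPartialHomeomorph Y W} (hc' : c' ∈ atlas W Y) (hx' : f x ∈ c'.source)
    (hα : ContDiffAt ℝ ∞ (α.rep c') (c' (f x))) :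
    ContDiffAt ℝ ∞ ((α.pullback (V := V) f).rep c) (c x) := by
  have h := contDiffAt_chartRep hf hc hx hc' hx'
  refine ContDiffAt.congr_of_eventuallyEq ?_ (rep_pullback α hf hc hx hc' hx')
  refine contDiffAt_alt_comp ?_ (h.fderiv_right (by simp))
  refine ContDiffAt.comp (c x) (g := α.rep c') ?_ h
  rwa [c.left_inv hx]

theorem SmoothAt.pullback [FiniteDimensional ℝ V] [FiniteDimensional ℝ W] {k : ℕ} {α : DForm W Y k}
    {f : X → Y} {x : X} (hα : α.SmoothAt (f x)) (hf : ContMDiffAt 𝓘(ℝ, V) 𝓘(ℝ, W) ∞ f x) :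
    (α.pullback (V := V) f).SmoothAt x :=
  contDiffAt_rep_pullback hf (chart_mem_atlas V x) (mem_chart_source V x) (chart_mem_atlas W (f x))
    (mem_chart_source W (f x)) hα

/-- Chart independence is `contDiffAt_rep_pullback` for the identity map, read in two different
charts. -/
theorem smoothAt_iff [FiniteDimensional ℝ V] {k : ℕ} {α : DForm V X k} {x : X}
    {c : OpenPartialHomeomorph X V} (hc : c ∈ atlas V X) (hx : x ∈ c.source) :
    α.SmoothAt x ↔ ContDiffAt ℝ ∞ (α.rep c) (c x) := by
  constructor <;> intro h
  · have := contDiffAt_rep_pullback (α := α) (f := id) contMDiffAt_id hc hx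
      (chart_mem_atlas V x) (mem_chart_source V x) h
    rwa [pullback_id] at this
  · have := contDiffAt_rep_pullback (α := α) (f := id) contMDiffAt_id
      (chart_mem_atlas V x) (mem_chart_source V x) hc hx h
    rwa [pullback_id] at this

theorem isSmoothOn_iff [FiniteDimensional ℝ V] {k : ℕ} {α : DForm V X k} {S : Set X}
    (hS : IsOpen S) : α.IsSmoothOn S ↔ ∀ x ∈ S, α.SmoothAt x := by
  constructor
  · intro h x hx
    refine (h _ (chart_mem_atlas V x)).contDiffAt (((chartAt V x).symm.isOpen_inter_preimage
      hS).mem_nhds ⟨mem_chart_target V x, ?_⟩)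
    simpa using hx
  · intro h c hc y hy
    have := (smoothAt_iff hc (c.map_target hy.1)).1 (h _ hy.2)
    rw [c.right_inv hy.1] at this
    exact this.contDiffWithinAt

/-- The exterior derivative is defined in the preferred chart. Any other chart of the atlas gives
the same value because d commutes with the pullback along the transition map. -/
theorem ext_eq {k : ℕ} {α : DForm V X k} {x : X}
    {c : OpenPartialHomeomorph X V} (hc : c ∈ atlas V X) (hx : x ∈ c.source)
    (hα : DifferentiableAt ℝ (α.rep c) (c x)) :
    α.ext x = ContinuousAlternatingMap.compContinuousLinearMap (extDeriv (α.rep c) (c x))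
      (mfderiv 𝓘(ℝ, V) 𝓘(ℝ, V) c x) := by
  have h1 := rep_pullback α (f := id) contMDiffAt_id (chart_mem_atlas V x) (mem_chart_source V x)
    hc hx
  rw [pullback_id] at h1
  have h2 := contDiffAt_chartRep (f := id) contMDiffAt_id (chart_mem_atlas V x)
    (mem_chart_source V x) hc hx
  have h3 : c (id ((chartAt V x).symm (chartAt V x x))) = c x := by simp
  have h4 := extDeriv_pullback (x := chartAt V x x) (r := ∞)
    (f := fun y => c (id ((chartAt V x).symm y))) (h3.symm ▸ hα) h2
    minSmoothness_two_le
  have d1 := (contMDiffAt_atlas (chart_mem_atlas V x) (mem_chart_source V x)).mdifferentiableAt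
    (by simp)
  have d2 : MDifferentiableAt 𝓘(ℝ, V) 𝓘(ℝ, V) (fun y => c (id ((chartAt V x).symm y)))
    (chartAt V x x) := (h2.differentiableAt (by simp)).mdifferentiableAt
  have h5 := mfderiv_comp x d2 d1
  have h6 : (fun y => c (id ((chartAt V x).symm y))) ∘ chartAt V x =ᶠ[𝓝 x] c := by
    filter_upwards [(chartAt V x).open_source.mem_nhds (mem_chart_source V x)] with y hy
    simp [(chartAt V x).left_inv hy]
  rw [h6.mfderiv_eq, mfderiv_eq_fderiv] at h5
  rw [ext, h1.extDeriv_eq, h4, h3, h5]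
  rfl

/-- In charts this is the naturality of d between normed spaces. The chain rule identifies the
derivative of the coordinate expression of f. -/
theorem ext_pullback [FiniteDimensional ℝ V] [FiniteDimensional ℝ W] {k : ℕ} {α : DForm W Y k}
    {f : X → Y} {x : X} (hα : α.SmoothAt (f x)) (hf : ContMDiffAt 𝓘(ℝ, V) 𝓘(ℝ, W) ∞ f x) :
    (α.pullback (V := V) f).ext x = α.ext.pullback (V := V) f x := by
  set c := chartAt V x
  set c' := chartAt W (f x)
  have hc := chart_mem_atlas V x
  have hx := mem_chart_source V x
  have hc' := chart_mem_atlas W (f x)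
  have hx' := mem_chart_source W (f x)
  have h1 := rep_pullback α hf hc hx hc' hx'
  have h2 := contDiffAt_chartRep hf hc hx hc' hx'
  have h3 : c' (f (c.symm (c x))) = c' (f x) := by rw [c.left_inv hx]
  have h4 := extDeriv_pullback (x := c x) (r := ∞)
    (f := fun y => c' (f (c.symm y))) (h3.symm ▸ ContDiffAt.differentiableAt hα (by simp)) h2
    minSmoothness_two_le
  have d1 := (contMDiffAt_atlas hc hx).mdifferentiableAt (by simp)
  have d2 : MDifferentiableAt 𝓘(ℝ, V) 𝓘(ℝ, W) (fun y => c' (f (c.symm y))) (c x) :=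
    (h2.differentiableAt (by simp)).mdifferentiableAt
  have h5 := mfderiv_comp x d2 d1
  have h6 : (fun y => c' (f (c.symm y))) ∘ c =ᶠ[𝓝 x] c' ∘ f := by
    filter_upwards [c.open_source.mem_nhds hx] with y hy
    simp [c.left_inv hy]
  have h7 := mfderiv_comp x ((contMDiffAt_atlas hc' hx').mdifferentiableAt (by simp))
    (hf.mdifferentiableAt (by simp))
  rw [h6.mfderiv_eq, h7, mfderiv_eq_fderiv] at h5
  rw [ext, h1.extDeriv_eq, h4, h3]
  exact congrArg (fun A : V →L[ℝ] W => (extDeriv (α.rep c') (c' (f x))).compContinuousLinearMap A)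
    h5.symm

theorem rep_ext {k : ℕ} {α : DForm V X k} {c : OpenPartialHomeomorph X V} (hc : c ∈ atlas V X)
    {y : V} (hy : y ∈ c.target) (hα : DifferentiableAt ℝ (α.rep c) y) :
    α.ext.rep c y = extDeriv (α.rep c) y := by
  have h := ext_eq hc (c.map_target hy) (by rwa [c.right_inv hy])
  rw [rep, h, c.right_inv hy]
  ext v
  refine congrArg (extDeriv (α.rep c) y) (funext fun i => ?_)
  exact mfderiv_comp_mfderiv_symm hc hy (v i)

theorem SmoothAt.ext [FiniteDimensional ℝ V] {k : ℕ} {α : DForm V X k} {x : X}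
    (hα : α.SmoothAt x) : α.ext.SmoothAt x := by
  refine (contDiffAt_extDeriv hα).congr_of_eventuallyEq ?_
  have h1 : ∀ᶠ y in 𝓝 (chartAt V x x), ContDiffAt ℝ 1 (α.rep (chartAt V x)) y :=
    (ContDiffAt.of_le (m := 1) hα (by simp)).eventually (by simp)
  filter_upwards [h1, (chartAt V x).open_target.mem_nhds (mem_chart_target V x)] with y hy hy'
  exact rep_ext (chart_mem_atlas V x) hy' (hy.differentiableAt (by simp))

theorem dFun_eq {f : X → ℝ} {x : X} (hf : MDifferentiableAt 𝓘(ℝ, V) 𝓘(ℝ) f x) :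
    dFun (V := V) f x = ContinuousAlternatingMap.ofSubsingleton ℝ V ℝ (0 : Fin 1)
      (mfderiv 𝓘(ℝ, V) 𝓘(ℝ) f x) := by
  set c := chartAt V x
  have hc := chart_mem_atlas V x
  have hx := mem_chart_source V x
  have d1 := (contMDiffAt_atlas hc hx).mdifferentiableAt (by simp)
  have d2 := (contMDiffAt_atlas_symm hc (c.map_source hx)).mdifferentiableAt (by simp)
  have d3 : MDifferentiableAt 𝓘(ℝ, V) 𝓘(ℝ) f (c.symm (c x)) := by rwa [c.left_inv hx]
  have h5 := mfderiv_comp x (g := f ∘ c.symm) (d3.comp (c x) d2) d1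
  have h6 : (f ∘ c.symm) ∘ c =ᶠ[𝓝 x] f := by
    filter_upwards [c.open_source.mem_nhds hx] with y hy
    simp [c.left_inv hy]
  rw [h6.mfderiv_eq, mfderiv_eq_fderiv] at h5
  rw [dFun, ext, rep_ofFun, extDeriv_constOfIsEmpty, h5]
  rfl

theorem smoothAt_dFun [FiniteDimensional ℝ V] {f : X → ℝ} {x : X}
    (hf : ContMDiffAt 𝓘(ℝ, V) 𝓘(ℝ) ∞ f x) : (dFun (V := V) f).SmoothAt x :=
  (smoothAt_ofFun hf).ext

/-- The Leibniz rule of the model space, carried over by the chart. The cast compares the degrees 1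
+ k and k + 1. -/
theorem ext_fmul {k : ℕ} {f : X → ℝ} {α : DForm V X k} {x : X}
    (hf : ContMDiffAt 𝓘(ℝ, V) 𝓘(ℝ) ∞ f x) (hα : α.SmoothAt x)
    (v : Fin (k + 1) → V) :
    ((DForm.fmul f α).ext x : V [⋀^Fin (k + 1)]→L[ℝ] ℝ) v = f x * α.ext x v +
      ((dFun f).wedge α x : V [⋀^Fin (1 + k)]→L[ℝ] ℝ) (v ∘ Fin.cast (add_comm 1 k)) := by
  set c := chartAt V x with hcdef
  have hc := chart_mem_atlas V x
  have hx := mem_chart_source V x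
  have h1 := (contDiffAt_comp_symm hf hc hx).differentiableAt (by simp)
  have h2 := hα.differentiableAt (by simp)
  have e : (DForm.fmul f α).rep c = fun y => f (c.symm y) • α.rep c y := rfl
  have h3 := altWedge_ofSubsingleton (V := V) (mfderiv 𝓘(ℝ, V) 𝓘(ℝ) f x : V →L[ℝ] ℝ) (α x) v
  have h4 := dFun_eq (hf.mdifferentiableAt (by simp))
  have h5 := extDeriv_mul h1 h2
    fun i => (mfderiv 𝓘(ℝ, V) 𝓘(ℝ, V) c x : V →L[ℝ] V) (v i)
  refine Eq.trans (h5.trans ?_) (congrArg (f x * α.ext x v + ·) (h3.symm.trans ?_))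
  · congr 1
    · rw [(chartAt V x).left_inv hx]; rfl
    · refine Finset.sum_congr rfl fun i _ => ?_
      congr 2
      · have d1 := (contMDiffAt_atlas hc hx).mdifferentiableAt (by simp)
        have d2 : MDifferentiableAt 𝓘(ℝ, V) 𝓘(ℝ) (fun y => f (c.symm y)) (c x) :=
          h1.mdifferentiableAt
        have h6 := mfderiv_comp x d2 d1
        have h7 : (fun y => f (c.symm y)) ∘ c =ᶠ[𝓝 x] f := by
          filter_upwards [c.open_source.mem_nhds hx] with y hy
          simp [c.left_inv hy]
        rw [h7.mfderiv_eq, mfderiv_eq_fderiv] at h6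
        exact (congrArg (fun A : V →L[ℝ] ℝ => A (v i)) h6).symm
      · refine (congrArg (fun q => (α q : V [⋀^Fin k]→L[ℝ] ℝ) _) (c.left_inv hx)).trans ?_
        refine congrArg (α x : V [⋀^Fin k]→L[ℝ] ℝ) (funext fun j => ?_)
        exact mfderiv_symm_comp_mfderiv hc hx _
  · rw [wedge, h4]; rfl

end DForm

end FormCalculus

/-! ### Differential ideals -/

section Ideals

variable {V : Type*} [NormedAddCommGroup V] [NormedSpace ℝ V]
variable {W : Type*} [NormedAddCommGroup W] [NormedSpace ℝ W]
variable {X : Type*} [TopologicalSpace X] [ChartedSpace V X]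
variable {Y : Type*} [TopologicalSpace Y] [ChartedSpace W Y]

namespace DForm

/-- Transport of a form along an equality of degrees. -/
def castDeg {k k' : ℕ} (h : k = k') (α : DForm V X k) : DForm V X k' := h ▸ α

theorem castDeg_apply {k k' : ℕ} (h : k = k') (α : DForm V X k) (x : X) (v : Fin k' → V) :
    (castDeg h α x : V [⋀^Fin k']→L[ℝ] ℝ) v = (α x : V [⋀^Fin k]→L[ℝ] ℝ) (v ∘ Fin.cast h) := by
  subst h; rfl

theorem castDeg_castDeg {a b c : ℕ} (h : a = b) (h' : b = c) (α : DForm V X a) :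
    castDeg h' (castDeg h α) = castDeg (h.trans h') α := by
  subst h; rfl

theorem wedge_congr_right {k l : ℕ} (α : DForm V X k) {β β' : DForm V X l} {x : X}
    (h : β x = β' x) : α.wedge β x = α.wedge β' x := congrArg (altWedge (V := V) (α x)) h

theorem wedge_castDeg {k l l' : ℕ} (h : l = l') (α : DForm V X k) (β : DForm V X l) :
    α.wedge (castDeg h β) = castDeg (congrArg (k + ·) h) (α.wedge β) := by
  subst h; rfl

theorem castDeg_castDeg_wedge {a a' b k : ℕ} (h : a = a') (hk : a' + b = k) (γ : DForm V X a)
    (β : DForm V X b) : castDeg hk ((castDeg h γ).wedge β) = castDeg (by omega) (γ.wedge β) := by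
  subst h; rfl

theorem wedge_assoc {k l m : ℕ} (α : DForm V X k) (β : DForm V X l) (γ : DForm V X m) :
    α.wedge (β.wedge γ) = castDeg (add_assoc k l m) ((α.wedge β).wedge γ) := by
  funext x
  refine ContinuousAlternatingMap.ext fun v => ?_
  exact (altWedge_assoc (V := V) (α x) (β x) (γ x) v).symm.trans
    (castDeg_apply (V := V) (add_assoc k l m) ((α.wedge β).wedge γ) x v).symm

theorem ofFun_wedge {k : ℕ} (f : X → ℝ) (α : DForm V X k) :
    (ofFun f).wedge α = castDeg (zero_add k).symm (fmul f α) := by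
  funext x
  refine ContinuousAlternatingMap.ext fun v => ?_
  exact (altWedge_const (V := V) (f x) (α x) v).trans
    (castDeg_apply (V := V) (zero_add k).symm (fmul f α) x v).symm

theorem ext_fmul_eq [IsManifold 𝓘(ℝ, V) ∞ X] {k : ℕ} {f : X → ℝ} {α : DForm V X k} {x : X}
    (hf : ContMDiffAt 𝓘(ℝ, V) 𝓘(ℝ) ∞ f x) (hα : α.SmoothAt x) :
    (fmul f α).ext x = (fmul f α.ext + castDeg (add_comm 1 k) ((dFun f).wedge α)) x := by
  refine ContinuousAlternatingMap.ext fun v => ?_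
  refine (ext_fmul hf hα v).trans ?_
  exact congrArg ((f x * α.ext x v) + ·) (castDeg_apply (V := V) (add_comm 1 k) ((dFun f).wedge α) x v).symm

end DForm

open DForm

variable {S : Set X} {G : (k : ℕ) → DForm V X k → Prop}

namespace DiffIdeal

theorem castDeg {k k' : ℕ} (h : k = k') {ξ : DForm V X k} (hξ : DiffIdeal S G k ξ) :
    DiffIdeal S G k' (DForm.castDeg h ξ) := by
  subst h; exact hξ

theorem of_castDeg {k k' : ℕ} (h : k = k') {ξ : DForm V X k}
    (hξ : DiffIdeal S G k' (DForm.castDeg h ξ)) : DiffIdeal S G k ξ := by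
  subst h; exact hξ

theorem sum {k : ℕ} {ι : Type*} (s : Finset ι) {ξ : ι → DForm V X k}
    (h : ∀ i ∈ s, DiffIdeal S G k (ξ i)) : DiffIdeal S G k (∑ i ∈ s, ξ i) := by
  classical
  induction s using Finset.induction_on with
  | empty => simpa using DiffIdeal.zero k
  | insert i s hi ih =>
    rw [Finset.sum_insert hi]
    exact .add (h i (Finset.mem_insert_self i s)) (ih fun j hj => h j (Finset.mem_insert_of_mem hj))

end DiffIdeal

/-- The forms of degree `k` which over `S` are combinations, with smooth functions as coefficients,
of the forms in `G`. -/
inductive FunSpan (S : Set X) (G : (k : ℕ) → DForm V X k → Prop) (k : ℕ) : DForm V X k → Prop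
  | zero : FunSpan S G k 0
  | add {ξ ζ : DForm V X k} : FunSpan S G k ξ → FunSpan S G k ζ → FunSpan S G k (ξ + ζ)
  | fmul (f : X → ℝ) (β : DForm V X k) : (∀ x ∈ S, ContMDiffAt 𝓘(ℝ, V) 𝓘(ℝ) ∞ f x) → G k β →
      FunSpan S G k (DForm.fmul f β)
  | congr {ξ ζ : DForm V X k} : FunSpan S G k ξ → (∀ x ∈ S, ζ x = ξ x) → FunSpan S G k ζ

namespace FunSpan

theorem sum {k : ℕ} {ι : Type*} (s : Finset ι) {ξ : ι → DForm V X k}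
    (h : ∀ i ∈ s, FunSpan S G k (ξ i)) : FunSpan S G k (∑ i ∈ s, ξ i) := by
  classical
  induction s using Finset.induction_on with
  | empty => simpa using FunSpan.zero
  | insert i s hi ih =>
    rw [Finset.sum_insert hi]
    exact .add (h i (Finset.mem_insert_self i s)) (ih fun j hj => h j (Finset.mem_insert_of_mem hj))

variable [IsManifold 𝓘(ℝ, V) ∞ X]

theorem smoothAt (hS : IsOpen S) (hG : ∀ b β, G b β → ∀ x ∈ S, β.SmoothAt x) {k : ℕ}
    {ξ : DForm V X k} (h : FunSpan S G k ξ) : ∀ x ∈ S, ξ.SmoothAt x := by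
  induction h with
  | zero => exact fun x _ => smoothAt_zero k x
  | add _ _ h1 h2 => exact fun x hx => (h1 x hx).add (h2 x hx)
  | fmul f β hf hβ => exact fun x hx => (hG k β hβ x hx).fmul (hf x hx)
  | congr _ h ih =>
    exact fun x hx => (ih x hx).congr (Filter.eventually_of_mem (hS.mem_nhds hx) h)

variable [FiniteDimensional ℝ V]

/-- A coefficient function is moved onto the left factor: γ ∧ fβ = fγ ∧ β. -/
theorem wedge_mem (hS : IsOpen S) {a k : ℕ} {γ : DForm V X a} (hγ : γ.IsSmoothOn S)
    {ξ : DForm V X k} (h : FunSpan S G k ξ) : DiffIdeal S G (a + k) (γ.wedge ξ) := by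
  induction h with
  | zero =>
    exact (DiffIdeal.zero _).congr fun x _ => altWedge_zero_right (V := V) (γ x)
  | add _ _ h1 h2 =>
    exact (h1.add h2).congr fun x _ => altWedge_add_right (V := V) (γ x) _ _
  | fmul f β hf hβ =>
    refine (DiffIdeal.gen (DForm.fmul f γ) β ?_ hβ).congr fun x _ => ?_
    · rw [isSmoothOn_iff hS] at hγ ⊢
      exact fun x hx => (hγ x hx).fmul (hf x hx)
    · exact (altWedge_smul_right (V := V) (f x) (γ x) (β x)).trans
        (altWedge_smul_left (V := V) (f x) (γ x) (β x)).symm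
  | congr _ h ih =>
    exact ih.congr fun x hx => wedge_congr_right γ (h x hx)

/-- Since d(fβ) = f dβ + df ∧ β, differentials of function combinations stay in the ideal. This is
why it suffices to compare generators as combinations over functions. -/
theorem wedge_ext_mem (hS : IsOpen S) (hG : ∀ b β, G b β → ∀ x ∈ S, β.SmoothAt x) {a k : ℕ}
    {γ : DForm V X a} (hγ : γ.IsSmoothOn S)
    {ξ : DForm V X k} (h : FunSpan S G k ξ) : DiffIdeal S G (a + (k + 1)) (γ.wedge ξ.ext) := by
  induction h with
  | zero =>
    refine (DiffIdeal.zero _).congr fun x _ => ?_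
    simp only [DForm.wedge, ext_zero]
    exact altWedge_zero_right (V := V) (γ x)
  | add h1 h2 ih1 ih2 =>
    refine (ih1.add ih2).congr fun x hx => ?_
    simp only [DForm.wedge, ext_add (h1.smoothAt hS hG x hx) (h2.smoothAt hS hG x hx)]
    exact altWedge_add_right (V := V) (γ x) _ _
  | fmul f β hf hβ =>
    have hγ' := (isSmoothOn_iff hS).1 hγ
    have h1 := DiffIdeal.dgen (G := G) (DForm.fmul f γ) β
      ((isSmoothOn_iff hS).2 fun x hx => (hγ' x hx).fmul (hf x hx)) hβ
    -- The term γ ∧ (df ∧ β) is a multiple of β with left factor γ ∧ df, after reassociation.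
    have h2 := DiffIdeal.gen (G := G) (γ.wedge (dFun f)) β
      ((isSmoothOn_iff hS).2 fun x hx => (hγ' x hx).wedge (smoothAt_dFun (hf x hx))) hβ
    have h3 := h2.castDeg (show a + 1 + k = a + (k + 1) by omega)
    refine (h1.add h3).congr fun x hx => ?_
    have e := wedge_castDeg (add_comm 1 k) γ ((dFun f).wedge β)
    rw [wedge_assoc] at e
    have e' : (DForm.castDeg (show a + 1 + k = a + (k + 1) by omega)
        ((γ.wedge (dFun f)).wedge β)) = γ.wedge (DForm.castDeg (add_comm 1 k) ((dFun f).wedge β)) := by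
      rw [e, castDeg_castDeg]
    rw [e']
    simp only [DForm.wedge, ext_fmul_eq (hf x hx) (hG k β hβ x hx)]
    refine (altWedge_add_right (V := V) (γ x) _ _).trans ?_
    refine congrArg₂ (· + ·) ?_ rfl
    exact (altWedge_smul_right (V := V) (f x) (γ x) (β.ext x)).trans
        (altWedge_smul_left (V := V) (f x) (γ x) (β.ext x)).symm
  | congr _ h ih =>
    exact ih.congr fun x hx => wedge_congr_right γ
      (DForm.ext_congr (Filter.eventually_of_mem (hS.mem_nhds hx) h))

end FunSpan

/-- Pullbacks of the elements of a differential ideal belong to the ideal generated by the pullbacks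
of the generators. -/
theorem DiffIdeal.pullback [IsManifold 𝓘(ℝ, V) ∞ X] [FiniteDimensional ℝ V]
    [IsManifold 𝓘(ℝ, W) ∞ Y] [FiniteDimensional ℝ W]
    {S' : Set Y} {G' : (k : ℕ) → DForm W Y k → Prop} (hS : IsOpen S) (hS' : IsOpen S') {f : X → Y}
    (hf : ∀ x ∈ S, ContMDiffAt 𝓘(ℝ, V) 𝓘(ℝ, W) ∞ f x) (hm : Set.MapsTo f S S')
    (hG : ∀ b β, G b β → ∀ x ∈ S, β.SmoothAt x) (hG' : ∀ b β, G' b β → ∀ y ∈ S', β.SmoothAt y)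
    (h : ∀ b β, G' b β → FunSpan S G b (β.pullback (V := V) f))
    {k : ℕ} {ξ : DForm W Y k} (hξ : DiffIdeal S' G' k ξ) :
    DiffIdeal S G k (ξ.pullback (V := V) f) := by
  induction hξ with
  | zero k => exact .zero k
  | add _ _ h1 h2 => exact h1.add h2
  | gen γ β hγ hβ =>
    rw [wedge_pullback]
    refine (h _ β hβ).wedge_mem hS ?_
    rw [isSmoothOn_iff hS] at *
    rw [isSmoothOn_iff hS'] at hγ
    exact fun x hx => (hγ _ (hm hx)).pullback (hf x hx)
  | dgen γ β hγ hβ =>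
    rw [wedge_pullback]
    refine ((h _ β hβ).wedge_ext_mem hS hG (γ := γ.pullback f) ?_).congr fun x hx => ?_
    · rw [isSmoothOn_iff hS] at *
      rw [isSmoothOn_iff hS'] at hγ
      exact fun x hx => (hγ _ (hm hx)).pullback (hf x hx)
    · exact (wedge_congr_right _ (ext_pullback (hG' _ β hβ _ (hm hx)) (hf x hx))).symm
  | congr _ h ih =>
    exact ih.congr fun x hx => by simp only [DForm.pullback, h _ (hm hx)]

end Ideals

/-! ### Membership in a finitely generated differential ideal is local. -/

section Gluing

variable {V : Type*} [NormedAddCommGroup V] [NormedSpace ℝ V]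
variable {X : Type*} [TopologicalSpace X] [ChartedSpace V X]

/-- Transport of alternating forms along an equality of degrees. -/
def altCast (V : Type*) [NormedAddCommGroup V] [NormedSpace ℝ V] {k k' : ℕ} (h : k = k') :
    (V [⋀^Fin k]→L[ℝ] ℝ) →ₗ[ℝ] (V [⋀^Fin k']→L[ℝ] ℝ) := h ▸ LinearMap.id

/-- Left multiplication of `b` to a form of degree `k` (zero, if the degree of `b` exceeds `k`),
as a linear function of the other factor. -/
def wedgeInto (k : ℕ) {l : ℕ} (b : V [⋀^Fin l]→L[ℝ] ℝ) :
    (V [⋀^Fin (k - l)]→L[ℝ] ℝ) →ₗ[ℝ] (V [⋀^Fin k]→L[ℝ] ℝ) :=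
  if h : l ≤ k then (altCast V (Nat.sub_add_cancel h)).comp ((altWedgeL V (k - l) l).flip b) else 0

theorem wedgeInto_of_le {k l : ℕ} (h : l ≤ k) (b : V [⋀^Fin l]→L[ℝ] ℝ)
    (a : V [⋀^Fin (k - l)]→L[ℝ] ℝ) :
    wedgeInto k b a = altCast V (Nat.sub_add_cancel h) (altWedge a b) := by
  rw [wedgeInto, dif_pos h]; rfl

theorem wedgeInto_of_not_le {k l : ℕ} (h : ¬ l ≤ k) (b : V [⋀^Fin l]→L[ℝ] ℝ)
    (a : V [⋀^Fin (k - l)]→L[ℝ] ℝ) : wedgeInto k b a = 0 := by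
  rw [wedgeInto, dif_neg h]; rfl

namespace DForm

/-- The value of a form at a point, as an alternating form on the model space. -/
def val {k : ℕ} (α : DForm V X k) (x : X) : V [⋀^Fin k]→L[ℝ] ℝ := α x

/-- The form with given values. -/
def ofVal {k : ℕ} (a : X → V [⋀^Fin k]→L[ℝ] ℝ) : DForm V X k := a

theorem val_sum {k : ℕ} {ι : Type*} (s : Finset ι) (α : ι → DForm V X k) (x : X) :
    (∑ i ∈ s, α i).val x = ∑ i ∈ s, (α i).val x := Finset.sum_apply x s α

theorem altCast_eq {k k' : ℕ} (h : k = k') (α : DForm V X k) (x : X) :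
    altCast V h (α.val x) = (castDeg h α).val x := by
  subst h; rfl

theorem wedgeInto_castDeg {a b k : ℕ} (h : a + b = k) (h' : a = k - b) (γ : DForm V X a)
    (β : DForm V X b) (x : X) :
    wedgeInto k (β.val x) ((castDeg h' γ).val x) = (castDeg h (γ.wedge β)).val x := by
  have hb : b ≤ k := by omega
  rw [wedgeInto_of_le hb]
  refine (altCast_eq (V := V) (Nat.sub_add_cancel hb) ((castDeg h' γ).wedge β) x).trans ?_
  rw [castDeg_castDeg_wedge]

end DForm

open DForm

variable {S : Set X} {G : (k : ℕ) → DForm V X k → Prop}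

/-- The generators of a differential ideal and their differentials. -/
abbrev GenIndex (G : (k : ℕ) → DForm V X k → Prop) :=
  {p : Σ b, DForm V X b // G p.1 p.2} ⊕ {p : Σ b, DForm V X b // G p.1 p.2}

/-- The algebraic generators of a differential ideal. -/
def algGen (j : GenIndex G) : Σ b, DForm V X b :=
  Sum.elim (fun p => p.1) (fun p => ⟨p.1.1 + 1, p.1.2.ext⟩) j

/-- The elements of a differential ideal with finitely many generators are the combinations of the
generators and their differentials with smooth forms as coefficients. -/
theorem DiffIdeal.exists_coeff [Fintype (GenIndex G)] {k : ℕ} {ξ : DForm V X k}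
    (h : DiffIdeal S G k ξ) : ∃ γ : (j : GenIndex G) → DForm V X (k - (algGen j).1),
      (∀ j, (γ j).IsSmoothOn S) ∧
      ∀ x ∈ S, ξ.val x = ∑ j, wedgeInto k ((algGen j).2.val x) ((γ j).val x) := by
  classical
  -- One product of a form with the generator i has that form as coefficient of i and zero for all
  -- other generators.
  have single : ∀ (a : ℕ) (γ : DForm V X a) (i : GenIndex G), γ.IsSmoothOn S →
      ∃ γ' : (j : GenIndex G) → DForm V X (a + (algGen i).1 - (algGen j).1),
      (∀ j, (γ' j).IsSmoothOn S) ∧ ∀ x ∈ S, (γ.wedge (algGen i).2).val x =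
        ∑ j, wedgeInto (a + (algGen i).1) ((algGen j).2.val x) ((γ' j).val x) := by
    intro a γ i hγ
    refine ⟨fun j => if hj : i = j then DForm.castDeg (by rw [← hj, Nat.add_sub_cancel]) γ else 0, fun j => ?_,
      fun x _ => ?_⟩
    · dsimp only
      split_ifs with hj
      · subst hj
        have : ∀ b (hb : a = b), (DForm.castDeg hb γ).IsSmoothOn S := by
          rintro b rfl; exact hγ
        exact this _ _
      · exact fun c hc => contDiffOn_const (c := 0)
    · rw [Finset.sum_eq_single i]
      · beta_reduce
        rw [dif_pos rfl]
        exact (wedgeInto_castDeg rfl (Nat.add_sub_cancel _ _).symm γ (algGen i).2 x).symm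
      · intro j _ hj
        beta_reduce
        rw [dif_neg (Ne.symm hj)]
        exact map_zero _
      · exact fun h => absurd (Finset.mem_univ i) h
  induction h with
  | zero k =>
    refine ⟨fun j => 0, fun j c hc => contDiffOn_const (c := 0), fun x _ => ?_⟩
    exact (Finset.sum_eq_zero fun j _ => map_zero _).symm
  | add _ _ h1 h2 =>
    obtain ⟨γ1, s1, e1⟩ := h1
    obtain ⟨γ2, s2, e2⟩ := h2
    refine ⟨fun j => γ1 j + γ2 j, fun j c hc => (s1 j c hc).add (s2 j c hc), fun x hx => ?_⟩
    refine (congrArg₂ (· + ·) (e1 x hx) (e2 x hx)).trans ?_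
    rw [← Finset.sum_add_distrib]
    exact Finset.sum_congr rfl fun j _ => (map_add (wedgeInto _ _) _ _).symm
  | gen γ β hγ hβ => exact single _ γ (Sum.inl ⟨⟨_, β⟩, hβ⟩) hγ
  | dgen γ β hγ hβ => exact single _ γ (Sum.inr ⟨⟨_, β⟩, hβ⟩) hγ
  | congr _ h ih =>
    obtain ⟨γ, s, e⟩ := ih
    exact ⟨γ, s, fun x hx => (h x hx).trans (e x hx)⟩

/-- Converse of `DiffIdeal.exists_coeff`. Membership becomes a linear equation for a family of
coefficient forms indexed by a fixed finite set, and such coefficients can be glued. -/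
theorem DiffIdeal.of_coeff [Fintype (GenIndex G)] {k : ℕ} {ξ : DForm V X k}
    (γ : (j : GenIndex G) → DForm V X (k - (algGen j).1)) (hγ : ∀ j, (γ j).IsSmoothOn S)
    (h : ∀ x ∈ S, ξ.val x = ∑ j, wedgeInto k ((algGen j).2.val x) ((γ j).val x)) :
    DiffIdeal S G k ξ := by
  have key : ∀ j : GenIndex G, DiffIdeal S G k
      (fun x => wedgeInto k ((algGen j).2.val x) ((γ j).val x)) := by
    intro j
    by_cases hj : (algGen j).1 ≤ k
    · have e : (fun x => wedgeInto k ((algGen j).2.val x) ((γ j).val x) : DForm V X k)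
          = DForm.castDeg (Nat.sub_add_cancel hj) ((γ j).wedge (algGen j).2) :=
        funext fun x => wedgeInto_castDeg (Nat.sub_add_cancel hj) rfl (γ j) (algGen j).2 x
      rw [e]
      refine DiffIdeal.castDeg _ ?_
      rcases j with p | p
      · exact .gen (γ _) p.1.2 (hγ _) p.2
      · exact .dgen (γ _) p.1.2 (hγ _) p.2
    -- The degree of this generator exceeds k. The truncated difference of degrees is harmless since
    -- `wedgeInto` is zero by definition in this case.
    · refine (DiffIdeal.zero k).congr fun x _ => ?_
      exact wedgeInto_of_not_le hj _ _
  refine (DiffIdeal.sum Finset.univ fun j _ => key j).congr fun x hx => ?_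
  refine (h x hx).trans ?_
  exact (Finset.sum_apply x Finset.univ
    (fun j => (fun x => wedgeInto k ((algGen j).2.val x) ((γ j).val x) : DForm V X k))).symm

variable [IsManifold 𝓘(ℝ, V) ∞ X] [FiniteDimensional ℝ V] [T2Space X] [SecondCountableTopology X]

/-- Membership in a differential ideal with finitely many generators is a local property. -/
theorem DiffIdeal.of_local (hG : {p : Σ b, DForm V X b | G p.1 p.2}.Finite) (hS : IsOpen S) {k : ℕ}
    {ξ : DForm V X k} (h : ∀ x ∈ S, ∃ U, IsOpen U ∧ x ∈ U ∧ DiffIdeal U G k ξ) :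
    DiffIdeal S G k ξ := by
  classical
  let _ : Fintype {p : Σ b, DForm V X b // G p.1 p.2} := hG.fintype
  have : LocallyCompactSpace X := Manifold.locallyCompact_of_finiteDimensional 𝓘(ℝ, V)
  -- The sets U cover S only, so the partition of unity is taken on the open submanifold S.
  set O : TopologicalSpace.Opens X := ⟨S, hS⟩ with hO
  have : LocallyCompactSpace O := hS.locallyCompactSpace
  choose U hU hxU hI using fun x : O => h x x.2
  choose γ hγ hξ using fun x : O => (hI x).exists_coeff
  obtain ⟨χ, hχ⟩ := SmoothPartitionOfUnity.exists_isSubordinate 𝓘(ℝ, V) (M := O) isClosed_univ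
    (fun x : O => (Subtype.val ⁻¹' U x : Set O)) (fun x => (hU x).preimage continuous_subtype_val)
    (fun x _ => Set.mem_iUnion.2 ⟨x, hxU x⟩)
  -- The functions are extended by zero to X. Their smoothness is claimed and used only at points of
  -- S.
  set e : O → X → ℝ := fun i x => if hx : x ∈ S then χ i ⟨x, hx⟩ else 0 with he
  have he' : ∀ i (x : O), e i x = χ i x := fun i x => dif_pos x.2
  have hes : ∀ i (x : O), ContMDiffAt 𝓘(ℝ, V) 𝓘(ℝ) ∞ (e i) x := fun i x => by
    refine (contMDiffAt_subtype_iff (U := O) (x := x)).1 ?_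
    have : (fun x : O => e i x) = χ i := funext fun x => he' i x
    rw [this]
    exact (χ i).contMDiff x
  have hev : ∀ (x : O) {P : X → Prop}, (∀ᶠ y : O in 𝓝 x, P y) → ∀ᶠ y in 𝓝 (x : X), P y := by
    intro x P hP
    have := (hS.isOpenEmbedding_subtypeVal.map_nhds_eq x)
    rw [← this]
    exact hP
  have hloc : ∀ x : O, ∃ I : Finset O, ∀ᶠ y : O in 𝓝 x, ∀ i ∉ I, χ i y = 0 := by
    intro x
    obtain ⟨t, ht, hf⟩ := χ.locallyFinite x
    refine ⟨hf.toFinset, Filter.eventually_of_mem ht fun y hy i hi => ?_⟩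
    by_contra h0
    exact hi (hf.mem_toFinset.2 ⟨y, h0, hy⟩)
  have hfin : ∀ (x : O) (I : Finset O), (∀ i ∉ I, χ i x = 0) → ∀ j,
      (∑ᶠ i, e i x • (γ i j).val x) = ∑ i ∈ I, e i x • (γ i j).val x := by
    intro x I hI j
    refine finsum_eq_sum_of_support_subset _ fun i hi => ?_
    by_contra hiI
    refine hi ?_
    simp only [he', hI i hiI, zero_smul]
  -- The glued coefficient of each generator is the sum of the local coefficients weighted by the
  -- partition of unity.
  refine DiffIdeal.of_coeff (fun j => ofVal fun x => ∑ᶠ i, e i x • (γ i j).val x)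
    (fun j => (isSmoothOn_iff hS).2 fun x hx => ?_) fun x hx => ?_
  · obtain ⟨I, hI'⟩ := hloc ⟨x, hx⟩
    have hs : (∑ i ∈ I, DForm.fmul (e i) (γ i j)).SmoothAt x := by
      refine SmoothAt.sum fun i _ => ?_
      -- On the support of the weight the local coefficient is smooth. Off the support it may be
      -- arbitrary, but the product vanishes nearby.
      by_cases hxi : (⟨x, hx⟩ : O) ∈ tsupport (χ i)
      · exact (((isSmoothOn_iff (hU i)).1 (hγ i j)) x (hχ i hxi)).fmul (hes i ⟨x, hx⟩)
      · refine (smoothAt_zero _ x).congr (hev ⟨x, hx⟩ ?_)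
        filter_upwards [(isClosed_tsupport (χ i)).isOpen_compl.mem_nhds hxi] with y hy
        have h0 : χ i y = 0 := by
          by_contra h0
          exact hy (subset_tsupport _ h0)
        change e i y • (γ i j).val y = 0
        rw [he', h0, zero_smul]
    refine hs.congr (hev ⟨x, hx⟩ ?_)
    filter_upwards [hI'] with y hy
    refine (hfin y I hy j).trans ?_
    exact (Finset.sum_apply (y : X) I (fun i => DForm.fmul (e i) (γ i j))).symm
  · obtain ⟨I, hI'⟩ := hloc ⟨x, hx⟩
    have hI0 := hI'.self_of_nhds
    have h0 : ∀ j, (ofVal fun x => ∑ᶠ i, e i x • (γ i j).val x).val x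
        = ∑ i ∈ I, e i x • (γ i j).val x := fun j => hfin ⟨x, hx⟩ I hI0 j
    simp only [h0, map_sum, map_smul]
    rw [Finset.sum_comm]
    -- Where the i-th weight is nonzero, the i-th coefficients reproduce ξ. The weights add up to 1,
    -- so the weighted coefficients reproduce ξ as well.
    have h1 : ∀ i ∈ I, ∑ j, e i x • wedgeInto k ((algGen j).2.val x) ((γ i j).val x)
        = e i x • ξ.val x := by
      intro i _
      rw [← Finset.smul_sum]
      by_cases hxi : x ∈ U i
      · rw [hξ i x hxi]
      · have h0 : e i x = 0 := by
          rw [he' i ⟨x, hx⟩]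
          by_contra h0
          exact hxi (hχ i (subset_tsupport _ h0))
        rw [h0, zero_smul, zero_smul]
    rw [Finset.sum_congr rfl h1, ← Finset.sum_smul]
    have h2 : ∑ i ∈ I, e i x = 1 := by
      have := χ.sum_eq_one (Set.mem_univ (⟨x, hx⟩ : O))
      rw [finsum_eq_sum_of_support_subset (s := I)] at this
      · rw [← this]
        exact Finset.sum_congr rfl fun i _ => he' i ⟨x, hx⟩
      · intro i hi
        by_contra hiI
        exact hi (hI0 i hiI)
    rw [h2, one_smul]

end Gluing

/-! ### Local sections of submersions -/

section Submersion

/-- P is restricted to the affine slice through a spanned by a right inverse R of its derivative.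
The restriction w ↦ P(a + R(w − P a)) has the identity as derivative at P a, so the inverse function
theorem applies to it. -/
theorem exists_contDiff_rightInverse {V W : Type*} [NormedAddCommGroup V] [NormedSpace ℝ V]
    [NormedAddCommGroup W] [NormedSpace ℝ W] [FiniteDimensional ℝ W]
    {P : V → W} {Ω : Set V} (hΩ : IsOpen Ω) (hP : ContDiffOn ℝ ∞ P Ω) {a : V} (ha : a ∈ Ω)
    (hs : Function.Surjective (fderiv ℝ P a)) :
    ∃ (B : Set W) (r : W → V), IsOpen B ∧ P a ∈ B ∧ r (P a) = a ∧ ContDiffOn ℝ ∞ r B ∧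
      Set.MapsTo r B Ω ∧ ∀ w ∈ B, P (r w) = w := by
  obtain ⟨R₀, hR₀⟩ := (fderiv ℝ P a : V →ₗ[ℝ] W).exists_rightInverse_of_surjective
    (LinearMap.range_eq_top.2 hs)
  set R : W →L[ℝ] V := LinearMap.toContinuousLinearMap R₀
  set j : W → V := fun w => a + R (w - P a) with hj
  have hjc : ContDiff ℝ ∞ j := contDiff_const.add (R.contDiff.comp (contDiff_id.sub contDiff_const))
  have hja : j (P a) = a := by simp [hj]
  set h : W → W := fun w => P (j w) with hh
  have hΩ' : IsOpen (j ⁻¹' Ω) := hΩ.preimage hjc.continuous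
  have hmem : P a ∈ j ⁻¹' Ω := by rw [Set.mem_preimage, hja]; exact ha
  have hhs : ContDiffOn ℝ ∞ h (j ⁻¹' Ω) := hP.comp hjc.contDiffOn (Set.mapsTo_preimage _ _)
  have hat : ∀ w ∈ j ⁻¹' Ω, ContDiffAt ℝ ∞ h w := fun w hw => hhs.contDiffAt (hΩ'.mem_nhds hw)
  have hd : HasFDerivAt h (ContinuousLinearEquiv.refl ℝ W : W →L[ℝ] W) (P a) := by
    have h1 : HasFDerivAt j R (P a) := by
      have := (R.hasFDerivAt.comp (P a) ((hasFDerivAt_id (P a)).sub_const (P a))).const_add a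
      simpa [hj] using this
    have h2 : HasFDerivAt P (fderiv ℝ P a) (j (P a)) := by
      rw [hja]
      exact ((hP.contDiffAt (hΩ.mem_nhds ha)).differentiableAt (by simp)).hasFDerivAt
    refine (h2.comp (P a) h1).congr_fderiv ?_
    ext w
    exact LinearMap.congr_fun hR₀ w
  have hha : h (P a) = P a := by rw [hh]; simp only [hja]
  set e := (hat _ hmem).toOpenPartialHomeomorph h hd (by simp) with he
  have hecoe : ⇑e = h := (hat _ hmem).toOpenPartialHomeomorph_coe hd (by simp)
  have hes : P a ∈ e.source := (hat _ hmem).mem_toOpenPartialHomeomorph_source hd (by simp)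
  have het : P a ∈ e.target := by
    have := e.map_source hes
    rwa [hecoe, hha] at this
  have hesym : e.symm (P a) = P a := by
    have := e.left_inv hes
    rwa [hecoe, hha] at this
  -- The local inverse must be smooth on a whole neighbourhood, which needs invertible derivatives
  -- at nearby points too. Invertible operators form an open set.
  have hunit : ∀ᶠ w in 𝓝 (P a), ∃ A : W ≃L[ℝ] W, (A : W →L[ℝ] W) = fderiv ℝ h w := by
    have hc : ContinuousAt (fderiv ℝ h) (P a) :=
      (((hat _ hmem).fderiv_right (m := ∞) (by simp)).continuousAt)
    have hn : ∀ᶠ B in 𝓝 (fderiv ℝ h (P a)), ∃ A : W ≃L[ℝ] W, (A : W →L[ℝ] W) = B := by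
      rw [hd.fderiv]
      exact ContinuousLinearEquiv.nhds (ContinuousLinearEquiv.refl ℝ W)
    exact hc.eventually (p := fun B => ∃ A : W ≃L[ℝ] W, (A : W →L[ℝ] W) = B) hn
  obtain ⟨D, hD, hDo, hDa⟩ := mem_nhds_iff.1 (hunit.and (hΩ'.mem_nhds hmem))
  refine ⟨e.target ∩ e.symm ⁻¹' D, fun w => j (e.symm w), e.symm.isOpen_inter_preimage hDo,
    ⟨het, by rw [Set.mem_preimage, hesym]; exact hDa⟩, ?_, ?_, ?_, ?_⟩
  · simp only [hesym, hja]
  · intro w hw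
    obtain ⟨⟨A, hA⟩, hw'⟩ := hD hw.2
    have hw2 := hat _ hw'
    refine (hjc.contDiffAt.comp w (e.contDiffAt_symm (f₀' := A) hw.1 ?_ ?_)).contDiffWithinAt
    · rw [hecoe, hA]
      exact (hw2.differentiableAt (by simp)).hasFDerivAt
    · rw [hecoe]; exact hw2
  · exact fun w hw => (hD hw.2).2
  · intro w hw
    have := e.right_inv hw.1
    rwa [hecoe] at this

variable {V : Type*} [NormedAddCommGroup V] [NormedSpace ℝ V]
variable {W : Type*} [NormedAddCommGroup W] [NormedSpace ℝ W] [FiniteDimensional ℝ W]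
variable {X : Type*} [TopologicalSpace X] [ChartedSpace V X] [IsManifold 𝓘(ℝ, V) ∞ X]
variable {Y : Type*} [TopologicalSpace Y] [ChartedSpace W Y] [IsManifold 𝓘(ℝ, W) ∞ Y]

/-- A submersion has smooth local sections. -/
theorem exists_local_section {f : X → Y} (hf : ContMDiff 𝓘(ℝ, V) 𝓘(ℝ, W) ∞ f) {a : X}
    (hs : Function.Surjective (mfderiv 𝓘(ℝ, V) 𝓘(ℝ, W) f a)) :
    ∃ (B : Set Y) (s : Y → X), IsOpen B ∧ f a ∈ B ∧ s (f a) = a ∧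
      (∀ y ∈ B, ContMDiffAt 𝓘(ℝ, W) 𝓘(ℝ, V) ∞ s y) ∧ ∀ y ∈ B, f (s y) = y := by
  set c := chartAt V a
  set c' := chartAt W (f a)
  have hc := chart_mem_atlas V a
  have ha := mem_chart_source V a
  have hc' := chart_mem_atlas W (f a)
  have ha' := mem_chart_source W (f a)
  set Ω : Set V := c.target ∩ c.symm ⁻¹' (f ⁻¹' c'.source)
  have hΩ : IsOpen Ω := c.symm.isOpen_inter_preimage (c'.open_source.preimage hf.continuous)
  have hP : ContDiffOn ℝ ∞ (fun y => c' (f (c.symm y))) Ω := fun y hy => by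
    have := contDiffAt_chartRep (hf (c.symm y)) hc (c.map_target hy.1) hc' hy.2
    rw [c.right_inv hy.1] at this
    exact this.contDiffWithinAt
  have haΩ : c a ∈ Ω := ⟨c.map_source ha, by
    rw [Set.mem_preimage, c.left_inv ha]; exact ha'⟩
  have hca : c' (f (c.symm (c a))) = c' (f a) := by rw [c.left_inv ha]
  -- The charts have invertible differentials, so the coordinate expression of f inherits
  -- surjectivity. A preimage is transported through both charts.
  have hs' : Function.Surjective (fderiv ℝ (fun y => c' (f (c.symm y))) (c a)) := by
    have d1 := (contMDiffAt_atlas_symm hc (c.map_source ha)).mdifferentiableAt (by simp)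
    have d2 := (hf a).mdifferentiableAt (by simp)
    have d3 := (contMDiffAt_atlas hc' ha').mdifferentiableAt (by simp)
    have d4 : MDifferentiableAt 𝓘(ℝ, V) 𝓘(ℝ, W) (c' ∘ f) (c.symm (c a)) := by
      rw [c.left_inv ha]; exact d3.comp a d2
    have e1 := mfderiv_comp (c a) (g := c' ∘ f) d4 d1
    have e2 : (mfderiv 𝓘(ℝ, V) 𝓘(ℝ, W) (c' ∘ f) (c.symm (c a)) : V →L[ℝ] W)
        = (mfderiv 𝓘(ℝ, V) 𝓘(ℝ, W) (c' ∘ f) a : V →L[ℝ] W) := by rw [c.left_inv ha]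
    have e3 := mfderiv_comp a d3 d2
    rw [mfderiv_eq_fderiv] at e1
    intro w
    obtain ⟨v, hv⟩ := hs ((mfderiv 𝓘(ℝ, W) 𝓘(ℝ, W) c'.symm (c' (f a)) : W →L[ℝ] W) w)
    refine ⟨(mfderiv 𝓘(ℝ, V) 𝓘(ℝ, V) c a : V →L[ℝ] V) v, ?_⟩
    refine (congrArg (fun A : V →L[ℝ] W => A ((mfderiv 𝓘(ℝ, V) 𝓘(ℝ, V) c a : V →L[ℝ] V) v))
      e1).trans ?_
    refine (congrArg (fun A : V →L[ℝ] W =>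
      A ((mfderiv 𝓘(ℝ, V) 𝓘(ℝ, V) c.symm (c a) : V →L[ℝ] V)
        ((mfderiv 𝓘(ℝ, V) 𝓘(ℝ, V) c a : V →L[ℝ] V) v))) (e2.trans e3)).trans ?_
    refine (congrArg (fun v => (mfderiv 𝓘(ℝ, W) 𝓘(ℝ, W) c' (f a) : W →L[ℝ] W)
      ((mfderiv 𝓘(ℝ, V) 𝓘(ℝ, W) f a : V →L[ℝ] W) v)) (mfderiv_symm_comp_mfderiv hc ha v)).trans ?_
    refine (congrArg (mfderiv 𝓘(ℝ, W) 𝓘(ℝ, W) c' (f a) : W →L[ℝ] W) hv).trans ?_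
    have := mfderiv_comp_mfderiv_symm hc' (c'.map_source ha') w
    rwa [c'.left_inv ha'] at this
  obtain ⟨B, r, hB, haB, hra, hr, hrΩ, hPr⟩ := exists_contDiff_rightInverse hΩ hP haΩ hs'
  simp only [hca] at haB hra
  refine ⟨c'.source ∩ c' ⁻¹' B, fun y => c.symm (r (c' y)), c'.isOpen_inter_preimage hB,
    ⟨ha', haB⟩, ?_, fun y hy => ?_, fun y hy => ?_⟩
  · simp only [hra, c.left_inv ha]
  · have h1 := contMDiffAt_atlas_symm hc (hrΩ hy.2).1
    have h2 : ContMDiffAt 𝓘(ℝ, W) 𝓘(ℝ, V) ∞ r (c' y) :=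
      (hr.contDiffAt (hB.mem_nhds hy.2)).contMDiffAt
    exact h1.comp y (h2.comp y (contMDiffAt_atlas hc' hy.1))
  · exact c'.injOn (hrΩ hy.2).2 hy.1 (hPr _ hy.2)

end Submersion

/-! ### Topology of the bundles -/

theorem exists_countable_chart_cover {n : ℕ} (M : Type*) [TopologicalSpace M]
    [ChartedSpace (E n) M] [SigmaCompactSpace M] :
    ∃ s : Set M, s.Countable ∧ ∀ x : M, ∃ y ∈ s, x ∈ (chartAt (E n) y).source := by
  obtain ⟨s, hs, hu⟩ := countable_cover_nhds_of_sigmaCompact fun x : M =>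
    chart_source_mem_nhds (E n) x
  refine ⟨s, hs, fun x => ?_⟩
  have : x ∈ ⋃ y ∈ s, (chartAt (E n) y).source := hu ▸ Set.mem_univ x
  simpa using this

namespace J1LM

variable {n : ℕ} {M : Type*} [TopologicalSpace M] [ChartedSpace (E n) M] [IsManifold (𝓡 n) ∞ M]

/-- The chart of `J¹LM` associated with a chart of `M`, as a local homeomorphism. -/
def chartH (φ : OpenPartialHomeomorph M (E n)) (hφ : φ ∈ Charts n M) :
    OpenPartialHomeomorph (J1LM n M) (VJ n) :=
  (core n M).openPartialHomeomorph (chart φ hφ) ⟨φ, hφ, rfl⟩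

variable {φ : OpenPartialHomeomorph M (E n)} (hφ : φ ∈ Charts n M)

theorem chartH_mem_atlas : chartH φ hφ ∈ atlas (VJ n) (J1LM n M) :=
  Set.mem_iUnion₂.2 ⟨chart φ hφ, ⟨φ, hφ, rfl⟩, rfl⟩

theorem coe_chartH : ⇑(chartH φ hφ) = coord φ := rfl

theorem chartH_source : (chartH φ hφ).source = {p | p.base ∈ φ.source} := rfl

theorem contMDiffAt_coord (hφ : φ ∈ Charts n M) {p : J1LM n M} (hp : p.base ∈ φ.source) :
    ContMDiffAt 𝓘(ℝ, VJ n) 𝓘(ℝ, VJ n) ∞ (coord φ) p := by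
  have h : p ∈ (chartH φ hφ).source := hp
  exact contMDiffAt_atlas (V := VJ n) (X := J1LM n M) (c := chartH φ hφ) (chartH_mem_atlas hφ) h

theorem isOpen_base_preimage (hφ : φ ∈ Charts n M) : IsOpen {p : J1LM n M | p.base ∈ φ.source} :=
  (chartH φ hφ).open_source

theorem contMDiff_base : ContMDiff 𝓘(ℝ, VJ n) (𝓡 n) ∞ (base : J1LM n M → M) := by
  intro p
  have hc := IsManifold.chart_mem_maximalAtlas (I := 𝓡 n) (n := ∞) p.base
  have hp := mem_chart_source (E n) p.base
  have h1 : ContMDiffAt 𝓘(ℝ, VJ n) 𝓘(ℝ, E n) ∞ (fun q => (coord (chartAt (E n) p.base) q).1) p :=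
    (contDiff_fst.contMDiff.contMDiffAt).comp p (contMDiffAt_coord hc hp)
  have h2 := (contMDiffAt_symm_of_mem_maximalAtlas hc
    ((chartAt (E n) p.base).map_source hp)).comp p h1
  refine h2.congr_of_eventuallyEq ?_
  filter_upwards [(isOpen_base_preimage hc).mem_nhds hp] with q hq
  exact ((chartAt (E n) p.base).left_inv hq).symm

/-- Points over the same base point lie in a common chart, and points over different base points are
separated in M. -/
instance [T2Space M] : T2Space (J1LM n M) := by
  rw [t2Space_iff_disjoint_nhds]
  intro p q hpq
  by_cases h : p.base = q.base
  · have hc := IsManifold.chart_mem_maximalAtlas (I := 𝓡 n) (n := ∞) p.base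
    set e := chartH _ hc
    have hp : p ∈ e.source := mem_chart_source (E n) p.base
    have hq : q ∈ e.source := by
      rw [chartH_source]
      simp [h]
    refine (e.continuousAt hp).disjoint ?_ (e.continuousAt hq)
    exact disjoint_nhds_nhds.2 fun h' => hpq (e.injOn hp hq h')
  · exact contMDiff_base.continuous.continuousAt.disjoint (disjoint_nhds_nhds.2 h)
      contMDiff_base.continuous.continuousAt

instance [SigmaCompactSpace M] : SecondCountableTopology (J1LM n M) := by
  obtain ⟨s, hs, hu⟩ := exists_countable_chart_cover (n := n) M
  refine ChartedSpace.secondCountable_of_countable_cover (VJ n)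
    -- The preferred chart of a jet depends only on its base point, so any jet over y will do. The
    -- one with identity frame and zero derivatives is chosen.
    (s := (fun x => (⟨x, 1, 0, isUnit_one⟩ : J1LM n M)) '' s) ?_ (hs.image _)
  refine Set.eq_univ_of_forall fun p => ?_
  obtain ⟨y, hy, hp⟩ := hu p.base
  exact Set.mem_iUnion₂.2 ⟨_, ⟨y, hy, rfl⟩, hp⟩

end J1LM

namespace CSigma

variable {n : ℕ} {M : Type*} [TopologicalSpace M] [ChartedSpace (E n) M] [IsManifold (𝓡 n) ∞ M]

/-- The chart of `C(LM) ×_M Σ` associated with a chart of `M`, as a local homeomorphism. -/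
def chartH (φ : OpenPartialHomeomorph M (E n)) (hφ : φ ∈ Charts n M) (o : ℤˣ) :
    OpenPartialHomeomorph (CSigma n M) (VQ n) :=
  (core n M).openPartialHomeomorph (chart φ hφ o) ⟨φ, hφ, o, rfl⟩

variable {φ : OpenPartialHomeomorph M (E n)} (hφ : φ ∈ Charts n M)

theorem chartH_mem_atlas (o : ℤˣ) : chartH φ hφ o ∈ atlas (VQ n) (CSigma n M) :=
  Set.mem_iUnion₂.2 ⟨chart φ hφ o, ⟨φ, hφ, o, rfl⟩, rfl⟩

theorem chartH_source (o : ℤˣ) :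
    (chartH φ hφ o).source = {q | q.base ∈ φ.source ∧ orientIn φ q = o} := rfl

theorem contMDiffAt_coord (hφ : φ ∈ Charts n M) {q : CSigma n M} (hq : q.base ∈ φ.source) :
    ContMDiffAt 𝓘(ℝ, VQ n) 𝓘(ℝ, VQ n) ∞ (coord φ) q := by
  have h : q ∈ (chartH φ hφ (orientIn φ q)).source := ⟨hq, rfl⟩
  exact contMDiffAt_atlas (V := VQ n) (X := CSigma n M) (c := chartH φ hφ (orientIn φ q))
    (chartH_mem_atlas hφ _) h

theorem isOpen_base_preimage (hφ : φ ∈ Charts n M) : IsOpen {q : CSigma n M | q.base ∈ φ.source} := by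
  have : {q : CSigma n M | q.base ∈ φ.source} = ⋃ o, (chartH φ hφ o).source := by
    ext q; simp [chartH_source]
  rw [this]
  exact isOpen_iUnion fun o => (chartH φ hφ o).open_source

theorem contMDiff_base : ContMDiff 𝓘(ℝ, VQ n) (𝓡 n) ∞ (base : CSigma n M → M) := by
  intro p
  have hc := IsManifold.chart_mem_maximalAtlas (I := 𝓡 n) (n := ∞) p.base
  have hp := mem_chart_source (E n) p.base
  have h1 : ContMDiffAt 𝓘(ℝ, VQ n) 𝓘(ℝ, E n) ∞ (fun q => (coord (chartAt (E n) p.base) q).1) p :=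
    (contDiff_fst.contMDiff.contMDiffAt).comp p (contMDiffAt_coord hc hp)
  have h2 := (contMDiffAt_symm_of_mem_maximalAtlas hc
    ((chartAt (E n) p.base).map_source hp)).comp p h1
  refine h2.congr_of_eventuallyEq ?_
  filter_upwards [(isOpen_base_preimage hc).mem_nhds hp] with q hq
  exact ((chartAt (E n) p.base).left_inv hq).symm

theorem orientIn_chartAt (q : CSigma n M) : orientIn (chartAt (E n) q.base) q = q.orient := by
  simp [orientIn, jac_self (mem_chart_source (E n) q.base), det_one, sgn]

instance [T2Space M] : T2Space (CSigma n M) := by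
  rw [t2Space_iff_disjoint_nhds]
  intro p q hpq
  by_cases h : p.base = q.base
  · have hc := IsManifold.chart_mem_maximalAtlas (I := 𝓡 n) (n := ∞) p.base
    set c := chartAt (E n) p.base with hcdef
    have hp : p.base ∈ c.source := mem_chart_source (E n) p.base
    have hq : q.base ∈ c.source := h ▸ hp
    by_cases ho : orientIn c p = orientIn c q
    · have hp' : p ∈ (chartH c hc (orientIn c p)).source := ⟨hp, rfl⟩
      have hq' : q ∈ (chartH c hc (orientIn c p)).source := ⟨hq, ho.symm⟩
      refine ((chartH c hc (orientIn c p)).continuousAt hp').disjoint ?_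
        ((chartH c hc (orientIn c p)).continuousAt hq')
      exact disjoint_nhds_nhds.2 fun h' =>
        hpq ((chartH c hc (orientIn c p)).injOn hp' hq' h')
    -- Opposite orientations over the same point lie in disjoint chart domains.
    · refine Filter.disjoint_of_disjoint_of_mem ?_
        ((chartH c hc (orientIn c p)).open_source.mem_nhds ⟨hp, rfl⟩)
        ((chartH c hc (orientIn c q)).open_source.mem_nhds ⟨hq, rfl⟩)
      exact Set.disjoint_left.2 fun r hr hr' => ho (hr.2.symm.trans hr'.2)
  · exact contMDiff_base.continuous.continuousAt.disjoint (disjoint_nhds_nhds.2 h)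
      contMDiff_base.continuous.continuousAt

instance [SigmaCompactSpace M] : SecondCountableTopology (CSigma n M) := by
  obtain ⟨s, hs, hu⟩ := exists_countable_chart_cover (n := n) M
  refine ChartedSpace.secondCountable_of_countable_cover (VQ n)
    -- Each chart of M gives two charts here, one per orientation, so representatives of both
    -- orientations are needed. The zero connection and the metric η are arbitrary choices.
    (s := (fun z : M × ℤˣ => (⟨z.1, 0, eta n, z.2, isLorentz_eta⟩ : CSigma n M)) ''
      (s ×ˢ Set.univ)) ?_ ((hs.prod Set.countable_univ).image _)
  refine Set.eq_univ_of_forall fun p => ?_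
  obtain ⟨y, hy, hp⟩ := hu p.base
  refine Set.mem_iUnion₂.2 ⟨_, ⟨⟨y, orientIn (chartAt (E n) y) p⟩, ⟨hy, Set.mem_univ _⟩, rfl⟩, hp, ?_⟩
  exact (orientIn_chartAt (⟨y, 0, eta n, orientIn (chartAt (E n) y) p, isLorentz_eta⟩ :
    CSigma n M)).symm

end CSigma

/-! ### One-forms given by functionals in a chart, and their exterior derivatives. -/

section OneForms

variable {V : Type*} [NormedAddCommGroup V] [NormedSpace ℝ V]
variable {X : Type*} [TopologicalSpace X] [ChartedSpace V X] [IsManifold 𝓘(ℝ, V) ∞ X]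

namespace DForm

theorem rep_oneForm {c : OpenPartialHomeomorph X V} (hc : c ∈ atlas V X) {x : X}
    (hx : x ∈ c.source) {α : DForm V X 1} {a : V → V →L[ℝ] ℝ}
    (h : ∀ᶠ y in 𝓝 x, α.val y = ContinuousAlternatingMap.ofSubsingleton ℝ V ℝ (0 : Fin 1)
      ((a (c y)).comp (mfderiv 𝓘(ℝ, V) 𝓘(ℝ, V) c y : V →L[ℝ] V))) :
    α.rep c =ᶠ[𝓝 (c x)]
      fun y => ContinuousAlternatingMap.ofSubsingleton ℝ V ℝ (0 : Fin 1) (a y) := by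
  filter_upwards [eventually_symm hx h, c.open_target.mem_nhds (c.map_source hx)] with y hy hy'
  refine ContinuousAlternatingMap.ext fun v => ?_
  have e : (α.rep c y : V [⋀^Fin 1]→L[ℝ] ℝ) v = α.val (c.symm y)
    (fun i => (mfderiv 𝓘(ℝ, V) 𝓘(ℝ, V) c.symm y : V →L[ℝ] V) (v i)) := rfl
  rw [e, hy, c.right_inv hy']
  exact congrArg (a y) (mfderiv_comp_mfderiv_symm hc hy' (v 0))

theorem contDiffAt_ofSubsingleton [FiniteDimensional ℝ V] {a : V → V →L[ℝ] ℝ} {y : V}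
    {r : WithTop ℕ∞} (ha : ContDiffAt ℝ r a y) :
    ContDiffAt ℝ r (fun y => ContinuousAlternatingMap.ofSubsingleton ℝ V ℝ (0 : Fin 1) (a y)) y :=
  contDiffAt_alt_iff.2 fun _ => ha.clm_apply contDiffAt_const

theorem smoothAt_of_oneForm [FiniteDimensional ℝ V] {c : OpenPartialHomeomorph X V}
    (hc : c ∈ atlas V X) {x : X}
    (hx : x ∈ c.source) {α : DForm V X 1} {a : V → V →L[ℝ] ℝ}
    (h : ∀ᶠ y in 𝓝 x, α.val y = ContinuousAlternatingMap.ofSubsingleton ℝ V ℝ (0 : Fin 1)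
      ((a (c y)).comp (mfderiv 𝓘(ℝ, V) 𝓘(ℝ, V) c y : V →L[ℝ] V)))
    (ha : ContDiffAt ℝ ∞ a (c x)) : α.SmoothAt x :=
  (smoothAt_iff hc hx).2
    ((contDiffAt_ofSubsingleton ha).congr_of_eventuallyEq (rep_oneForm hc hx h))

theorem ext_of_oneForm [FiniteDimensional ℝ V] {c : OpenPartialHomeomorph X V}
    (hc : c ∈ atlas V X) {x : X}
    (hx : x ∈ c.source) {α : DForm V X 1} {a : V → V →L[ℝ] ℝ}
    (h : ∀ᶠ y in 𝓝 x, α.val y = ContinuousAlternatingMap.ofSubsingleton ℝ V ℝ (0 : Fin 1)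
      ((a (c y)).comp (mfderiv 𝓘(ℝ, V) 𝓘(ℝ, V) c y : V →L[ℝ] V)))
    (ha : ContDiffAt ℝ ∞ a (c x)) (D : V →L[ℝ] V) (hD : D = mfderiv 𝓘(ℝ, V) 𝓘(ℝ, V) c x)
    (v w : V) :
    α.ext.val x ![v, w] = fderiv ℝ (fun y => a y (D w)) (c x) (D v)
      - fderiv ℝ (fun y => a y (D v)) (c x) (D w) := by
  have hr := rep_oneForm hc hx h
  have hs := contDiffAt_ofSubsingleton ha
  have hd := hs.differentiableAt (by simp)
  have h1 := ext_eq (α := α) hc hx (hd.congr_of_eventuallyEq hr)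
  have h2 := extDeriv_apply hd ![D v, D w]
  rw [hr.extDeriv_eq] at h1
  have h3 : α.ext.val x ![v, w] = (extDeriv (fun y => ContinuousAlternatingMap.ofSubsingleton ℝ V ℝ
      (0 : Fin 1) (a y)) (c x)) ![D v, D w] := by
    refine (congrArg (fun b : V [⋀^Fin 2]→L[ℝ] ℝ => b ![v, w]) h1).trans ?_
    subst hD
    refine congrArg (extDeriv (fun y => ContinuousAlternatingMap.ofSubsingleton ℝ V ℝ
      (0 : Fin 1) (a y)) (c x)) (funext fun i => ?_)
    fin_cases i <;> rfl
  rw [h3, h2]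
  simp [Fin.sum_univ_two, Fin.removeNth, sub_eq_add_neg]

theorem alt_ext_two {b b' : V [⋀^Fin 2]→L[ℝ] ℝ} (h : ∀ v w, b ![v, w] = b' ![v, w]) : b = b' :=
  ContinuousAlternatingMap.ext fun v => by
    have : v = ![v 0, v 1] := by ext i; fin_cases i <;> rfl
    rw [this]; exact h _ _

end DForm

end OneForms

/-! ### Directional derivatives -/

section DirDeriv

variable {V F G : Type*} [NormedAddCommGroup V] [NormedSpace ℝ V] [NormedAddCommGroup F]
  [NormedSpace ℝ F] [NormedAddCommGroup G] [NormedSpace ℝ G]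

/-- `f` is differentiable at `z`, with derivative `D`. -/
def HasDirDeriv (f : V → F) (z : V) (D : V → F) : Prop :=
  ∃ D' : V →L[ℝ] F, HasFDerivAt f D' z ∧ ∀ v, D' v = D v

namespace HasDirDeriv

variable {f g : V → F} {z : V} {D D₁ : V → F}

theorem differentiableAt (h : HasDirDeriv f z D) : DifferentiableAt ℝ f z := by
  obtain ⟨D', h, -⟩ := h
  exact h.differentiableAt

theorem fderiv_apply (h : HasDirDeriv f z D) (v : V) : fderiv ℝ f z v = D v := by
  obtain ⟨D', h, h'⟩ := h
  rw [h.fderiv, h']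

theorem of_differentiableAt (h : DifferentiableAt ℝ f z) : HasDirDeriv f z (fderiv ℝ f z) :=
  ⟨_, h.hasFDerivAt, fun _ => rfl⟩

theorem of_clm (A : V →L[ℝ] F) (z : V) : HasDirDeriv (fun z => A z) z fun v => A v :=
  ⟨A, A.hasFDerivAt, fun _ => rfl⟩

theorem const (c : F) (z : V) : HasDirDeriv (fun _ => c) z fun _ => 0 :=
  ⟨0, hasFDerivAt_const c z, fun _ => rfl⟩

theorem sub (hf : HasDirDeriv f z D) (hg : HasDirDeriv g z D₁) :
    HasDirDeriv (fun z => f z - g z) z fun v => D v - D₁ v := by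
  obtain ⟨D', h, h'⟩ := hf
  obtain ⟨D₁', h₁, h₁'⟩ := hg
  exact ⟨D' - D₁', h.sub h₁, fun v => by simp [h', h₁']⟩

theorem neg (hf : HasDirDeriv f z D) : HasDirDeriv (fun z => -f z) z fun v => -D v := by
  obtain ⟨D', h, h'⟩ := hf
  exact ⟨-D', h.neg, fun v => by simp [h']⟩

theorem clm (A : F →L[ℝ] G) (hf : HasDirDeriv f z D) :
    HasDirDeriv (fun z => A (f z)) z fun v => A (D v) := by
  obtain ⟨D', h, h'⟩ := hf
  exact ⟨A.comp D', A.hasFDerivAt.comp z h, fun v => by simp [h']⟩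

theorem comp {k : F → G} {K : F → G} (hk : HasDirDeriv k (f z) K) (hf : HasDirDeriv f z D) :
    HasDirDeriv (fun z => k (f z)) z fun v => K (D v) := by
  obtain ⟨D', h, h'⟩ := hf
  obtain ⟨K', h₁, h₁'⟩ := hk
  exact ⟨K'.comp D', h₁.comp z h, fun v => by simp [h', h₁']⟩

theorem congr_deriv {D₂ : V → F} (hf : HasDirDeriv f z D) (h : ∀ v, D₂ v = D v) :
    HasDirDeriv f z D₂ := by
  rwa [funext h]

theorem prodMk {g : V → G} {D₁ : V → G} (hf : HasDirDeriv f z D) (hg : HasDirDeriv g z D₁) :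
    HasDirDeriv (fun z => (f z, g z)) z fun v => (D v, D₁ v) := by
  obtain ⟨D', h, h'⟩ := hf
  obtain ⟨D₁', h₁, h₁'⟩ := hg
  exact ⟨D'.prod D₁', h.prodMk h₁, fun v => by simp [h', h₁']⟩

theorem clm_apply {k : V → F →L[ℝ] G} {K : V → F →L[ℝ] G} (hk : HasDirDeriv k z K)
    (hf : HasDirDeriv f z D) :
    HasDirDeriv (fun z => k z (f z)) z fun v => K v (f z) + k z (D v) := by
  obtain ⟨D', h, h'⟩ := hf
  obtain ⟨K', h₁, h₁'⟩ := hk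
  exact ⟨_, h₁.clm_apply h, fun v => by simp [h', h₁', add_comm]⟩

variable {R : Type*} [NormedRing R] [NormedAlgebra ℝ R] {a b : V → R} {Da Db : V → R}

theorem mul (ha : HasDirDeriv a z Da) (hb : HasDirDeriv b z Db) :
    HasDirDeriv (fun z => a z * b z) z fun v => Da v * b z + a z * Db v := by
  obtain ⟨A, h, h'⟩ := ha
  obtain ⟨B, h₁, h₁'⟩ := hb
  exact ⟨_, h.mul' h₁, fun v => by simp [h', h₁', add_comm]⟩

theorem inverse [HasSummableGeomSeries R] (ha : HasDirDeriv a z Da) (hz : IsUnit (a z)) :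
    HasDirDeriv (fun z => Ring.inverse (a z)) z
      fun v => -(Ring.inverse (a z) * Da v * Ring.inverse (a z)) := by
  obtain ⟨A, h, h'⟩ := ha
  obtain ⟨u, hu⟩ := hz
  have h1 := hasFDerivAt_ringInverse (𝕜 := ℝ) u
  rw [hu] at h1
  refine ⟨_, h1.comp z h, fun v => ?_⟩
  rw [← hu, Ring.inverse_unit]
  simp [h']

end HasDirDeriv

end DirDeriv

/-! ### Matrix entries of endomorphisms. -/

section Entries

variable {n : ℕ}

theorem entry_apply (i j : Fin n) (A : L n) :
    entry i j A = A (EuclideanSpace.single j (1 : ℝ)) i := rfl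

theorem sum_single (y : E n) : y = ∑ k, y k • EuclideanSpace.single k (1 : ℝ) := by
  ext i; simp [Finset.sum_apply, Pi.single_apply]

theorem apply_eq_sum (A : L n) (y : E n) (i : Fin n) : A y i = ∑ k, entry i k A * y k := by
  conv_lhs => rw [sum_single y]
  simp [entry_apply, mul_comm]

theorem entry_mul (i j : Fin n) (A B : L n) :
    entry i j (A * B) = ∑ k, entry i k A * entry k j B := by
  rw [entry_apply]
  exact apply_eq_sum A _ i

theorem entry_star (i j : Fin n) (A : L n) : entry i j (star A) = entry j i A := by
  have h := ContinuousLinearMap.adjoint_inner_left A (EuclideanSpace.single i (1 : ℝ))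
    (EuclideanSpace.single j (1 : ℝ))
  simp only [EuclideanSpace.inner_single_left, EuclideanSpace.inner_single_right] at h
  rw [entry_apply, entry_apply, ContinuousLinearMap.star_eq_adjoint]
  simpa using h

theorem entry_eta (i j : Fin n) : entry i j (eta n) = etaMatrix n i j := by
  rw [entry_apply, eta, Matrix.ofLp_toEuclideanCLM]
  simp

theorem entry_one (i j : Fin n) : entry i j (1 : L n) = if i = j then 1 else 0 := by
  simp [entry_apply]

end Entries

/-! ### Differentials of the jet coordinates and their change of chart. -/

/-- The coordinates `e^μ_k` of `VJ n`. -/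
def frameL (n : ℕ) : VJ n →L[ℝ] L n :=
  (ContinuousLinearMap.fst ℝ (L n) (E n →L[ℝ] L n)).comp
    (ContinuousLinearMap.snd ℝ (E n) (L n × (E n →L[ℝ] L n)))

/-- The coordinates `e^μ_{kν}` of `VJ n`. -/
def jetL (n : ℕ) : VJ n →L[ℝ] (E n →L[ℝ] L n) :=
  (ContinuousLinearMap.snd ℝ (L n) (E n →L[ℝ] L n)).comp
    (ContinuousLinearMap.snd ℝ (E n) (L n × (E n →L[ℝ] L n)))

theorem hasDirDeriv_fst {n : ℕ} (z : VJ n) :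
    HasDirDeriv (fun z : VJ n => z.1) z fun v => v.1 :=
  .of_clm (ContinuousLinearMap.fst ℝ (E n) (L n × (E n →L[ℝ] L n))) z

theorem hasDirDeriv_frame {n : ℕ} (z : VJ n) :
    HasDirDeriv (fun z : VJ n => z.2.1) z fun v => v.2.1 := .of_clm (frameL n) z

theorem hasDirDeriv_jet {n : ℕ} (z : VJ n) :
    HasDirDeriv (fun z : VJ n => z.2.2) z fun v => v.2.2 := .of_clm (jetL n) z

namespace J1LM

variable {n : ℕ} {M : Type*} [TopologicalSpace M] [ChartedSpace (E n) M] [IsManifold (𝓡 n) ∞ M]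
variable {φ ψ : OpenPartialHomeomorph M (E n)}

/-- The differential of the jet coordinates. -/
def dcoord (φ : OpenPartialHomeomorph M (E n)) (p : J1LM n M) : VJ n →L[ℝ] VJ n :=
  mfderiv 𝓘(ℝ, VJ n) 𝓘(ℝ, VJ n) (coord φ) p

theorem isUnit_coord (hφ : φ ∈ Charts n M) {p : J1LM n M} (hp : p.base ∈ φ.source) :
    IsUnit (coord φ p).2.1 := ((chartH φ hφ).map_source hp).2

/-- The differential of a function of the jet coordinates. -/
theorem mfderiv_of_coord {F : Type*} [NormedAddCommGroup F] [NormedSpace ℝ F] {f : J1LM n M → F}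
    {h D : VJ n → F} (hφ : φ ∈ Charts n M) {p : J1LM n M} (hp : p.base ∈ φ.source)
    (hf : ∀ᶠ q in 𝓝 p, f q = h (coord φ q)) (hh : HasDirDeriv h (coord φ p) D) (v : VJ n) :
    (mfderiv 𝓘(ℝ, VJ n) 𝓘(ℝ, F) f p : VJ n →L[ℝ] F) v = D (dcoord φ p v) := by
  have e : f =ᶠ[𝓝 p] h ∘ coord φ := hf
  rw [e.mfderiv_eq]
  have := mfderiv_comp p (I'' := 𝓘(ℝ, F)) hh.differentiableAt.mdifferentiableAt
    ((contMDiffAt_coord hφ hp).mdifferentiableAt (by simp))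
  rw [mfderiv_eq_fderiv] at this
  refine (congrArg (fun A : VJ n →L[ℝ] F => A v) this).trans ?_
  exact hh.fderiv_apply _

theorem coord_change (hφ : φ ∈ Charts n M) (hψ : ψ ∈ Charts n M) {p : J1LM n M}
    (hp : p.base ∈ φ.source) (hp' : p.base ∈ ψ.source) :
    coord ψ p = (tr φ ψ (coord φ p).1, jac φ ψ (coord φ p).1 * (coord φ p).2.1,
      jetChange (jac φ ψ (coord φ p).1) (jac ψ φ (tr φ ψ (coord φ p).1)) (hess φ ψ (coord φ p).1)
        (coord φ p).2.1 (coord φ p).2.2) := by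
  have h := coord_ofCoord hφ hψ hp hp' (isUnit_coord hφ hp) (coord φ p).2.2
  have e : ofCoord φ (φ p.base, (coord φ p).2.1, (coord φ p).2.2) = p := ofCoord_coord hφ hp
  rw [e] at h
  have e1 : (coord φ p).1 = φ p.base := rfl
  have e2 : tr φ ψ (φ p.base) = ψ p.base := by simp [tr, φ.left_inv hp]
  rw [e1, e2]
  exact h

theorem eventually_base (hφ : φ ∈ Charts n M) {p : J1LM n M} (hp : p.base ∈ φ.source) :
    ∀ᶠ q : J1LM n M in 𝓝 p, q.base ∈ φ.source := (isOpen_base_preimage hφ).mem_nhds hp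

theorem dcoord_fst (hφ : φ ∈ Charts n M) (hψ : ψ ∈ Charts n M) {p : J1LM n M}
    (hp : p.base ∈ φ.source) (hp' : p.base ∈ ψ.source) (v : VJ n) :
    (dcoord ψ p v).1 = jac φ ψ (φ p.base) (dcoord φ p v).1 := by
  have d1 : DifferentiableAt ℝ (tr φ ψ) (φ p.base) := ((contDiffOn_tr hφ hψ).contDiffAt
    ((isOpen_overlap φ ψ).mem_nhds (mem_overlap hp hp'))).differentiableAt (by simp)
  have h1 := mfderiv_of_coord (f := fun q => (coord ψ q).1) (h := fun z => z.1) hψ hp'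
    (Filter.Eventually.of_forall fun _ => rfl) (hasDirDeriv_fst _) v
  have h2 := mfderiv_of_coord (f := fun q => (coord ψ q).1) (h := fun z => tr φ ψ z.1) hφ hp
    (by
      filter_upwards [eventually_base hφ hp, eventually_base hψ hp'] with q hq hq'
      rw [coord_change hφ hψ hq hq'])
    (HasDirDeriv.comp (k := tr φ ψ) (.of_differentiableAt d1) (hasDirDeriv_fst (coord φ p))) v
  exact h1.symm.trans h2

/-- Differentiating u ↦ Ju, with J the Jacobian, produces a Hessian term. It is the one cancelled in
ω by the inhomogeneous term in the rule for jets. The differentials of the e^μ_{kν} are not needed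
in a second chart, because θ and ω contain only dx and du. -/
theorem dcoord_snd (hφ : φ ∈ Charts n M) (hψ : ψ ∈ Charts n M) {p : J1LM n M}
    (hp : p.base ∈ φ.source) (hp' : p.base ∈ ψ.source) (v : VJ n) :
    (dcoord ψ p v).2.1 = hess φ ψ (φ p.base) (dcoord φ p v).1 * (coord φ p).2.1
      + jac φ ψ (φ p.base) * (dcoord φ p v).2.1 := by
  have d1 : DifferentiableAt ℝ (jac φ ψ) (φ p.base) := ((contDiffOn_jac hφ hψ).contDiffAt
    ((isOpen_overlap φ ψ).mem_nhds (mem_overlap hp hp'))).differentiableAt (by simp)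
  have h1 := mfderiv_of_coord (f := fun q => (coord ψ q).2.1) (h := fun z => z.2.1) hψ hp'
    (Filter.Eventually.of_forall fun _ => rfl) (hasDirDeriv_frame _) v
  have h2 := mfderiv_of_coord (f := fun q => (coord ψ q).2.1)
    (h := fun z => jac φ ψ z.1 * z.2.1) hφ hp
    (by
      filter_upwards [eventually_base hφ hp, eventually_base hψ hp'] with q hq hq'
      rw [coord_change hφ hψ hq hq'])
    ((HasDirDeriv.comp (k := jac φ ψ) (f := fun z : VJ n => z.1) (z := coord φ p) (.of_differentiableAt d1)
      (hasDirDeriv_fst (coord φ p))).mul (hasDirDeriv_frame _)) v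
  exact h1.symm.trans h2

end J1LM

/-! ### The canonical forms in coordinates -/

section Model

variable {n : ℕ}

/-- The tautological form in jet coordinates. -/
def thetaModel (z : VJ n) : VJ n →L[ℝ] E n :=
  (Ring.inverse z.2.1).comp (ContinuousLinearMap.fst ℝ (E n) (L n × (E n →L[ℝ] L n)))

/-- The canonical connection form in jet coordinates. -/
def omegaModel (z : VJ n) : VJ n →L[ℝ] L n :=
  (ContinuousLinearMap.compL ℝ (E n) (E n) (E n) (Ring.inverse z.2.1)).comp
    ((ContinuousLinearMap.fst ℝ (L n) (E n →L[ℝ] L n)).comp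
      (ContinuousLinearMap.snd ℝ (E n) (L n × (E n →L[ℝ] L n)))
      - z.2.2.comp (ContinuousLinearMap.fst ℝ (E n) (L n × (E n →L[ℝ] L n))))

theorem thetaModel_apply (z v : VJ n) : thetaModel z v = Ring.inverse z.2.1 v.1 := rfl

theorem omegaModel_apply (z v : VJ n) :
    omegaModel z v = Ring.inverse z.2.1 * (v.2.1 - z.2.2 v.1) := rfl

theorem contDiffAt_inverse_frame {z : VJ n} (hz : IsUnit z.2.1) :
    ContDiffAt ℝ ∞ (fun z : VJ n => Ring.inverse z.2.1) z := by
  obtain ⟨u, hu⟩ := hz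
  have := contDiffAt_ringInverse (n := ∞) ℝ u
  rw [hu] at this
  exact this.comp z (contDiff_fst.comp contDiff_snd).contDiffAt

theorem contDiffAt_thetaModel {z : VJ n} (hz : IsUnit z.2.1) :
    ContDiffAt ℝ ∞ (thetaModel : VJ n → _) z :=
  (contDiffAt_inverse_frame hz).clm_comp contDiffAt_const

theorem contDiffAt_omegaModel {z : VJ n} (hz : IsUnit z.2.1) :
    ContDiffAt ℝ ∞ (omegaModel : VJ n → _) z := by
  refine ContDiffAt.clm_comp ?_ (contDiffAt_const.sub (ContDiffAt.clm_comp ?_ contDiffAt_const))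
  · exact (ContinuousLinearMap.contDiff _).contDiffAt.comp z (contDiffAt_inverse_frame hz)
  · exact (contDiff_snd.comp contDiff_snd).contDiffAt

theorem fderiv_thetaModel {z : VJ n} (hz : IsUnit z.2.1) (i : Fin n) (v w : VJ n) :
    fderiv ℝ (fun z : VJ n => ((EuclideanSpace.proj i).comp (thetaModel z) : VJ n →L[ℝ] ℝ) w) z v
      = -(Ring.inverse z.2.1 * v.2.1 * Ring.inverse z.2.1) w.1 i := by
  have h := HasDirDeriv.clm ((EuclideanSpace.proj i : E n →L[ℝ] ℝ).comp
      (ContinuousLinearMap.apply ℝ (E n) w.1)) ((hasDirDeriv_frame z).inverse hz)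
  exact (h.fderiv_apply v).trans rfl

theorem fderiv_omegaModel {z : VJ n} (hz : IsUnit z.2.1) (i j : Fin n) (v w : VJ n) :
    fderiv ℝ (fun z : VJ n => ((entry i j).comp (omegaModel z) : VJ n →L[ℝ] ℝ) w) z v
      = entry i j (-(Ring.inverse z.2.1 * v.2.1 * Ring.inverse z.2.1) * (w.2.1 - z.2.2 w.1)
        + Ring.inverse z.2.1 * (0 - v.2.2 w.1)) := by
  have h := HasDirDeriv.clm (entry i j) (((hasDirDeriv_frame z).inverse hz).mul
    ((HasDirDeriv.const w.2.1 z).sub (HasDirDeriv.clm (ContinuousLinearMap.apply ℝ (L n) w.1)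
      (hasDirDeriv_jet z))))
  exact h.fderiv_apply v

end Model

section Forms

variable {n : ℕ} {M : Type*} [TopologicalSpace M] [ChartedSpace (E n) M] [IsManifold (𝓡 n) ∞ M]
variable {φ ψ : OpenPartialHomeomorph M (E n)}

open J1LM

theorem inverse_mul_of_isUnit {R : Type*} [Ring R] {a b : R} (ha : IsUnit a) (hb : IsUnit b) :
    Ring.inverse (a * b) = Ring.inverse b * Ring.inverse a := by
  obtain ⟨u, rfl⟩ := ha
  obtain ⟨v, rfl⟩ := hb
  rw [← Units.val_mul, Ring.inverse_unit, Ring.inverse_unit, Ring.inverse_unit, mul_inv_rev,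
    Units.val_mul]

/-- Both u and dx are multiplied by the Jacobian, which cancels in u⁻¹ dx. -/
theorem thetaModel_coord (hφ : φ ∈ Charts n M) (hψ : ψ ∈ Charts n M) {p : J1LM n M}
    (hp : p.base ∈ φ.source) (hp' : p.base ∈ ψ.source) (v : VJ n) :
    thetaModel (coord ψ p) (dcoord ψ p v) = thetaModel (coord φ p) (dcoord φ p v) := by
  have hA := isUnit_jac hφ hψ hp hp'
  have e : (coord ψ p).2.1 = jac φ ψ (φ p.base) * (coord φ p).2.1 := by
    rw [coord_change hφ hψ hp hp']; rfl
  rw [thetaModel_apply, thetaModel_apply, dcoord_fst hφ hψ hp hp', e,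
    inverse_mul_of_isUnit hA (isUnit_coord hφ hp)]
  have h := congrArg (fun T : L n => T (dcoord φ p v).1) (Ring.inverse_mul_cancel _ hA)
  exact congrArg (fun y => (Ring.inverse (coord φ p).2.1 : L n) y) h

/-- The Hessian terms of du and of ρ dx are equal. The difference du − ρ dx is therefore multiplied
by the Jacobian, which u⁻¹ cancels. -/
theorem omegaModel_coord (hφ : φ ∈ Charts n M) (hψ : ψ ∈ Charts n M) {p : J1LM n M}
    (hp : p.base ∈ φ.source) (hp' : p.base ∈ ψ.source) (v : VJ n) :
    omegaModel (coord ψ p) (dcoord ψ p v) = omegaModel (coord φ p) (dcoord φ p v) := by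
  have hA := isUnit_jac hφ hψ hp hp'
  have e1 : (coord φ p).1 = φ p.base := rfl
  have e2 : tr φ ψ (φ p.base) = ψ p.base := by simp [tr, φ.left_inv hp]
  have e := coord_change hφ hψ hp hp'
  rw [e1, e2] at e
  have h := congrArg (fun T : L n => T (dcoord φ p v).1) (jac_mul_jac hφ hψ hp hp')
  have h' : (jac ψ φ (ψ p.base)) (jac φ ψ (φ p.base) (dcoord φ p v).1) = (dcoord φ p v).1 := h
  rw [omegaModel_apply, omegaModel_apply, dcoord_fst hφ hψ hp hp', dcoord_snd hφ hψ hp hp', e]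
  simp only [jetChange_apply]
  rw [inverse_mul_of_isUnit hA (isUnit_coord hφ hp), h']
  have h2 : ∀ a b c d : L n, a + b * c - (b * d + a) = b * (c - d) := fun a b c d => by
    rw [mul_sub]; abel
  rw [h2, mul_assoc, ← mul_assoc (Ring.inverse (jac φ ψ (φ p.base))), Ring.inverse_mul_cancel _ hA,
    one_mul]

/-- The form is defined through preferred charts, which change from point to point. This lets a
single chart be used near a given point, as differentiation requires. -/
theorem theta_val (hφ : φ ∈ Charts n M) {p : J1LM n M} (hp : p.base ∈ φ.source) (i : Fin n) :
    (theta i : FormJ n M 1).val p = ContinuousAlternatingMap.ofSubsingleton ℝ (VJ n) ℝ (0 : Fin 1)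
      (((EuclideanSpace.proj i).comp (thetaModel (coord φ p))).comp (dcoord φ p)) := by
  refine ContinuousAlternatingMap.ext fun v => ?_
  have := thetaModel_coord (IsManifold.chart_mem_maximalAtlas p.base) hφ
    (mem_chart_source (E n) p.base) hp (v 0)
  exact congrArg (fun y : E n => y i) this.symm

theorem omega_val (hφ : φ ∈ Charts n M) {p : J1LM n M} (hp : p.base ∈ φ.source) (i j : Fin n) :
    (omega i j : FormJ n M 1).val p = ContinuousAlternatingMap.ofSubsingleton ℝ (VJ n) ℝ (0 : Fin 1)
      (((entry i j).comp (omegaModel (coord φ p))).comp (dcoord φ p)) := by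
  refine ContinuousAlternatingMap.ext fun v => ?_
  have := omegaModel_coord (IsManifold.chart_mem_maximalAtlas p.base) hφ
    (mem_chart_source (E n) p.base) hp (v 0)
  exact congrArg (entry i j) this.symm

theorem smoothAt_theta (i : Fin n) (p : J1LM n M) : (theta i : FormJ n M 1).SmoothAt p := by
  have hc := IsManifold.chart_mem_maximalAtlas (I := 𝓡 n) (n := ∞) p.base
  have hp := mem_chart_source (E n) p.base
  refine DForm.smoothAt_of_oneForm (c := chartH _ hc) (chartH_mem_atlas hc) hp
    (a := fun z => (EuclideanSpace.proj i).comp (thetaModel z)) ?_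
    (contDiffAt_const.clm_comp (contDiffAt_thetaModel (isUnit_coord hc hp)))
  filter_upwards [eventually_base hc hp] with q hq using theta_val hc hq i

theorem smoothAt_omega (i j : Fin n) (p : J1LM n M) : (omega i j : FormJ n M 1).SmoothAt p := by
  have hc := IsManifold.chart_mem_maximalAtlas (I := 𝓡 n) (n := ∞) p.base
  have hp := mem_chart_source (E n) p.base
  refine DForm.smoothAt_of_oneForm (c := chartH _ hc) (chartH_mem_atlas hc) hp
    (a := fun z => (entry i j).comp (omegaModel z)) ?_
    (contDiffAt_const.clm_comp (contDiffAt_omegaModel (isUnit_coord hc hp)))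
  filter_upwards [eventually_base hc hp] with q hq using omega_val hc hq i j

/-- The formula comes from d(u⁻¹) = −u⁻¹ du u⁻¹. The point and the two vectors enter as variables
with equations, so that they are plain elements of the model space in later rewriting. -/
theorem ext_theta (hφ : φ ∈ Charts n M) {p : J1LM n M} (hp : p.base ∈ φ.source) (i : Fin n)
    {z V W : VJ n} (hz : z = coord φ p) {v w : VJ n} (hV : V = dcoord φ p v)
    (hW : W = dcoord φ p w) : (theta i : FormJ n M 1).ext.val p ![v, w] =
      (-(Ring.inverse z.2.1 * V.2.1 * Ring.inverse z.2.1) W.1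
        + (Ring.inverse z.2.1 * W.2.1 * Ring.inverse z.2.1) V.1) i := by
  subst hz hV hW
  have h := DForm.ext_of_oneForm (c := chartH φ hφ) (chartH_mem_atlas hφ) hp
    (α := (theta i : FormJ n M 1))
    (a := fun z => (EuclideanSpace.proj i).comp (thetaModel z))
    (by filter_upwards [eventually_base hφ hp] with q hq using theta_val hφ hq i)
    (contDiffAt_const.clm_comp (contDiffAt_thetaModel (isUnit_coord hφ hp))) (dcoord φ p) rfl v w
  refine h.trans ?_
  rw [coe_chartH, fderiv_thetaModel (isUnit_coord hφ hp), fderiv_thetaModel (isUnit_coord hφ hp)]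
  simp

theorem ext_omega (hφ : φ ∈ Charts n M) {p : J1LM n M} (hp : p.base ∈ φ.source) (i j : Fin n)
    {z V W : VJ n} (hz : z = coord φ p) {v w : VJ n} (hV : V = dcoord φ p v)
    (hW : W = dcoord φ p w) : (omega i j : FormJ n M 1).ext.val p ![v, w] =
      entry i j ((-(Ring.inverse z.2.1 * V.2.1 * Ring.inverse z.2.1) * (W.2.1 - z.2.2 W.1)
        + Ring.inverse z.2.1 * (0 - V.2.2 W.1)) -
        (-(Ring.inverse z.2.1 * W.2.1 * Ring.inverse z.2.1) * (V.2.1 - z.2.2 V.1)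
        + Ring.inverse z.2.1 * (0 - W.2.2 V.1))) := by
  subst hz hV hW
  have h := DForm.ext_of_oneForm (c := chartH φ hφ) (chartH_mem_atlas hφ) hp
    (α := (omega i j : FormJ n M 1))
    (a := fun z => (entry i j).comp (omegaModel z))
    (by filter_upwards [eventually_base hφ hp] with q hq using omega_val hφ hq i j)
    (contDiffAt_const.clm_comp (contDiffAt_omegaModel (isUnit_coord hφ hp))) (dcoord φ p) rfl v w
  refine h.trans ?_
  rw [coe_chartH, fderiv_omegaModel (isUnit_coord hφ hp), fderiv_omegaModel (isUnit_coord hφ hp)]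
  exact (map_sub (entry i j) _ _).symm

theorem omega_wedge_theta (hφ : φ ∈ Charts n M) {p : J1LM n M} (hp : p.base ∈ φ.source) (i k : Fin n)
    {z V W : VJ n} (hz : z = coord φ p) {v w : VJ n} (hV : V = dcoord φ p v)
    (hW : W = dcoord φ p w) : ((omega i k : FormJ n M 1).wedge (theta k)).val p ![v, w] =
      entry i k (omegaModel z V) * thetaModel z W k - entry i k (omegaModel z W) * thetaModel z V k := by
  subst hz hV hW
  have h : ((omega i k : FormJ n M 1).wedge (theta k)).val p =
    altWedge ((omega i k : FormJ n M 1).val p) ((theta k : FormJ n M 1).val p) := rfl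
  rw [h, omega_val hφ hp, theta_val hφ hp, altWedge_one_one]
  rfl

theorem omega_wedge_omega (hφ : φ ∈ Charts n M) {p : J1LM n M} (hp : p.base ∈ φ.source)
    (i k j : Fin n)
    {z V W : VJ n} (hz : z = coord φ p) {v w : VJ n} (hV : V = dcoord φ p v)
    (hW : W = dcoord φ p w) : ((omega i k : FormJ n M 1).wedge (omega k j)).val p ![v, w] =
      entry i k (omegaModel z V) * entry k j (omegaModel z W)
        - entry i k (omegaModel z W) * entry k j (omegaModel z V) := by
  subst hz hV hW
  have h : ((omega i k : FormJ n M 1).wedge (omega k j)).val p =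
    altWedge ((omega i k : FormJ n M 1).val p) ((omega k j : FormJ n M 1).val p) := rfl
  rw [h, omega_val hφ hp, omega_val hφ hp, altWedge_one_one]
  rfl

/-- The torsion in jet coordinates. -/
theorem torsion_apply (hφ : φ ∈ Charts n M) {p : J1LM n M} (hp : p.base ∈ φ.source) (i : Fin n)
    {z V W : VJ n} (hz : z = coord φ p) {v w : VJ n} (hV : V = dcoord φ p v)
    (hW : W = dcoord φ p w) : (torsion i : FormJ n M 2).val p ![v, w] =
      (Ring.inverse z.2.1 (z.2.2 W.1 (Ring.inverse z.2.1 V.1) -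
        z.2.2 V.1 (Ring.inverse z.2.1 W.1))) i := by
  have h : (torsion i : FormJ n M 2).val p ![v, w] = (theta i : FormJ n M 1).ext.val p ![v, w] +
      ∑ k, ((omega i k : FormJ n M 1).wedge (theta k)).val p ![v, w] := by
    have h1 : (torsion i : FormJ n M 2).val p = (theta i : FormJ n M 1).ext.val p +
      (∑ k, (omega i k : FormJ n M 1).wedge (theta k)).val p := rfl
    rw [h1, DForm.val_sum, ContinuousAlternatingMap.add_apply, ContinuousAlternatingMap.sum_apply]
  rw [h, ext_theta hφ hp i hz hV hW]
  simp only [omega_wedge_theta hφ hp i _ hz hV hW, Finset.sum_sub_distrib, ← apply_eq_sum]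
  -- The terms with du from dθ and from ω ∧ θ cancel, and only the ones with dx survive.
  rw [omegaModel_apply, omegaModel_apply, thetaModel_apply, thetaModel_apply]
  simp only [mul_sub, sub_apply, mul_apply_eq_comp, map_sub, PiLp.sub_apply, PiLp.add_apply,
    PiLp.neg_apply]
  ring

/-- The curvature in jet coordinates. -/
theorem curvature_apply (hφ : φ ∈ Charts n M) {p : J1LM n M} (hp : p.base ∈ φ.source)
    (i j : Fin n)
    {z V W : VJ n} (hz : z = coord φ p) {v w : VJ n} (hV : V = dcoord φ p v)
    (hW : W = dcoord φ p w) {I : L n} (hI : I = Ring.inverse z.2.1) :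
    (curvature i j : FormJ n M 2).val p ![v, w] =
      entry i j ((-(I * V.2.2 W.1) + I * z.2.2 W.1 * I * V.2.1 + I * z.2.2 V.1 * I * z.2.2 W.1)
        - (-(I * W.2.2 V.1) + I * z.2.2 V.1 * I * W.2.1 + I * z.2.2 W.1 * I * z.2.2 V.1)) := by
  have h : (curvature i j : FormJ n M 2).val p ![v, w] = (omega i j : FormJ n M 1).ext.val p ![v, w] +
      ∑ k, ((omega i k : FormJ n M 1).wedge (omega k j)).val p ![v, w] := by
    have h1 : (curvature i j : FormJ n M 2).val p = (omega i j : FormJ n M 1).ext.val p +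
      (∑ k, (omega i k : FormJ n M 1).wedge (omega k j)).val p := rfl
    rw [h1, DForm.val_sum, ContinuousAlternatingMap.add_apply, ContinuousAlternatingMap.sum_apply]
  rw [h, ext_omega hφ hp i j hz hV hW]
  simp only [omega_wedge_omega hφ hp i _ j hz hV hW, Finset.sum_sub_distrib, ← entry_mul]
  rw [← map_sub, ← map_add, omegaModel_apply, omegaModel_apply, ← hI]
  congr 1
  -- The terms quadratic in du cancel between dω and ω ∧ ω, as do half of the mixed terms.
  noncomm_ring

theorem metricity_apply (hφ : φ ∈ Charts n M) {p : J1LM n M} (hp : p.base ∈ φ.source) (i j : Fin n)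
    (v : Fin 1 → VJ n) : (metricity i j : FormJ n M 1).val p v =
      entry i j (omegaModel (coord φ p) (dcoord φ p (v 0)) * eta n +
        eta n * star (omegaModel (coord φ p) (dcoord φ p (v 0)))) := by
  have h : (metricity i j : FormJ n M 1).val p = ∑ k, (etaMatrix n i k • (omega j k : FormJ n M 1).val p
      + etaMatrix n j k • (omega i k : FormJ n M 1).val p) := DForm.val_sum _ _ _
  have hs : ∀ k, etaMatrix n j k = etaMatrix n k j := fun k =>
    congrFun (congrFun (Matrix.diagonal_transpose _).symm j) k
  rw [h, map_add, entry_mul, entry_mul]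
  simp only [entry_star, entry_eta, omega_val hφ hp, ContinuousAlternatingMap.sum_apply,
    Finset.sum_add_distrib, ContinuousAlternatingMap.add_apply]
  rw [add_comm]
  congr 1
  refine Finset.sum_congr rfl fun k _ => ?_
  rw [hs, mul_comm]; rfl

theorem smoothAt_torsion (i : Fin n) (p : J1LM n M) : (torsion i : FormJ n M 2).SmoothAt p :=
  (smoothAt_theta i p).ext.add
    (DForm.SmoothAt.sum fun k _ => (smoothAt_omega i k p).wedge (smoothAt_theta k p))

theorem smoothAt_curvature (i j : Fin n) (p : J1LM n M) :
    (curvature i j : FormJ n M 2).SmoothAt p :=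
  (smoothAt_omega i j p).ext.add
    (DForm.SmoothAt.sum fun k _ => (smoothAt_omega i k p).wedge (smoothAt_omega k j p))

theorem smoothAt_metricity (i j : Fin n) (p : J1LM n M) :
    (metricity i j : FormJ n M 1).SmoothAt p :=
  DForm.SmoothAt.sum fun k _ => ((smoothAt_omega j k p).smul _).add ((smoothAt_omega i k p).smul _)

end Forms

/-! ### Coordinate forms on the bundle of metrics and connections -/

namespace CSigma

variable {n : ℕ} {M : Type*} [TopologicalSpace M] [ChartedSpace (E n) M] [IsManifold (𝓡 n) ∞ M]
variable {φ : OpenPartialHomeomorph M (E n)}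

/-- The differential of the coordinates. -/
def dcoord (φ : OpenPartialHomeomorph M (E n)) (q : CSigma n M) : VQ n →L[ℝ] VQ n :=
  mfderiv 𝓘(ℝ, VQ n) 𝓘(ℝ, VQ n) (coord φ) q

/-- On the domain of φ the coordinates agree with a chart of the atlas, the one of the orientation
of q. -/
theorem dcoord_injective (hφ : φ ∈ Charts n M) {q : CSigma n M} (hq : q.base ∈ φ.source) :
    Function.Injective (dcoord φ q) := by
  have h : q ∈ (chartH φ hφ (orientIn φ q)).source := ⟨hq, rfl⟩
  have := mfderiv_symm_comp_mfderiv (chartH_mem_atlas hφ (orientIn φ q)) h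
  exact Function.LeftInverse.injective this

theorem mfderiv_clm_coord (hφ : φ ∈ Charts n M) {q : CSigma n M} (hq : q.base ∈ φ.source)
    (l : VQ n →L[ℝ] ℝ) (v : VQ n) :
    (mfderiv 𝓘(ℝ, VQ n) 𝓘(ℝ) (fun q => l (coord φ q)) q : VQ n →L[ℝ] ℝ) v = l (dcoord φ q v) := by
  have := mfderiv_comp q (I'' := 𝓘(ℝ)) (g := l) l.differentiableAt.mdifferentiableAt
    ((contMDiffAt_coord hφ hq).mdifferentiableAt (by simp))
  rw [mfderiv_eq_fderiv, ContinuousLinearMap.fderiv] at this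
  exact congrArg (fun A : VQ n →L[ℝ] ℝ => A v) this

theorem contMDiffAt_clm_coord (hφ : φ ∈ Charts n M) {q : CSigma n M} (hq : q.base ∈ φ.source)
    (l : VQ n →L[ℝ] ℝ) : ContMDiffAt 𝓘(ℝ, VQ n) 𝓘(ℝ) ∞ (fun q => l (coord φ q)) q :=
  l.contDiff.contMDiff.contMDiffAt.comp q (contMDiffAt_coord hφ hq)

theorem dFun_clm_coord (hφ : φ ∈ Charts n M) {q : CSigma n M} (hq : q.base ∈ φ.source)
    (l : VQ n →L[ℝ] ℝ) : (DForm.dFun (V := VQ n) fun q => l (coord φ q)).val q =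
      ContinuousAlternatingMap.ofSubsingleton ℝ (VQ n) ℝ (0 : Fin 1) (l.comp (dcoord φ q)) := by
  refine (DForm.dFun_eq ((contMDiffAt_clm_coord hφ hq l).mdifferentiableAt (by simp))).trans ?_
  congr 1
  exact ContinuousLinearMap.ext fun v => mfderiv_clm_coord hφ hq l v

/-- The coordinate `x^γ` of the model. -/
def xL (γ : Fin n) : VQ n →L[ℝ] ℝ :=
  (EuclideanSpace.proj γ).comp (ContinuousLinearMap.fst ℝ (E n) (SymOp n × (E n →L[ℝ] L n)))

/-- The coordinate `g^{μν}` of the model. -/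
def gL (μ ν : Fin n) : VQ n →L[ℝ] ℝ :=
  (entry μ ν).comp (SymOp.op.comp ((ContinuousLinearMap.fst ℝ (SymOp n) (E n →L[ℝ] L n)).comp
    (ContinuousLinearMap.snd ℝ (E n) (SymOp n × (E n →L[ℝ] L n)))))

/-- The coordinate `Γ^σ_{ργ}` of the model. -/
def ΓL (σ ρ γ : Fin n) : VQ n →L[ℝ] ℝ :=
  (entry σ γ).comp ((ContinuousLinearMap.apply ℝ (L n) (EuclideanSpace.single ρ (1 : ℝ))).comp
    ((ContinuousLinearMap.snd ℝ (SymOp n) (E n →L[ℝ] L n)).comp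
      (ContinuousLinearMap.snd ℝ (E n) (SymOp n × (E n →L[ℝ] L n)))))

theorem contMDiffAt_x (hφ : φ ∈ Charts n M) {q : CSigma n M} (hq : q.base ∈ φ.source) (γ : Fin n) :
    ContMDiffAt 𝓘(ℝ, VQ n) 𝓘(ℝ) ∞ (x φ γ) q := contMDiffAt_clm_coord hφ hq (xL γ)

theorem contMDiffAt_g (hφ : φ ∈ Charts n M) {q : CSigma n M} (hq : q.base ∈ φ.source)
    (μ ν : Fin n) : ContMDiffAt 𝓘(ℝ, VQ n) 𝓘(ℝ) ∞ (g φ μ ν) q :=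
  contMDiffAt_clm_coord hφ hq (gL μ ν)

theorem contMDiffAt_Γ (hφ : φ ∈ Charts n M) {q : CSigma n M} (hq : q.base ∈ φ.source)
    (σ ρ γ : Fin n) : ContMDiffAt 𝓘(ℝ, VQ n) 𝓘(ℝ) ∞ (Γ φ σ ρ γ) q :=
  contMDiffAt_clm_coord hφ hq (ΓL σ ρ γ)

theorem dx_val (hφ : φ ∈ Charts n M) {q : CSigma n M} (hq : q.base ∈ φ.source) (γ : Fin n) :
    (dx φ γ : FormQ n M 1).val q =
      ContinuousAlternatingMap.ofSubsingleton ℝ (VQ n) ℝ (0 : Fin 1) ((xL γ).comp (dcoord φ q)) :=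
  dFun_clm_coord hφ hq (xL γ)

theorem dg_val (hφ : φ ∈ Charts n M) {q : CSigma n M} (hq : q.base ∈ φ.source) (μ ν : Fin n) :
    (DForm.dFun (g φ μ ν) : FormQ n M 1).val q =
      ContinuousAlternatingMap.ofSubsingleton ℝ (VQ n) ℝ (0 : Fin 1) ((gL μ ν).comp (dcoord φ q)) :=
  dFun_clm_coord hφ hq (gL μ ν)

theorem dΓ_val (hφ : φ ∈ Charts n M) {q : CSigma n M} (hq : q.base ∈ φ.source) (σ ρ γ : Fin n) :
    (DForm.dFun (Γ φ σ ρ γ) : FormQ n M 1).val q =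
      ContinuousAlternatingMap.ofSubsingleton ℝ (VQ n) ℝ (0 : Fin 1)
        ((ΓL σ ρ γ).comp (dcoord φ q)) :=
  dFun_clm_coord hφ hq (ΓL σ ρ γ)

theorem smoothAt_dx (hφ : φ ∈ Charts n M) {q : CSigma n M} (hq : q.base ∈ φ.source) (γ : Fin n) :
    (dx φ γ : FormQ n M 1).SmoothAt q := DForm.smoothAt_dFun (contMDiffAt_x hφ hq γ)

theorem smoothAt_metricityForm (hφ : φ ∈ Charts n M) {q : CSigma n M} (hq : q.base ∈ φ.source)
    (μ ν : Fin n) : (metricityForm φ μ ν : FormQ n M 1).SmoothAt q :=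
  (DForm.smoothAt_dFun (contMDiffAt_g hφ hq μ ν)).add (.sum fun γ _ => .sum fun _ _ =>
    (smoothAt_dx hφ hq γ).fmul (((contMDiffAt_g hφ hq _ _).mul (contMDiffAt_Γ hφ hq _ _ _)).add
      ((contMDiffAt_g hφ hq _ _).mul (contMDiffAt_Γ hφ hq _ _ _))))

theorem smoothAt_torsionForm (hφ : φ ∈ Charts n M) {q : CSigma n M} (hq : q.base ∈ φ.source)
    (σ : Fin n) : (torsionForm φ σ : FormQ n M 2).SmoothAt q :=
  .sum fun μ _ => .sum fun ν _ => ((smoothAt_dx hφ hq μ).wedge (smoothAt_dx hφ hq ν)).fmul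
    ((contMDiffAt_Γ hφ hq _ _ _).sub (contMDiffAt_Γ hφ hq _ _ _))

theorem smoothAt_LCGenerator (hφ : φ ∈ Charts n M) (b : ℕ) (β : FormQ n M b)
    (h : LCGenerator φ b β) : ∀ q ∈ {q : CSigma n M | q.base ∈ φ.source}, β.SmoothAt q := by
  intro q hq
  cases h with
  | metricity μ ν => exact smoothAt_metricityForm hφ hq μ ν
  | torsion σ => exact smoothAt_torsionForm hφ hq σ

/-- Finiteness is what `DiffIdeal.of_local` asks of the generators. -/
theorem finite_LCGenerator :
    {p : Σ b, DForm (VQ n) (CSigma n M) b | LCGenerator φ p.1 p.2}.Finite := by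
  refine ((Set.finite_range fun i : Fin n × Fin n =>
    (⟨1, metricityForm φ i.1 i.2⟩ : Σ b, DForm (VQ n) (CSigma n M) b)).union
    (Set.finite_range fun i : Fin n =>
    (⟨2, torsionForm φ i⟩ : Σ b, DForm (VQ n) (CSigma n M) b))).subset ?_
  rintro ⟨b, β⟩ h
  cases h with
  | metricity μ ν => exact Or.inl ⟨(μ, ν), rfl⟩
  | torsion σ => exact Or.inr ⟨σ, rfl⟩

theorem clm_apply_eq_sum (A : E n →L[ℝ] L n) (y : E n) (i j : Fin n) :
    entry i j (A y) = ∑ ρ, y ρ * entry i j (A (EuclideanSpace.single ρ (1 : ℝ))) := by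
  conv_lhs => rw [sum_single y]
  simp

/-- The index expression is dg + Γg + gΓᵀ, the shape that `metricity_model` uses. The symmetry of g
puts the indices in the order of a matrix product. -/
theorem metricityForm_apply (hφ : φ ∈ Charts n M) {q : CSigma n M} (hq : q.base ∈ φ.source)
    (μ ν : Fin n) {z V : VQ n} (hz : z = coord φ q) {v : Fin 1 → VQ n} (hV : V = dcoord φ q (v 0)) :
    (metricityForm φ μ ν : FormQ n M 1).val q v =
      entry μ ν (V.2.1.op + z.2.2 V.1 * z.2.1.op + z.2.1.op * star (z.2.2 V.1)) := by
  have h : (metricityForm φ μ ν : FormQ n M 1).val q = (DForm.dFun (g φ μ ν) : FormQ n M 1).val q +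
      ∑ γ, ∑ σ, (g φ μ σ q * Γ φ ν γ σ q + g φ ν σ q * Γ φ μ γ σ q) • (dx φ γ : FormQ n M 1).val q := by
    have h1 : (metricityForm φ μ ν : FormQ n M 1).val q =
      (DForm.dFun (g φ μ ν) : FormQ n M 1).val q + (∑ γ, ∑ σ, DForm.fmul
      (fun q => g φ μ σ q * Γ φ ν γ σ q + g φ ν σ q * Γ φ μ γ σ q) (dx φ γ) : FormQ n M 1).val q := rfl
    rw [h1, DForm.val_sum]
    simp only [DForm.val_sum]
    rfl
  have hs : ∀ i j, entry i j z.2.1.op = entry j i z.2.1.op := fun i j => by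
    conv_lhs => rw [← z.2.1.star_op, entry_star]
  have e1 : ∀ i j, g φ i j q = entry i j z.2.1.op := fun i j => by rw [hz]; rfl
  have e2 : ∀ i j k, Γ φ i j k q = entry i k (z.2.2 (EuclideanSpace.single j (1 : ℝ))) :=
    fun i j k => by rw [hz]; rfl
  have e3 : ∀ γ, (dx φ γ : FormQ n M 1).val q v = V.1 γ := fun γ => by
    rw [dx_val hφ hq, hV]; rfl
  have e4 : (DForm.dFun (g φ μ ν) : FormQ n M 1).val q v = entry μ ν V.2.1.op := by
    rw [dg_val hφ hq, hV]; rfl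
  rw [h, ContinuousAlternatingMap.add_apply, ContinuousAlternatingMap.sum_apply, e4, map_add,
    map_add, add_assoc]
  congr 1
  simp only [ContinuousAlternatingMap.sum_apply, ContinuousAlternatingMap.smul_apply, e1, e2, e3,
    entry_mul, entry_star, clm_apply_eq_sum z.2.2 V.1, smul_eq_mul, Finset.sum_mul, Finset.mul_sum]
  rw [Finset.sum_comm, ← Finset.sum_add_distrib]
  refine Finset.sum_congr rfl fun σ _ => ?_
  rw [← Finset.sum_add_distrib]
  refine Finset.sum_congr rfl fun γ _ => ?_
  rw [hs σ ν]
  ring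

theorem dx_wedge_dx (hφ : φ ∈ Charts n M) {q : CSigma n M} (hq : q.base ∈ φ.source)
    (μ ν : Fin n) {V W v w : VQ n} (hV : V = dcoord φ q v) (hW : W = dcoord φ q w) :
    ((dx φ μ : FormQ n M 1).wedge (dx φ ν)).val q ![v, w] = V.1 μ * W.1 ν - W.1 μ * V.1 ν := by
  have h : ((dx φ μ : FormQ n M 1).wedge (dx φ ν)).val q =
    altWedge ((dx φ μ : FormQ n M 1).val q) ((dx φ ν : FormQ n M 1).val q) := rfl
  subst hV hW
  rw [h, dx_val hφ hq, dx_val hφ hq, altWedge_one_one]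
  rfl

theorem apply_apply_eq_sum (A : E n →L[ℝ] L n) (y y' : E n) (i : Fin n) :
    A y y' i = ∑ ρ, ∑ j, y ρ * y' j * entry i j (A (EuclideanSpace.single ρ (1 : ℝ))) := by
  rw [apply_eq_sum, Finset.sum_comm]
  refine Finset.sum_congr rfl fun j _ => ?_
  rw [clm_apply_eq_sum, Finset.sum_mul]
  refine Finset.sum_congr rfl fun ρ _ => ?_
  ring

/-- The factor 2 appears because the double sum over μ and ν meets every antisymmetric pair twice.
-/
theorem torsionForm_apply (hφ : φ ∈ Charts n M) {q : CSigma n M} (hq : q.base ∈ φ.source)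
    (σ : Fin n) {z V W v w : VQ n} (hz : z = coord φ q) (hV : V = dcoord φ q v)
    (hW : W = dcoord φ q w) :
    (torsionForm φ σ : FormQ n M 2).val q ![v, w] =
      2 * (z.2.2 V.1 W.1 - z.2.2 W.1 V.1) σ := by
  have h : (torsionForm φ σ : FormQ n M 2).val q = ∑ μ, ∑ ν, (Γ φ σ μ ν q - Γ φ σ ν μ q) •
      ((dx φ μ : FormQ n M 1).wedge (dx φ ν)).val q := by
    refine (DForm.val_sum _ _ _).trans ?_
    simp only [DForm.val_sum]
    rfl
  have e2 : ∀ i j k, Γ φ i j k q = entry i k (z.2.2 (EuclideanSpace.single j (1 : ℝ))) :=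
    fun i j k => by rw [hz]; rfl
  rw [h, ContinuousAlternatingMap.sum_apply]
  simp only [ContinuousAlternatingMap.sum_apply, ContinuousAlternatingMap.smul_apply, e2,
    dx_wedge_dx hφ hq _ _ hV hW, smul_eq_mul, PiLp.sub_apply, apply_apply_eq_sum z.2.2]
  set c : Fin n → Fin n → ℝ := fun ρ j => entry σ j (z.2.2 (EuclideanSpace.single ρ (1 : ℝ)))
  have e : ∀ a b : Fin n → ℝ, ∑ μ, ∑ ν, c ν μ * (a μ * b ν) = ∑ μ, ∑ ν, c μ ν * (b μ * a ν) :=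
    fun a b => by
      rw [Finset.sum_comm]
      exact Finset.sum_congr rfl fun μ _ => Finset.sum_congr rfl fun ν _ => by ring
  have h1 := e V.1 W.1
  have h2 := e W.1 V.1
  have h3 : ∑ μ, ∑ ν, (c μ ν - c ν μ) * (V.1 μ * W.1 ν - W.1 μ * V.1 ν) =
      ∑ μ, ∑ ν, c μ ν * (V.1 μ * W.1 ν) - ∑ μ, ∑ ν, c μ ν * (W.1 μ * V.1 ν)
      - ∑ μ, ∑ ν, c ν μ * (V.1 μ * W.1 ν) + ∑ μ, ∑ ν, c ν μ * (W.1 μ * V.1 ν) := by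
    simp only [← Finset.sum_sub_distrib, ← Finset.sum_add_distrib]
    exact Finset.sum_congr rfl fun μ _ => Finset.sum_congr rfl fun ν _ => by ring
  refine h3.trans ?_
  rw [h1, h2]
  simp only [mul_comm (c _ _)]
  ring

/-- As a matrix this is the antisymmetrisation of dΓ(v)(w) + Γ(v)Γ(w), to be compared with Ω in
`curvature_model`. -/
theorem curvatureForm_apply (hφ : φ ∈ Charts n M) {q : CSigma n M} (hq : q.base ∈ φ.source)
    (γ κ : Fin n) {z V W v w : VQ n} (hz : z = coord φ q) (hV : V = dcoord φ q v)
    (hW : W = dcoord φ q w) :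
    (curvatureForm φ γ κ : FormQ n M 2).val q ![v, w] =
      entry γ κ ((V.2.2 W.1 + z.2.2 V.1 * z.2.2 W.1) - (W.2.2 V.1 + z.2.2 W.1 * z.2.2 V.1)) := by
  have h : (curvatureForm φ γ κ : FormQ n M 2).val q =
      ∑ ρ, altWedge ((DForm.dFun (Γ φ γ ρ κ) : FormQ n M 1).val q) ((dx φ ρ : FormQ n M 1).val q) +
      ∑ σ, ∑ β, ∑ δ, (Γ φ σ δ κ q * Γ φ γ β σ q) •
      ((dx φ β : FormQ n M 1).wedge (dx φ δ)).val q := by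
    have h1 : (curvatureForm φ γ κ : FormQ n M 2).val q =
      (∑ ρ, (DForm.dFun (Γ φ γ ρ κ)).wedge (dx φ ρ) : FormQ n M 2).val q
      + (∑ σ, ∑ β, ∑ δ, DForm.fmul (fun q => Γ φ σ δ κ q * Γ φ γ β σ q)
          ((dx φ β).wedge (dx φ δ)) : FormQ n M 2).val q := rfl
    rw [h1, DForm.val_sum, DForm.val_sum]
    simp only [DForm.val_sum]
    rfl
  have e2 : ∀ i j k, Γ φ i j k q = entry i k (z.2.2 (EuclideanSpace.single j (1 : ℝ))) :=
    fun i j k => by rw [hz]; rfl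
  have e3 : ∀ ρ, altWedge ((DForm.dFun (Γ φ γ ρ κ) : FormQ n M 1).val q)
      ((dx φ ρ : FormQ n M 1).val q) ![v, w] =
      entry γ κ (V.2.2 (EuclideanSpace.single ρ (1 : ℝ))) * W.1 ρ -
      entry γ κ (W.2.2 (EuclideanSpace.single ρ (1 : ℝ))) * V.1 ρ := fun ρ => by
    rw [dx_val hφ hq, dΓ_val hφ hq, altWedge_one_one, hV, hW]; rfl
  rw [h, ContinuousAlternatingMap.add_apply, ContinuousAlternatingMap.sum_apply,
    ContinuousAlternatingMap.sum_apply]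
  simp only [ContinuousAlternatingMap.sum_apply, ContinuousAlternatingMap.smul_apply, e2, e3,
    dx_wedge_dx hφ hq _ _ hV hW, smul_eq_mul, map_sub, map_add, entry_mul]
  have f : ∀ (A : E n →L[ℝ] L n) (y : E n), entry γ κ (A y) =
      ∑ ρ, entry γ κ (A (EuclideanSpace.single ρ (1 : ℝ))) * y ρ := fun A y =>
    (clm_apply_eq_sum A y γ κ).trans (Finset.sum_congr rfl fun ρ _ => mul_comm _ _)
  rw [f V.2.2, f W.2.2, Finset.sum_sub_distrib]
  have e : ∀ y y' : E n, ∑ σ, entry γ σ (z.2.2 y) * entry σ κ (z.2.2 y') = ∑ σ, ∑ β, ∑ δ,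
      entry σ κ (z.2.2 (EuclideanSpace.single δ (1 : ℝ))) *
      entry γ σ (z.2.2 (EuclideanSpace.single β (1 : ℝ))) * (y β * y' δ) := fun y y' => by
    refine Finset.sum_congr rfl fun σ _ => ?_
    rw [clm_apply_eq_sum z.2.2 y, clm_apply_eq_sum z.2.2 y', Finset.sum_mul_sum]
    exact Finset.sum_congr rfl fun μ _ => Finset.sum_congr rfl fun ν _ => by ring
  rw [e, e]
  simp only [mul_sub, Finset.sum_sub_distrib]
  ring

end CSigma

/-- The generators of `I_PG` are smooth. -/
theorem smoothAt_PGGenerator {n : ℕ} {M : Type*} [TopologicalSpace M] [ChartedSpace (E n) M]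
    [IsManifold (𝓡 n) ∞ M] (b : ℕ) (β : FormJ n M b) (h : PGGenerator b β) (p : J1LM n M) :
    β.SmoothAt p := by
  cases h with
  | metricity i j => exact smoothAt_metricity i j p
  | torsion i => exact smoothAt_torsion i p

theorem finite_PGGenerator {n : ℕ} {M : Type*} [TopologicalSpace M] [ChartedSpace (E n) M]
    [IsManifold (𝓡 n) ∞ M] :
    {p : Σ b, DForm (VJ n) (J1LM n M) b | PGGenerator p.1 p.2}.Finite := by
  refine ((Set.finite_range fun i : Fin n × Fin n =>
    (⟨1, metricity i.1 i.2⟩ : Σ b, DForm (VJ n) (J1LM n M) b)).union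
    (Set.finite_range fun i : Fin n =>
    (⟨2, torsion i⟩ : Σ b, DForm (VJ n) (J1LM n M) b))).subset ?_
  rintro ⟨b, β⟩ h
  cases h with
  | metricity μ ν => exact Or.inl ⟨(μ, ν), rfl⟩
  | torsion σ => exact Or.inr ⟨σ, rfl⟩

/-! ### The projection onto the bundle of metrics and connections -/

section Algebra

variable {n : ℕ}

/-- The bilinear map `(B, ρ) ↦ (v ↦ ρ v * B)`. -/
def rightMul (n : ℕ) : L n →L[ℝ] (E n →L[ℝ] L n) →L[ℝ] (E n →L[ℝ] L n) :=
  (ContinuousLinearMap.compL ℝ (E n) (L n) (L n)).comp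
    (ContinuousLinearMap.compL ℝ (E n) (E n) (E n)).flip

/-- The projection `p_H` in coordinates. -/
def projModel (z : VJ n) : VQ n :=
  (z.1, symL n (metricOf z.2.1), -rightMul n (Ring.inverse z.2.1) z.2.2)

/-- The differential of `p_H` in coordinates. -/
def dprojModel (z v : VJ n) : VQ n :=
  (v.1, symL n (v.2.1 * eta n * star z.2.1 + z.2.1 * eta n * star v.2.1),
    -(rightMul n (-(Ring.inverse z.2.1 * v.2.1 * Ring.inverse z.2.1)) z.2.2 +
      rightMul n (Ring.inverse z.2.1) v.2.2))

theorem contDiffAt_projModel {z : VJ n} (hz : IsUnit z.2.1) :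
    ContDiffAt ℝ ∞ (projModel : VJ n → VQ n) z := by
  refine contDiffAt_fst.prodMk (ContDiffAt.prodMk ?_ (ContDiffAt.neg ?_))
  · exact ((symL n).contDiff.comp contDiff_metricOf).contDiffAt.comp z
      (contDiff_fst.comp contDiff_snd).contDiffAt
  · exact ((rightMul n).contDiff.contDiffAt.comp z (contDiffAt_inverse_frame hz)).clm_apply
      (contDiff_snd.comp contDiff_snd).contDiffAt

theorem hasDirDeriv_projModel {z : VJ n} (hz : IsUnit z.2.1) :
    HasDirDeriv (projModel : VJ n → VQ n) z (dprojModel z) := by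
  refine (hasDirDeriv_fst z).prodMk (HasDirDeriv.prodMk (HasDirDeriv.clm (symL n) ?_)
    (HasDirDeriv.neg ?_))
  · have h := ((hasDirDeriv_frame z).mul (HasDirDeriv.const (eta n) z)).mul
      (HasDirDeriv.clm (starL n) (hasDirDeriv_frame z))
    refine HasDirDeriv.congr_deriv h fun v => ?_
    simp [starL_apply]
  · exact (HasDirDeriv.clm (rightMul n) ((hasDirDeriv_frame z).inverse hz)).clm_apply
      (hasDirDeriv_jet z)

theorem star_dmetric (u v : L n) : star (v * eta n * star u + u * eta n * star v) =
    v * eta n * star u + u * eta n * star v := by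
  simp only [star_add, star_mul, star_star, star_eta, mul_assoc]
  rw [add_comm]

theorem star_inverse_mul_star {u : L n} (hu : IsUnit u) : star (Ring.inverse u) * star u = 1 := by
  rw [← star_mul, Ring.mul_inverse_cancel _ hu, star_one]

theorem star_mul_star_inverse {u : L n} (hu : IsUnit u) : star u * star (Ring.inverse u) = 1 := by
  rw [← star_mul, Ring.inverse_mul_cancel _ hu, star_one]

/-- The equations are solved in triangular order: dx is given, du is determined by dg up to a
choice, and then dρ by dΓ. -/
theorem dprojModel_surjective {z : VJ n} (hz : IsUnit z.2.1) (w : VQ n) :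
    ∃ v, dprojModel z v = w := by
  obtain ⟨w₁, s, w₃⟩ := w
  obtain ⟨x, u, ρ⟩ := z
  have hz' : IsUnit u := hz
  set t : L n := (2⁻¹ : ℝ) • s.op with ht
  have ht' : star t = t := by simp [ht, s.star_op]
  have htt : t + t = s.op := by rw [ht, ← two_smul ℝ, smul_smul]; norm_num
  -- This du satisfies du η uᵀ = t. As t is symmetric, the transposed term u η duᵀ is t as well, and
  -- the two halves add up to s.
  set a : L n := t * star (Ring.inverse u) * eta n with ha
  have e2 : u * eta n * star a = t := by
    simp only [ha, star_mul, star_star, star_eta, ht', mul_assoc]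
    rw [← mul_assoc (eta n) (eta n), eta_mul_eta, one_mul, ← mul_assoc,
      Ring.mul_inverse_cancel _ hz', one_mul]
  have e3 : a * eta n * star u = t := by
    rw [ha, mul_assoc (t * star (Ring.inverse u)), eta_mul_eta, mul_one, mul_assoc,
      star_inverse_mul_star hz', mul_one]
  -- In dΓ the unknown dρ occurs only as dρ u⁻¹, so one multiplies by u on the right.
  refine ⟨(w₁, a, rightMul n u (-w₃ -
    rightMul n (-(Ring.inverse u * a * Ring.inverse u)) ρ)), ?_⟩
  refine Prod.ext rfl (Prod.ext ?_ ?_)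
  · change symL n (a * eta n * star u + u * eta n * star a) = s
    rw [e2, e3, htt]
    exact symL_eq s.star_op
  · refine ContinuousLinearMap.ext fun v => ?_
    change -(ρ v * -(Ring.inverse u * a * Ring.inverse u) + (-(w₃ v) -
      ρ v * -(Ring.inverse u * a * Ring.inverse u)) * u * Ring.inverse u) = w₃ v
    rw [mul_assoc _ u, Ring.mul_inverse_cancel _ hz', mul_one]
    abel

end Algebra

namespace J1LM

variable {n : ℕ} {M : Type*} [TopologicalSpace M] [ChartedSpace (E n) M] [IsManifold (𝓡 n) ∞ M]
variable {φ : OpenPartialHomeomorph M (E n)}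

theorem dcoord_surjective (hφ : φ ∈ Charts n M) {p : J1LM n M} (hp : p.base ∈ φ.source) :
    Function.Surjective (dcoord φ p) := by
  have h : coord φ p ∈ (chartH φ hφ).target := (chartH φ hφ).map_source hp
  have := mfderiv_comp_mfderiv_symm (chartH_mem_atlas hφ) h
  intro v
  have e := this v
  have e' : (chartH φ hφ).symm (coord φ p) = p := (chartH φ hφ).left_inv hp
  rw [e'] at e
  exact ⟨_, e⟩

/-- In −ρu⁻¹ the Hessian term of the rule for jets loses its factor u and becomes the inhomogeneous
term of the rule for connections. So the formula for p_H, a definition in preferred charts, holds in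
every chart. -/
theorem coord_toCSigma (hφ : φ ∈ Charts n M) {p : J1LM n M} (hp : p.base ∈ φ.source) :
    CSigma.coord φ p.toCSigma = projModel (coord φ p) := by
  have hc := IsManifold.chart_mem_maximalAtlas (I := 𝓡 n) (n := ∞) p.base
  have hcp := mem_chart_source (E n) p.base
  have hA := isUnit_jac hc hφ hcp hp
  have hD := jac_mul_jac hc hφ hcp hp
  refine Prod.ext rfl (Prod.ext ?_ ?_)
  · have e : metricOf (coord φ p).2.1 = CSigma.metricIn φ p.toCSigma := by
      simp [metricOf, CSigma.metricIn, toCSigma, coord, mul_assoc]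
    change _ = symL n (metricOf (coord φ p).2.1)
    rw [symL_eq (star_metricOf _)]
    exact SymOp.ext e.symm
  · refine ContinuousLinearMap.ext fun v => ?_
    have hD' : Ring.inverse (jac (chartAt (E n) p.base) φ (chartAt (E n) p.base p.base)) =
        jac φ (chartAt (E n) p.base) (φ p.base) := by
      have := congrArg (· * Ring.inverse (jac (chartAt (E n) p.base) φ
        (chartAt (E n) p.base p.base))) hD
      simp only [one_mul, mul_assoc, Ring.mul_inverse_cancel _ hA, mul_one] at this
      exact this.symm
    change connChange _ _ _ p.toCSigma.conn v =
      -(jetChange _ _ _ p.frame p.jet v * Ring.inverse (_ * p.frame))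
    rw [connChange_apply, jetChange_apply, inverse_mul_of_isUnit hA p.isUnit_frame, hD', ← neg_mul,
      ← mul_assoc]
    congr 1
    have e : ∀ y, p.toCSigma.conn y = -(p.jet y * Ring.inverse p.frame) := fun y => rfl
    rw [e, neg_mul, add_mul, mul_assoc (hess _ _ _ _), Ring.mul_inverse_cancel _ p.isUnit_frame,
      mul_one]
    simp only [mul_neg, mul_assoc, toCSigma]
    abel

theorem orientIn_toCSigma (hφ : φ ∈ Charts n M) {p : J1LM n M} (hp : p.base ∈ φ.source) :
    CSigma.orientIn φ p.toCSigma = sgn (det (coord φ p).2.1) := by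
  have hc := IsManifold.chart_mem_maximalAtlas (I := 𝓡 n) (n := ∞) p.base
  have hcp := mem_chart_source (E n) p.base
  have hA := isUnit_jac hc hφ hcp hp
  have e : (coord φ p).2.1 = jac (chartAt (E n) p.base) φ (chartAt (E n) p.base p.base) * p.frame :=
    rfl
  rw [e, det_mul, sgn_mul (det_ne_zero hA) (det_ne_zero p.isUnit_frame)]
  rfl

theorem eventually_sgn {X : Type*} [TopologicalSpace X] {f : X → ℝ} {x : X} (hf : ContinuousAt f x)
    (hx : f x ≠ 0) : ∀ᶠ y in 𝓝 x, sgn (f y) = sgn (f x) := by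
  rcases lt_or_gt_of_ne hx with h | h
  · filter_upwards [hf.eventually_lt continuousAt_const h] with y hy
    simp [sgn, h.not_gt, hy.not_gt]
  · filter_upwards [continuousAt_const.eventually_lt hf h] with y hy
    simp [sgn, h, hy]

theorem contMDiff_toCSigma :
    ContMDiff 𝓘(ℝ, VJ n) 𝓘(ℝ, VQ n) ∞ (toCSigma : J1LM n M → CSigma n M) := by
  intro p
  have hc := IsManifold.chart_mem_maximalAtlas (I := 𝓡 n) (n := ∞) p.base
  have hp := mem_chart_source (E n) p.base
  set c := chartAt (E n) p.base
  set o := CSigma.orientIn c p.toCSigma with ho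
  have hu := isUnit_coord hc hp
  have h1 : ContMDiffAt 𝓘(ℝ, VJ n) 𝓘(ℝ, VQ n) ∞ (fun q => projModel (coord c q)) p :=
    (contDiffAt_projModel hu).contMDiffAt.comp p (contMDiffAt_coord hc hp)
  have ht : projModel (coord c p) ∈ (CSigma.chartH c hc o).target := by
    rw [← coord_toCSigma hc hp]
    exact (CSigma.chartH c hc o).map_source ⟨hp, rfl⟩
  have h2 := (contMDiffAt_atlas_symm (CSigma.chartH_mem_atlas hc o) ht).comp p h1
  refine h2.congr_of_eventuallyEq ?_
  have hd : ContinuousAt (fun q => det (coord c q).2.1) p :=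
    continuous_det.continuousAt.comp ((continuous_fst.comp continuous_snd).continuousAt.comp
      (contMDiffAt_coord hc hp).continuousAt)
  -- The orientation of the frame is locally constant, so nearby points are mapped into the same
  -- chart of the quotient. There the map is `projModel`.
  filter_upwards [eventually_base hc hp, eventually_sgn hd (det_ne_zero hu)] with q hq hq'
  rw [← orientIn_toCSigma hc hp, ← orientIn_toCSigma hc hq] at hq'
  change q.toCSigma = CSigma.ofCoord c o (projModel (coord c q))
  rw [← coord_toCSigma hc hq, ho, ← hq']
  exact (CSigma.ofCoord_coord hc hq).symm

/-- The differential of `p_H`, typed as a map of the model spaces. -/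
def dproj (p : J1LM n M) : VJ n →L[ℝ] VQ n :=
  mfderiv 𝓘(ℝ, VJ n) 𝓘(ℝ, VQ n) toCSigma p

theorem dcoord_dproj (hφ : φ ∈ Charts n M) {p : J1LM n M} (hp : p.base ∈ φ.source) (v : VJ n) :
    CSigma.dcoord φ p.toCSigma (dproj p v) = dprojModel (coord φ p) (dcoord φ p v) := by
  have h1 := mfderiv_of_coord (f := fun q : J1LM n M => CSigma.coord φ q.toCSigma) hφ hp
    (by filter_upwards [eventually_base hφ hp] with q hq using coord_toCSigma hφ hq)
    (hasDirDeriv_projModel (isUnit_coord hφ hp)) v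
  have hp' : p.toCSigma.base ∈ φ.source := hp
  have h2 := mfderiv_comp p ((CSigma.contMDiffAt_coord hφ hp').mdifferentiableAt (by simp))
    (contMDiff_toCSigma.contMDiffAt.mdifferentiableAt (by simp))
  refine Eq.trans ?_ h1
  exact (congrArg (fun A : VJ n →L[ℝ] VQ n => A v) h2).symm

theorem dproj_surjective (p : J1LM n M) : Function.Surjective (dproj p) := by
  have hc := IsManifold.chart_mem_maximalAtlas (I := 𝓡 n) (n := ∞) p.base
  have hp := mem_chart_source (E n) p.base
  have hp' : p.toCSigma.base ∈ (chartAt (E n) p.base).source := hp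
  intro w
  obtain ⟨v', hv'⟩ := dprojModel_surjective (isUnit_coord hc hp)
    (CSigma.dcoord (chartAt (E n) p.base) p.toCSigma w)
  obtain ⟨v, rfl⟩ := dcoord_surjective hc hp v'
  refine ⟨v, CSigma.dcoord_injective hc hp' ?_⟩
  rw [dcoord_dproj hc hp, hv']

end J1LM

/-! ### The action of the Lorentz group -/

/-- The matrix of an endomorphism. -/
def entries {n : ℕ} (A : L n) : Matrix (Fin n) (Fin n) ℝ := Matrix.of fun i j => entry i j A

theorem det_eq {n : ℕ} (A : L n) : det A = (entries A).det := by
  rw [det, ← LinearMap.det_toMatrix (EuclideanSpace.basisFun (Fin n) ℝ).toBasis]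
  congr 1

theorem det_eta {n : ℕ} [NeZero n] : det (eta n) = -1 := by
  have h : entries (eta n) = etaMatrix n := by
    ext i j
    exact entry_eta i j
  rw [det_eq, h, etaMatrix, Matrix.det_diagonal, Finset.prod_eq_single (0 : Fin n)]
  · simp
  · intro b _ hb
    rw [if_neg]
    exact fun h => hb (Fin.ext h)
  · simp

theorem det_star {n : ℕ} (A : L n) : det (star A) = det A := by
  have h : entries (star A) = (entries A).transpose := by
    ext i j
    exact entry_star i j A
  rw [det_eq, h, Matrix.det_transpose, det_eq]

theorem metricOf_mul {n : ℕ} (u A : L n) : metricOf (u * A) = u * metricOf A * star u := by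
  simp [metricOf, mul_assoc]

namespace J1LM

section Fibres

variable {n : ℕ} {M : Type*}

theorem toCSigma_conn (p : J1LM n M) (v : E n) :
    p.toCSigma.conn v = -(p.jet v * Ring.inverse p.frame) := rfl

theorem rmul_jet (p : J1LM n M) (A : (L n)ˣ) (v : E n) : (p.rmul A).jet v = p.jet v * A := rfl

theorem eq_one_of_rmul_eq {p : J1LM n M} {A : (L n)ˣ} (h : p.rmul A = p) : A = 1 := by
  have h1 : p.frame * A = p.frame := congrArg J1LM.frame h
  refine Units.ext ?_
  rw [Units.val_one]
  exact p.isUnit_frame.mul_left_cancel (by rw [h1, mul_one])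

theorem toCSigma_rmul (p : J1LM n M) {A : (L n)ˣ} (hA : A ∈ lorentzGroup n) :
    (p.rmul A).toCSigma = p.toCSigma := by
  obtain ⟨h1, h2⟩ := hA
  ext1
  · rfl
  · refine ContinuousLinearMap.ext fun v => ?_
    rw [toCSigma_conn, toCSigma_conn, rmul_jet]
    change -(p.jet v * (A : L n) * Ring.inverse (p.frame * (A : L n))) = _
    rw [inverse_mul_of_isUnit p.isUnit_frame A.isUnit, mul_assoc, ← mul_assoc (A : L n),
      Ring.mul_inverse_cancel _ A.isUnit, one_mul]
  · change metricOf (p.frame * (A : L n)) = metricOf p.frame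
    rw [metricOf_mul, h1]; rfl
  · change sgn (det (p.frame * (A : L n))) = sgn (det p.frame)
    rw [det_mul, h2, mul_one]

/-- The only candidate is A = u⁻¹u'. Equal metrics and orientations make it Lorentz with determinant
1, and equal connections make the jets correspond. -/
theorem toCSigma_eq_iff [NeZero n] (p p' : J1LM n M) :
    p.toCSigma = p'.toCSigma ↔ ∃ A ∈ lorentzGroup n, p' = p.rmul A := by
  constructor
  · intro h
    have hu := p.isUnit_frame
    have hu' := p'.isUnit_frame
    have hb : p.base = p'.base := congrArg CSigma.base h
    have hg : metricOf p.frame = metricOf p'.frame := congrArg CSigma.metric h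
    have ho : sgn (det p.frame) = sgn (det p'.frame) := congrArg CSigma.orient h
    have hΓ : ∀ v, p.jet v * Ring.inverse p.frame = p'.jet v * Ring.inverse p'.frame := fun v => by
      have := congrArg (fun q : CSigma n M => q.conn v) h
      simpa only [toCSigma_conn, neg_inj] using this
    obtain ⟨A, hA⟩ : IsUnit (Ring.inverse p.frame * p'.frame) := hu.ringInverse.mul hu'
    have hA' : p'.frame = p.frame * A := by
      rw [hA, ← mul_assoc, Ring.mul_inverse_cancel _ hu, one_mul]
    -- From u(AηAᵀ)uᵀ = uηuᵀ one cancels the invertible outer factors.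
    have hm : metricOf (A : L n) = eta n := by
      have h1 : p.frame * metricOf (A : L n) * star p.frame = p.frame * eta n * star p.frame := by
        rw [← metricOf_mul, ← hA', ← hg]; rfl
      have h2 := congrArg (· * star (Ring.inverse p.frame)) h1
      simp only [mul_assoc, star_mul_star_inverse hu, mul_one] at h2
      exact hu.mul_left_cancel h2
    -- Taking determinants in AηAᵀ = η gives (det A)² = 1, and the equality of the orientations
    -- makes det A positive.
    have hd : det (A : L n) = 1 := by
      have h1 : det (A : L n) * det (A : L n) = 1 := by
        have := congrArg det hm
        rw [metricOf, det_mul, det_mul, det_star, det_eta] at this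
        linarith
      rw [hA', det_mul, sgn_mul (det_ne_zero hu) (det_ne_zero A.isUnit)] at ho
      have h2 : sgn (det (A : L n)) = 1 := by
        have := mul_left_cancel (ho.symm.trans (mul_one _).symm)
        exact this
      have h3 : 0 < det (A : L n) := by
        by_contra hneg
        rw [sgn, if_neg hneg] at h2
        exact absurd h2 (by decide)
      nlinarith
    refine ⟨A, ⟨hm, hd⟩, ?_⟩
    ext1
    · exact hb.symm
    · exact hA'
    · refine ContinuousLinearMap.ext fun v => ?_
      rw [rmul_jet, hA, ← mul_assoc, hΓ, mul_assoc, Ring.inverse_mul_cancel _ hu', mul_one]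
  · rintro ⟨A, hA, rfl⟩
    exact (toCSigma_rmul p hA).symm

theorem toCSigma_surjective [NeZero n] :
    Function.Surjective (toCSigma : J1LM n M → CSigma n M) := by
  rintro ⟨x, Γ, g, o, u₀, hu₀, hg⟩
  -- A frame with the wrong orientation is replaced by uη. This keeps the metric because ηηη = η,
  -- and reverses the orientation because det η = −1.
  obtain ⟨u, hu, hm, hd⟩ : ∃ u : L n, IsUnit u ∧ metricOf u = g ∧ sgn (det u) = o := by
    by_cases h : sgn (det u₀) = o
    · exact ⟨u₀, hu₀, hg.symm, h⟩
    · have hη : IsUnit (eta n) := ⟨⟨eta n, eta n, eta_mul_eta, eta_mul_eta⟩, rfl⟩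
      refine ⟨u₀ * eta n, hu₀.mul hη, ?_, ?_⟩
      · rw [hg, metricOf_mul]
        congr 2
        rw [metricOf, star_eta, mul_assoc, eta_mul_eta, mul_one]
      · rw [det_mul, sgn_mul (det_ne_zero hu₀) (det_ne_zero hη), det_eta]
        have h1 : sgn (-1 : ℝ) = -1 := by simp [sgn]
        rw [h1]
        rcases Int.units_eq_one_or (sgn (det u₀)) with h2 | h2 <;>
          rcases Int.units_eq_one_or o with h3 | h3 <;> simp_all
  -- The jet ρ = −Γu solves −ρu⁻¹ = Γ.
  refine ⟨⟨x, u, -rightMul n u Γ, hu⟩, ?_⟩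
  ext1
  · rfl
  · refine ContinuousLinearMap.ext fun v => ?_
    rw [toCSigma_conn]
    change -(-(Γ v * u) * Ring.inverse u) = Γ v
    rw [neg_mul, neg_neg, mul_assoc, Ring.mul_inverse_cancel _ hu, mul_one]
  · exact hm
  · exact hd

end Fibres

variable {n : ℕ} {M : Type*} [TopologicalSpace M] [ChartedSpace (E n) M] [IsManifold (𝓡 n) ∞ M]
variable {φ : OpenPartialHomeomorph M (E n)}

/-- The action multiplies on the right, while the terms of the coordinate change act on the left or
carry u as last factor. So the action has the same form in every chart. -/
theorem coord_rmul (p : J1LM n M) (A : (L n)ˣ) : coord φ (p.rmul A) =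
    ((coord φ p).1, (coord φ p).2.1 * A, rightMul n A (coord φ p).2.2) := by
  refine Prod.ext rfl (Prod.ext ?_ ?_)
  · exact (mul_assoc _ _ _).symm
  · refine ContinuousLinearMap.ext fun v => ?_
    change jetChange _ _ _ (p.frame * (A : L n)) (p.rmul A).jet v =
      jetChange _ _ _ p.frame p.jet v * (A : L n)
    rw [jetChange_apply, jetChange_apply, rmul_jet, add_mul, mul_assoc, mul_assoc]
    rfl

theorem contMDiff_rmul (A : (L n)ˣ) :
    ContMDiff 𝓘(ℝ, VJ n) 𝓘(ℝ, VJ n) ∞ (fun p : J1LM n M => p.rmul A) := by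
  intro p
  have hc := IsManifold.chart_mem_maximalAtlas (I := 𝓡 n) (n := ∞) p.base
  have hp := mem_chart_source (E n) p.base
  set c := chartAt (E n) p.base
  have h0 : ContDiff ℝ ∞ (fun z : VJ n => ((z.1, z.2.1 * A, rightMul n A z.2.2) : VJ n)) := by
    refine contDiff_fst.prodMk (ContDiff.prodMk ?_ ?_)
    · exact (contDiff_fst.comp contDiff_snd).mul contDiff_const
    · exact (rightMul n A).contDiff.comp (contDiff_snd.comp contDiff_snd)
  have h1 : ContMDiffAt 𝓘(ℝ, VJ n) 𝓘(ℝ, VJ n) ∞ (fun q : J1LM n M => coord c (q.rmul A)) p := by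
    simp only [coord_rmul]
    exact h0.contMDiff.contMDiffAt.comp p (contMDiffAt_coord hc hp)
  have hp' : p.rmul A ∈ (chartH c hc).source := hp
  have h2 := (contMDiffAt_atlas_symm (chartH_mem_atlas hc)
    ((chartH c hc).map_source hp')).comp p h1
  refine h2.congr_of_eventuallyEq ?_
  filter_upwards [eventually_base hc hp] with q hq
  exact (ofCoord_coord hc (p := q.rmul A) hq).symm

theorem continuous_rmul :
    Continuous (fun z : lorentzGroup n × J1LM n M => z.2.rmul z.1) := by
  rw [continuous_iff_continuousAt]
  rintro ⟨A, p⟩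
  have hc := IsManifold.chart_mem_maximalAtlas (I := 𝓡 n) (n := ∞) p.base
  have hp := mem_chart_source (E n) p.base
  set c := chartAt (E n) p.base
  have hz : ContinuousAt (fun z : lorentzGroup n × J1LM n M => coord c z.2) (A, p) :=
    ContinuousAt.comp (f := Prod.snd) (x := (A, p)) (contMDiffAt_coord hc hp).continuousAt
      continuousAt_snd
  have hA : ContinuousAt (fun z : lorentzGroup n × J1LM n M => ((z.1 : (L n)ˣ) : L n)) (A, p) :=
    (Units.continuous_val.comp (continuous_subtype_val.comp continuous_fst)).continuousAt
  have h1 : ContinuousAt (fun z : lorentzGroup n × J1LM n M => coord c (z.2.rmul z.1)) (A, p) := by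
    simp only [coord_rmul]
    exact hz.fst.prodMk ((hz.snd.fst.mul hA).prodMk
      (((rightMul n).continuous.continuousAt.comp hA).clm_apply hz.snd.snd))
  have hp' : p.rmul A ∈ (chartH c hc).source := hp
  have h2 := ContinuousAt.comp (f := fun z : lorentzGroup n × J1LM n M => coord c (z.2.rmul z.1))
    (x := (A, p)) ((chartH c hc).continuousAt_symm ((chartH c hc).map_source hp')) h1
  refine h2.congr_of_eventuallyEq ?_
  filter_upwards [continuousAt_snd.eventually (eventually_base hc hp)] with q hq
  exact (ofCoord_coord hc (p := q.2.rmul q.1) hq).symm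

/-- By the ultrafilter criterion one has to show that A converges in H as soon as p and pA converge.
In a chart A = u⁻¹(uA), and the limits of u and uA are again invertible. -/
theorem isProperMap_rmul [T2Space M] :
    IsProperMap (fun z : lorentzGroup n × J1LM n M => (z.2.rmul z.1, z.2)) := by
  rw [isProperMap_iff_ultrafilter]
  have hcont : Continuous (fun z : lorentzGroup n × J1LM n M => (z.2.rmul z.1, z.2)) :=
    continuous_rmul.prodMk continuous_snd
  refine ⟨hcont, ?_⟩
  rintro 𝒰 ⟨p', p⟩ h
  have h' : Filter.Tendsto (fun z : lorentzGroup n × J1LM n M => z.2.rmul z.1) 𝒰 (𝓝 p') :=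
    (continuous_fst.tendsto _).comp h
  have h0 : Filter.Tendsto (fun z : lorentzGroup n × J1LM n M => z.2) 𝒰 (𝓝 p) :=
    (continuous_snd.tendsto _).comp h
  have b' := (contMDiff_base.continuous.tendsto p').comp h'
  have b₀ := (contMDiff_base.continuous.tendsto p).comp h0
  -- The action is vertical and M is Hausdorff, so both limits lie over the same point and one chart
  -- serves for both.
  have hb : p'.base = p.base := tendsto_nhds_unique
    (f := fun z : lorentzGroup n × J1LM n M => z.2.base) b' b₀
  have hc := IsManifold.chart_mem_maximalAtlas (I := 𝓡 n) (n := ∞) p.base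
  have hp := mem_chart_source (E n) p.base
  set c := chartAt (E n) p.base
  have hp' : p'.base ∈ c.source := hb ▸ hp
  have hu := isUnit_coord hc hp
  have hu' := isUnit_coord hc hp'
  have t1 : Filter.Tendsto (fun z : lorentzGroup n × J1LM n M => (coord c z.2).2.1) 𝒰
      (𝓝 (coord c p).2.1) :=
    ((contMDiffAt_coord hc hp).continuousAt.tendsto.comp h0).snd_nhds.fst_nhds
  have t2 : Filter.Tendsto (fun z : lorentzGroup n × J1LM n M => (coord c (z.2.rmul z.1)).2.1) 𝒰
      (𝓝 (coord c p').2.1) :=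
    ((contMDiffAt_coord hc hp').continuousAt.tendsto.comp h').snd_nhds.fst_nhds
  have hinv : ∀ {u : L n}, IsUnit u → Filter.Tendsto Ring.inverse (𝓝 u) (𝓝 (Ring.inverse u)) := by
    rintro _ ⟨u, rfl⟩
    exact NormedRing.inverse_continuousAt u
  have ev : ∀ᶠ z : lorentzGroup n × J1LM n M in (𝒰 : Filter _), z.2.base ∈ c.source :=
    h0.eventually (eventually_base hc hp)
  set a : L n := Ring.inverse (coord c p).2.1 * (coord c p').2.1 with ha
  set b : L n := Ring.inverse (coord c p').2.1 * (coord c p).2.1 with hb'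
  have tA : Filter.Tendsto (fun z : lorentzGroup n × J1LM n M => ((z.1 : (L n)ˣ) : L n)) 𝒰 (𝓝 a) := by
    refine Filter.Tendsto.congr' ?_ (((hinv hu).comp t1).mul t2)
    filter_upwards [ev] with z hz
    simp only [Function.comp_apply, coord_rmul]
    rw [← mul_assoc, Ring.inverse_mul_cancel _ (isUnit_coord hc hz), one_mul]
  have tB : Filter.Tendsto (fun z : lorentzGroup n × J1LM n M => (((z.1 : (L n)ˣ)⁻¹ : (L n)ˣ) : L n))
      𝒰 (𝓝 b) := by
    refine Filter.Tendsto.congr' ?_ (((hinv hu').comp t2).mul t1)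
    filter_upwards [ev] with z hz
    simp only [Function.comp_apply, coord_rmul]
    rw [inverse_mul_of_isUnit (isUnit_coord hc hz) (Units.isUnit _), mul_assoc,
      Ring.inverse_mul_cancel _ (isUnit_coord hc hz), mul_one, Ring.inverse_unit]
  have hab : a * b = 1 := by
    rw [ha, hb', mul_assoc, ← mul_assoc (coord c p').2.1, Ring.mul_inverse_cancel _ hu', one_mul,
      Ring.inverse_mul_cancel _ hu]
  have hba : b * a = 1 := by
    rw [ha, hb', mul_assoc, ← mul_assoc (coord c p).2.1, Ring.mul_inverse_cancel _ hu, one_mul,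
      Ring.inverse_mul_cancel _ hu']
  set a₀ : (L n)ˣ := ⟨a, b, hab, hba⟩
  -- The topology of the unit group is induced by a ↦ (a, a⁻¹), which is why the convergence of the
  -- inverses was needed.
  have tU : Filter.Tendsto (fun z : lorentzGroup n × J1LM n M => (z.1 : (L n)ˣ)) 𝒰 (𝓝 a₀) := by
    rw [Units.isEmbedding_embedProduct.isInducing.tendsto_nhds_iff]
    exact tA.prodMk_nhds ((MulOpposite.continuous_op.tendsto _).comp tB)
  -- The equations defining H are closed conditions, so they hold for the limit.
  have hm : metricOf a = eta n := by
    refine tendsto_nhds_unique ((contDiff_metricOf.continuous.tendsto a).comp tA)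
      (tendsto_const_nhds.congr fun z => ?_)
    exact z.1.2.1.symm
  have hd : det a = 1 := by
    refine tendsto_nhds_unique ((continuous_det.tendsto a).comp tA)
      (tendsto_const_nhds.congr fun z => ?_)
    exact z.1.2.2.symm
  have hx : (𝒰 : Filter _) ≤ 𝓝 ((⟨a₀, hm, hd⟩ : lorentzGroup n), p) := by
    have : Filter.Tendsto id (𝒰 : Filter (lorentzGroup n × J1LM n M))
        (𝓝 ((⟨a₀, hm, hd⟩ : lorentzGroup n), p)) :=
      (tendsto_subtype_rng.2 tU).prodMk_nhds h0
    exact Filter.tendsto_id'.1 this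
  exact ⟨_, tendsto_nhds_unique ((hcont.tendsto _).mono_left hx) h, hx⟩

end J1LM

/-! ### Pullbacks of the coordinate forms to the jet bundle -/

section Pullback

variable {n : ℕ}

theorem entry_conj (B X : L n) (i j : Fin n) :
    entry i j (B * X * star B) = ∑ k, ∑ l, entry i k B * entry j l B * entry k l X := by
  rw [entry_mul, Finset.sum_comm]
  refine Finset.sum_congr rfl fun l _ => ?_
  rw [entry_mul, entry_star, Finset.sum_mul]
  exact Finset.sum_congr rfl fun k _ => by ring

theorem entry_mul_mul (B X C : L n) (i j : Fin n) :
    entry i j (B * X * C) = ∑ k, ∑ l, entry i k B * entry l j C * entry k l X := by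
  rw [entry_mul, Finset.sum_comm]
  refine Finset.sum_congr rfl fun l _ => ?_
  rw [entry_mul, Finset.sum_mul]
  exact Finset.sum_congr rfl fun k _ => by ring

/-- With g = uηuᵀ and Γ = −ρu⁻¹ the left side is (du − ρ dx)ηuᵀ plus its transpose, and du − ρ dx =
uω. -/
theorem metricity_model (z v : VJ n) (hz : IsUnit z.2.1) :
    (dprojModel z v).2.1.op + (projModel z).2.2 (dprojModel z v).1 * (projModel z).2.1.op +
      (projModel z).2.1.op * star ((projModel z).2.2 (dprojModel z v).1) =
    z.2.1 * (omegaModel z v * eta n + eta n * star (omegaModel z v)) * star z.2.1 := by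
  obtain ⟨x, u, ρ⟩ := z
  obtain ⟨y, w, r⟩ := v
  have hu : IsUnit u := hz
  have e1 : (dprojModel (x, u, ρ) (y, w, r)).2.1.op = w * eta n * star u + u * eta n * star w := by
    change (symL n _).op = _
    rw [symL_eq (star_dmetric u w)]; rfl
  have e2 : (projModel (x, u, ρ)).2.1.op = u * eta n * star u := by
    change (symL n (metricOf u)).op = _
    rw [symL_eq (star_metricOf u)]; rfl
  have e3 : (projModel (x, u, ρ)).2.2 (dprojModel (x, u, ρ) (y, w, r)).1
      = -(ρ y * Ring.inverse u) := rfl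
  have e4 : omegaModel (x, u, ρ) (y, w, r) = Ring.inverse u * (w - ρ y) := rfl
  rw [e1, e2, e3, e4]
  have h1 : ρ y * Ring.inverse u * (u * eta n * star u) = ρ y * eta n * star u := by
    simp only [mul_assoc]
    rw [← mul_assoc (Ring.inverse u) u, Ring.inverse_mul_cancel _ hu, one_mul]
  have h2 : u * eta n * star u * star (ρ y * Ring.inverse u) = u * eta n * star (ρ y) := by
    rw [star_mul, mul_assoc, ← mul_assoc (star u), star_mul_star_inverse hu, one_mul]
  have h3 : u * (Ring.inverse u * (w - ρ y) * eta n) * star u = (w - ρ y) * eta n * star u := by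
    rw [← mul_assoc, ← mul_assoc, Ring.mul_inverse_cancel _ hu, one_mul]
  have h4 : u * (eta n * star (Ring.inverse u * (w - ρ y))) * star u =
      u * eta n * star (w - ρ y) := by
    rw [star_mul]
    simp only [mul_assoc]
    rw [star_inverse_mul_star hu, mul_one]
  change _ = u * _ * star u
  rw [mul_add, add_mul, h3, h4, star_neg, neg_mul, mul_neg, h1, h2, star_sub]
  noncomm_ring

theorem torsion_model (z v w : VJ n) :
    (projModel z).2.2 (dprojModel z v).1 (dprojModel z w).1 -
      (projModel z).2.2 (dprojModel z w).1 (dprojModel z v).1 =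
    z.2.2 w.1 (Ring.inverse z.2.1 v.1) - z.2.2 v.1 (Ring.inverse z.2.1 w.1) := by
  have e : ∀ a b : E n, (projModel z).2.2 a b = -(z.2.2 a (Ring.inverse z.2.1 b)) := fun a b => rfl
  rw [e, e, sub_neg_eq_add, neg_add_eq_sub]
  rfl

end Pullback

namespace J1LM

variable {n : ℕ} {M : Type*} [TopologicalSpace M] [ChartedSpace (E n) M] [IsManifold (𝓡 n) ∞ M]
variable {φ : OpenPartialHomeomorph M (E n)}

/-- The component `e^μ_i` of the frame in the chart `φ`. -/
def frameIn (φ : OpenPartialHomeomorph M (E n)) (μ i : Fin n) (p : J1LM n M) : ℝ :=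
  entry μ i (coord φ p).2.1

/-- The component `e^i_μ` of the coframe in the chart `φ`. -/
def coframeIn (φ : OpenPartialHomeomorph M (E n)) (i μ : Fin n) (p : J1LM n M) : ℝ :=
  entry i μ (Ring.inverse (coord φ p).2.1)

theorem contMDiffAt_frameIn (hφ : φ ∈ Charts n M) {p : J1LM n M} (hp : p.base ∈ φ.source)
    (μ i : Fin n) : ContMDiffAt 𝓘(ℝ, VJ n) 𝓘(ℝ) ∞ (frameIn φ μ i) p :=
  ((entry μ i).comp (frameL n)).contDiff.contMDiff.contMDiffAt.comp p (contMDiffAt_coord hφ hp)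

theorem contMDiffAt_coframeIn (hφ : φ ∈ Charts n M) {p : J1LM n M} (hp : p.base ∈ φ.source)
    (i μ : Fin n) : ContMDiffAt 𝓘(ℝ, VJ n) 𝓘(ℝ) ∞ (coframeIn φ i μ) p :=
  ((entry i μ).contDiff.contDiffAt.comp _ (contDiffAt_inverse_frame
    (isUnit_coord hφ hp))).contMDiffAt.comp p (contMDiffAt_coord hφ hp)

theorem pullback_metricityForm_apply (hφ : φ ∈ Charts n M) {p : J1LM n M} (hp : p.base ∈ φ.source)
    (μ ν : Fin n) (v : Fin 1 → VJ n) :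
    ((CSigma.metricityForm φ μ ν).pullback (V := VJ n) toCSigma).val p v = entry μ ν
      ((coord φ p).2.1 * (omegaModel (coord φ p) (dcoord φ p (v 0)) * eta n +
        eta n * star (omegaModel (coord φ p) (dcoord φ p (v 0)))) * star (coord φ p).2.1) := by
  have hp' : p.toCSigma.base ∈ φ.source := hp
  rw [← metricity_model _ _ (isUnit_coord hφ hp)]
  exact CSigma.metricityForm_apply hφ hp' μ ν (coord_toCSigma hφ hp).symm
    (dcoord_dproj hφ hp (v 0)).symm

/-- The coefficients are entries of u ⊗ u. The inverse relation `metricity_eq` has entries of u⁻¹ ⊗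
u⁻¹, so the two families generate the same module over functions. -/
theorem pullback_metricityForm (hφ : φ ∈ Charts n M) {p : J1LM n M} (hp : p.base ∈ φ.source)
    (μ ν : Fin n) : (CSigma.metricityForm φ μ ν).pullback (V := VJ n) toCSigma p =
      (∑ i, ∑ j, DForm.fmul (fun p => frameIn φ μ i p * frameIn φ ν j p) (metricity i j) :
        FormJ n M 1) p := by
  refine ContinuousAlternatingMap.ext fun (v : Fin 1 → VJ n) => ?_
  refine (pullback_metricityForm_apply hφ hp μ ν v).trans ?_
  have h : (∑ i, ∑ j, DForm.fmul (fun p => frameIn φ μ i p * frameIn φ ν j p) (metricity i j) :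
        FormJ n M 1).val p = ∑ i, ∑ j, (frameIn φ μ i p * frameIn φ ν j p) •
        (metricity i j : FormJ n M 1).val p := by
    exact (DForm.val_sum _ _ _).trans (Finset.sum_congr rfl fun _ _ => DForm.val_sum _ _ _)
  refine Eq.trans ?_ (congrArg (fun b : VJ n [⋀^Fin 1]→L[ℝ] ℝ => b v) h).symm
  simp only [ContinuousAlternatingMap.sum_apply, ContinuousAlternatingMap.smul_apply,
    metricity_apply hφ hp, smul_eq_mul]
  exact entry_conj _ _ _ _

theorem metricity_eq (hφ : φ ∈ Charts n M) {p : J1LM n M} (hp : p.base ∈ φ.source)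
    (i j : Fin n) : (metricity i j : FormJ n M 1) p =
      (∑ μ, ∑ ν, DForm.fmul (fun p => coframeIn φ i μ p * coframeIn φ j ν p)
        ((CSigma.metricityForm φ μ ν).pullback toCSigma) : FormJ n M 1) p := by
  refine ContinuousAlternatingMap.ext fun (v : Fin 1 → VJ n) => ?_
  refine (metricity_apply hφ hp i j v).trans ?_
  have h : (∑ μ, ∑ ν, DForm.fmul (fun p => coframeIn φ i μ p * coframeIn φ j ν p)
        ((CSigma.metricityForm φ μ ν).pullback toCSigma) : FormJ n M 1).val p =
      ∑ μ, ∑ ν, (coframeIn φ i μ p * coframeIn φ j ν p) •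
        ((CSigma.metricityForm φ μ ν).pullback (V := VJ n) toCSigma).val p := by
    exact (DForm.val_sum _ _ _).trans (Finset.sum_congr rfl fun _ _ => DForm.val_sum _ _ _)
  refine Eq.trans ?_ (congrArg (fun b : VJ n [⋀^Fin 1]→L[ℝ] ℝ => b v) h).symm
  simp only [ContinuousAlternatingMap.sum_apply, ContinuousAlternatingMap.smul_apply,
    pullback_metricityForm_apply hφ hp, smul_eq_mul]
  refine Eq.trans ?_ (entry_conj _ _ _ _)
  have hu := isUnit_coord hφ hp
  congr 1
  set X := omegaModel (coord φ p) (dcoord φ p (v 0)) * eta n +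
        eta n * star (omegaModel (coord φ p) (dcoord φ p (v 0)))
  rw [mul_assoc, mul_assoc _ (star (coord φ p).2.1), star_mul_star_inverse hu, mul_one, ← mul_assoc,
    Ring.inverse_mul_cancel _ hu, one_mul]

theorem pullback_torsionForm_apply (hφ : φ ∈ Charts n M) {p : J1LM n M} (hp : p.base ∈ φ.source)
    (σ : Fin n) (v w : VJ n) :
    ((CSigma.torsionForm φ σ).pullback (V := VJ n) toCSigma).val p ![v, w] =
      2 * ((coord φ p).2.2 (dcoord φ p w).1 (Ring.inverse (coord φ p).2.1 (dcoord φ p v).1) -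
        (coord φ p).2.2 (dcoord φ p v).1 (Ring.inverse (coord φ p).2.1 (dcoord φ p w).1)) σ := by
  have hp' : p.toCSigma.base ∈ φ.source := hp
  rw [← torsion_model]
  refine Eq.trans ?_ (CSigma.torsionForm_apply hφ hp' σ (coord_toCSigma hφ hp).symm
    (dcoord_dproj hφ hp v).symm (dcoord_dproj hφ hp w).symm)
  refine congrArg ((CSigma.torsionForm φ σ : FormQ n M 2).val p.toCSigma) (funext fun i => ?_)
  fin_cases i <;> rfl

/-- The factor 2 is the one of `CSigma.torsionForm_apply`. It is undone by the factor 2⁻¹ in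
`torsion_eq`. -/
theorem pullback_torsionForm (hφ : φ ∈ Charts n M) {p : J1LM n M} (hp : p.base ∈ φ.source)
    (σ : Fin n) : (CSigma.torsionForm φ σ).pullback (V := VJ n) toCSigma p =
      (∑ i, DForm.fmul (fun p => 2 * frameIn φ σ i p) (torsion i) : FormJ n M 2) p := by
  refine DForm.alt_ext_two (V := VJ n) fun v w => ?_
  refine (pullback_torsionForm_apply hφ hp σ v w).trans ?_
  have h : (∑ i, DForm.fmul (fun p => 2 * frameIn φ σ i p) (torsion i) : FormJ n M 2).val p =
      ∑ i, (2 * frameIn φ σ i p) • (torsion i : FormJ n M 2).val p := DForm.val_sum _ _ _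
  refine Eq.trans ?_ (congrArg (fun b : VJ n [⋀^Fin 2]→L[ℝ] ℝ => b ![v, w]) h).symm
  simp only [ContinuousAlternatingMap.sum_apply, ContinuousAlternatingMap.smul_apply,
    torsion_apply hφ hp _ rfl rfl rfl, smul_eq_mul, mul_assoc, ← Finset.mul_sum]
  congr 1
  refine Eq.trans ?_ (apply_eq_sum (coord φ p).2.1 _ σ)
  have h2 := Ring.mul_inverse_cancel _ (isUnit_coord hφ hp)
  exact congrArg (fun A : L n => A _ σ) h2.symm

theorem torsion_eq (hφ : φ ∈ Charts n M) {p : J1LM n M} (hp : p.base ∈ φ.source)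
    (i : Fin n) : (torsion i : FormJ n M 2) p =
      (∑ σ, DForm.fmul (fun p => 2⁻¹ * coframeIn φ i σ p)
        ((CSigma.torsionForm φ σ).pullback toCSigma) : FormJ n M 2) p := by
  refine DForm.alt_ext_two (V := VJ n) fun v w => ?_
  refine (torsion_apply hφ hp i rfl rfl rfl).trans ?_
  have h : (∑ σ, DForm.fmul (fun p => 2⁻¹ * coframeIn φ i σ p)
        ((CSigma.torsionForm φ σ).pullback toCSigma) : FormJ n M 2).val p =
      ∑ σ, (2⁻¹ * coframeIn φ i σ p) •
        ((CSigma.torsionForm φ σ).pullback (V := VJ n) toCSigma).val p := DForm.val_sum _ _ _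
  refine Eq.trans ?_ (congrArg (fun b : VJ n [⋀^Fin 2]→L[ℝ] ℝ => b ![v, w]) h).symm
  simp only [ContinuousAlternatingMap.sum_apply, ContinuousAlternatingMap.smul_apply,
    pullback_torsionForm_apply hφ hp, smul_eq_mul]
  refine (apply_eq_sum _ _ i).trans (Finset.sum_congr rfl fun σ _ => ?_)
  simp only [coframeIn]
  ring

end J1LM

/-! ### Function spans and pullbacks -/

section FunSpan

variable {V : Type*} [NormedAddCommGroup V] [NormedSpace ℝ V]
variable {W : Type*} [NormedAddCommGroup W] [NormedSpace ℝ W]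
variable {X : Type*} [TopologicalSpace X] [ChartedSpace V X]
variable {Y : Type*} [TopologicalSpace Y] [ChartedSpace W Y]
variable {S : Set X} {G : (k : ℕ) → DForm V X k → Prop}

theorem DForm.pullback_sum {k : ℕ} {ι : Type*} (s : Finset ι) (α : ι → DForm W Y k) (f : X → Y) :
    (∑ i ∈ s, α i).pullback (V := V) f = ∑ i ∈ s, (α i).pullback (V := V) f := by
  funext x
  refine ContinuousAlternatingMap.ext fun (v : Fin k → V) => ?_
  have h1 := DForm.val_sum s α (f x)
  have h2 := DForm.val_sum s (fun i => (α i).pullback (V := V) f) x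
  refine Eq.trans ?_ (congrArg (fun b : V [⋀^Fin k]→L[ℝ] ℝ => b v) h2).symm
  refine (congrArg (fun b : W [⋀^Fin k]→L[ℝ] ℝ => b fun i =>
    (mfderiv 𝓘(ℝ, V) 𝓘(ℝ, W) f x : V →L[ℝ] W) (v i)) h1).trans ?_
  exact (ContinuousAlternatingMap.sum_apply _ _).trans (ContinuousAlternatingMap.sum_apply
    (fun i => ((α i).pullback (V := V) f).val x) v).symm

theorem DForm.pullback_eq_of_eq {k : ℕ} {α β : DForm W Y k} {f : X → Y} {x : X}
    (h : α (f x) = β (f x)) : α.pullback (V := V) f x = β.pullback (V := V) f x := by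
  simp only [DForm.pullback, h]

theorem FunSpan.of_fmul [IsManifold 𝓘(ℝ, V) ∞ X] {k : ℕ} {ξ : DForm V X k}
    (h : FunSpan S G k ξ) {f : X → ℝ}
    (hf : ∀ x ∈ S, ContMDiffAt 𝓘(ℝ, V) 𝓘(ℝ) ∞ f x) : FunSpan S G k (DForm.fmul f ξ) := by
  induction h with
  | zero => exact FunSpan.zero.congr fun x _ => smul_zero (f x)
  | add _ _ h1 h2 => exact (h1.add h2).congr fun x _ => smul_add (f x) _ _
  | fmul g β hg hβ =>
    exact (FunSpan.fmul (fun x => f x * g x) β (fun x hx => (hf x hx).mul (hg x hx)) hβ).congr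
      fun x _ => smul_smul (f x) (g x) _
  | congr _ h ih => exact ih.congr fun x hx => congrArg (f x • ·) (h x hx)

end FunSpan

/-! ### The reduced differential system -/

section General

variable {V : Type*} [NormedAddCommGroup V] [NormedSpace ℝ V]
variable {W : Type*} [NormedAddCommGroup W] [NormedSpace ℝ W]
variable {X : Type*} [TopologicalSpace X] [ChartedSpace V X]
variable {Y : Type*} [TopologicalSpace Y] [ChartedSpace W Y]
variable {S : Set X} {G : (k : ℕ) → DForm V X k → Prop}

theorem DForm.pullback_fmul {k : ℕ} (h : Y → ℝ) (α : DForm W Y k) (f : X → Y) :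
    (DForm.fmul h α).pullback (V := V) f = DForm.fmul (h ∘ f) (α.pullback (V := V) f) := rfl

theorem DForm.pullback_eq_self {k : ℕ} (α : DForm W Y k) {f : Y → Y} {y : Y} (h : f =ᶠ[𝓝 y] id) :
    α.pullback (V := W) f y = α y := by
  rw [DForm.pullback_congr (V := W) α h, DForm.pullback_id]

theorem DiffIdeal.of_fmul [IsManifold 𝓘(ℝ, V) ∞ X] [FiniteDimensional ℝ V] (hS : IsOpen S) {k : ℕ}
    {f : X → ℝ} {β : DForm V X k} (hf : ∀ x ∈ S, ContMDiffAt 𝓘(ℝ, V) 𝓘(ℝ) ∞ f x) (hβ : G k β) :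
    DiffIdeal S G k (DForm.fmul f β) := by
  refine DiffIdeal.of_castDeg (zero_add k).symm ?_
  rw [← DForm.ofFun_wedge]
  refine DiffIdeal.gen _ β ?_ hβ
  rw [DForm.isSmoothOn_iff hS]
  exact fun x hx => DForm.smoothAt_ofFun (hf x hx)

/-- This turns the vanishing of all generators along a map into the vanishing of the whole ideal:
pulling back into the ideal without generators gives zero. -/
theorem DiffIdeal.eq_zero_of_isEmpty {k : ℕ} {ξ : DForm V X k} (hG : ∀ b β, ¬ G b β)
    (h : DiffIdeal S G k ξ) : ∀ x ∈ S, ξ x = 0 := by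
  induction h with
  | zero k => exact fun x _ => rfl
  | add _ _ h1 h2 => exact fun x hx => (congrArg₂ (· + ·) (h1 x hx) (h2 x hx)).trans (add_zero _)
  | gen γ β hγ hβ => exact absurd hβ (hG _ _)
  | dgen γ β hγ hβ => exact absurd hβ (hG _ _)
  | congr _ h ih => exact fun x hx => (h x hx).trans (ih x hx)

end General

namespace J1LM

variable {n : ℕ} {M : Type*} [TopologicalSpace M] [ChartedSpace (E n) M] [IsManifold (𝓡 n) ∞ M]
variable {φ : OpenPartialHomeomorph M (E n)}

theorem funSpan_pullback_toCSigma (hφ : φ ∈ Charts n M) (b : ℕ) (β : FormQ n M b)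
    (hβ : CSigma.LCGenerator φ b β) :
    FunSpan {p : J1LM n M | p.base ∈ φ.source} PGGenerator b (β.pullback toCSigma) := by
  cases hβ with
  | metricity μ ν =>
    refine FunSpan.congr (FunSpan.sum _ fun i _ => FunSpan.sum _ fun j _ =>
      FunSpan.fmul _ _ (fun p hp => ?_) (.metricity i j)) fun p hp => pullback_metricityForm hφ hp μ ν
    exact (contMDiffAt_frameIn hφ hp μ i).mul (contMDiffAt_frameIn hφ hp ν j)
  | torsion σ =>
    refine FunSpan.congr (FunSpan.sum _ fun i _ => FunSpan.fmul _ _ (fun p hp => ?_) (.torsion i))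
      fun p hp => pullback_torsionForm hφ hp σ
    exact contMDiffAt_const.mul (contMDiffAt_frameIn hφ hp σ i)

theorem diffIdeal_pullback_toCSigma (hφ : φ ∈ Charts n M) {k : ℕ} {α : FormQ n M k}
    (h : DiffIdeal {q : CSigma n M | q.base ∈ φ.source} (CSigma.LCGenerator φ) k α) :
    DiffIdeal {p : J1LM n M | p.base ∈ φ.source} PGGenerator k (α.pullback toCSigma) :=
  h.pullback (isOpen_base_preimage hφ) (CSigma.isOpen_base_preimage hφ)
    (fun p _ => contMDiff_toCSigma p) (fun _ hp => hp)
    (fun b β hβ p _ => smoothAt_PGGenerator b β hβ p) (CSigma.smoothAt_LCGenerator hφ)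
    (funSpan_pullback_toCSigma hφ)

/-- If the generators of the Levi-Civita system pull back along `toCSigma ∘ f` to combinations of
forms in `G`, then so do the generators of `IPG` along `f`. -/
theorem funSpan_pullback_of_comp {V : Type*} [NormedAddCommGroup V] [NormedSpace ℝ V]
    {X : Type*} [TopologicalSpace X] [ChartedSpace V X] [IsManifold 𝓘(ℝ, V) ∞ X] {S : Set X}
    {G : (k : ℕ) → DForm V X k → Prop} (hφ : φ ∈ Charts n M) {f : X → J1LM n M}
    (hf : ∀ x ∈ S, ContMDiffAt 𝓘(ℝ, V) 𝓘(ℝ, VJ n) ∞ f x) (hm : ∀ x ∈ S, (f x).base ∈ φ.source)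
    (h : ∀ b β, CSigma.LCGenerator φ b β → FunSpan S G b (β.pullback (V := V) (toCSigma ∘ f)))
    (b : ℕ) (β : FormJ n M b) (hβ : PGGenerator b β) : FunSpan S G b (β.pullback (V := V) f) := by
  have hc : ∀ {c : ℕ} (γ : FormQ n M c), ∀ x ∈ S,
      (γ.pullback (V := VJ n) toCSigma).pullback (V := V) f x =
        γ.pullback (V := V) (toCSigma ∘ f) x := fun γ x hx =>
    DForm.pullback_pullback γ ((contMDiff_toCSigma (f x)).mdifferentiableAt (by simp))
      ((hf x hx).mdifferentiableAt (by simp))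
  cases hβ with
  | metricity i j =>
    -- The generator is first written through the pulled-back metricity forms of the quotient. Their
    -- pullbacks along f are the pullbacks along p_H ∘ f, which are known by hypothesis.
    have key : FunSpan S G 1 (∑ μ, ∑ ν, DForm.fmul ((fun p => coframeIn φ i μ p * coframeIn φ j ν p) ∘ f)
        (((CSigma.metricityForm φ μ ν).pullback (V := VJ n) toCSigma).pullback (V := V) f)) := by
      refine FunSpan.sum _ fun μ _ => FunSpan.sum _ fun ν _ => FunSpan.of_fmul
        ((h _ _ (.metricity μ ν)).congr (hc _)) fun x hx => ?_
      exact ((contMDiffAt_coframeIn hφ (hm x hx) i μ).mul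
        (contMDiffAt_coframeIn hφ (hm x hx) j ν)).comp x (hf x hx)
    refine key.congr fun x hx => ?_
    refine (DForm.pullback_eq_of_eq (V := V) (metricity_eq hφ (hm x hx) i j)).trans ?_
    refine congrFun ?_ x
    rw [DForm.pullback_sum]
    exact Finset.sum_congr rfl fun μ _ => DForm.pullback_sum _ _ _
  | torsion i =>
    have key : FunSpan S G 2 (∑ σ, DForm.fmul ((fun p => 2⁻¹ * coframeIn φ i σ p) ∘ f)
        (((CSigma.torsionForm φ σ).pullback (V := VJ n) toCSigma).pullback (V := V) f)) := by
      refine FunSpan.sum _ fun σ _ => FunSpan.of_fmul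
        ((h _ _ (.torsion σ)).congr (hc _)) fun x hx => ?_
      exact (contMDiffAt_const.mul (contMDiffAt_coframeIn hφ (hm x hx) i σ)).comp x (hf x hx)
    refine key.congr fun x hx => ?_
    refine (DForm.pullback_eq_of_eq (V := V) (torsion_eq hφ (hm x hx) i)).trans ?_
    exact congrFun (DForm.pullback_sum _ _ _) x

/-- The differential system `IPG` is invariant under the Lorentz group. -/
theorem IPG_pullback_rmul [T2Space M] [SigmaCompactSpace M] {A : (L n)ˣ} (hA : A ∈ lorentzGroup n)
    {k : ℕ} {ξ : FormJ n M k} (hξ : IPG n M k ξ) :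
    IPG n M k (ξ.pullback fun p : J1LM n M => p.rmul A) := by
  refine DiffIdeal.of_local finite_PGGenerator isOpen_univ fun p _ => ?_
  have hφ : chartAt (E n) p.base ∈ Charts n M := IsManifold.chart_mem_maximalAtlas p.base
  refine ⟨_, isOpen_base_preimage hφ, mem_chart_source (E n) p.base, ?_⟩
  refine DiffIdeal.pullback (isOpen_base_preimage hφ) isOpen_univ (fun p _ => contMDiff_rmul A p)
    (Set.mapsTo_univ _ _) (fun b β hβ p _ => smoothAt_PGGenerator b β hβ p)
    (fun b β hβ p _ => smoothAt_PGGenerator b β hβ p) ?_ hξ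
  refine funSpan_pullback_of_comp hφ (fun p _ => contMDiff_rmul A p) (fun _ hp => hp) ?_
  -- Invariance reduces to p_H ∘ R_A = p_H.
  have h : (toCSigma ∘ fun p : J1LM n M => p.rmul A) = toCSigma := funext fun p => toCSigma_rmul p hA
  rw [h]
  exact funSpan_pullback_toCSigma hφ

/-- Downwards one pulls back along local sections of p_H, upwards along p_H itself. Both arguments
are local and are glued by `DiffIdeal.of_local`. -/
theorem reducedEDS_iff [NeZero n] [T2Space M] [SigmaCompactSpace M] (k : ℕ) (α : FormQ n M k) :
    ReducedEDS J1LM.toCSigma (IPG n M) k α ↔ α.IsSmooth ∧ ∀ φ ∈ Charts n M,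
      DiffIdeal {q : CSigma n M | q.base ∈ φ.source} (CSigma.LCGenerator φ) k α := by
  refine and_congr_right fun hα => ⟨fun h φ hφ => ?_, fun h => ?_⟩
  · refine DiffIdeal.of_local CSigma.finite_LCGenerator (CSigma.isOpen_base_preimage hφ) fun q hq => ?_
    obtain ⟨p, rfl⟩ := toCSigma_surjective q
    obtain ⟨B, s, hB, hpB, -, hs, hsec⟩ := exists_local_section contMDiff_toCSigma (dproj_surjective p)
    have hU := hB.inter (CSigma.isOpen_base_preimage hφ)
    -- The composite p_H ∘ s is the identity near every point of B, so s^* undoes p_H^*.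
    have hid : ∀ {c : ℕ} (γ : FormQ n M c), ∀ y ∈ B, γ.pullback (V := VQ n) (toCSigma ∘ s) y = γ y :=
      fun γ y hy => DForm.pullback_eq_self γ (Filter.eventually_of_mem (hB.mem_nhds hy) hsec)
    refine ⟨_, hU, ⟨hpB, hq⟩, ?_⟩
    have hsm : ∀ y ∈ B ∩ {q | q.base ∈ φ.source},
        ContMDiffAt 𝓘(ℝ, VQ n) 𝓘(ℝ, VJ n) ∞ s y := fun y hy => hs y hy.1
    have key := DiffIdeal.pullback (G := CSigma.LCGenerator φ) hU isOpen_univ hsm (Set.mapsTo_univ _ _)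
      (fun b β hβ y hy => CSigma.smoothAt_LCGenerator hφ b β hβ y hy.2)
      (fun b β hβ p _ => smoothAt_PGGenerator b β hβ p)
      (funSpan_pullback_of_comp hφ hsm (fun y hy => ?_) fun b β hβ => ?_) h
    · refine key.congr fun y hy => ?_
      refine Eq.symm ((DForm.pullback_pullback α ((contMDiff_toCSigma (s y)).mdifferentiableAt
        (by simp)) ((hs y hy.1).mdifferentiableAt (by simp))).trans (hid α y hy.1))
    · have : (s y).toCSigma.base ∈ φ.source := by rw [hsec y hy.1]; exact hy.2
      exact this
    -- Along p_H ∘ s a Levi-Civita generator pulls back to itself, a combination with coefficient 1.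
    · refine (FunSpan.fmul (fun _ => 1) β (fun _ _ => contMDiffAt_const) hβ).congr fun y hy => ?_
      exact (hid β y hy.1).trans (one_smul ℝ (β y)).symm
  · refine DiffIdeal.of_local finite_PGGenerator isOpen_univ fun p _ => ?_
    have hφ : chartAt (E n) p.base ∈ Charts n M := IsManifold.chart_mem_maximalAtlas p.base
    exact ⟨_, isOpen_base_preimage hφ, mem_chart_source (E n) p.base,
      diffIdeal_pullback_toCSigma hφ (h _ hφ)⟩

end J1LM

/-! ### Integral sections of the reduced differential system -/

namespace CSigma

variable {n : ℕ} {M : Type*} [TopologicalSpace M] [ChartedSpace (E n) M] [IsManifold (𝓡 n) ∞ M]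
variable {φ : OpenPartialHomeomorph M (E n)}

/-- The tangent vector at `x` with components `w` in the chart `φ`. -/
def ofComponents (φ : OpenPartialHomeomorph M (E n)) (x : M) : E n →L[ℝ] E n :=
  mfderiv (𝓡 n) (𝓡 n) φ.symm (φ x)

theorem ofComponents_surjective (hφ : φ ∈ Charts n M) {x : M} (hx : x ∈ φ.source) :
    Function.Surjective (ofComponents φ x) := by
  have h1 := (contMDiffAt_of_mem_maximalAtlas hφ hx).mdifferentiableAt (by simp)
  have h2 := (contMDiffAt_symm_of_mem_maximalAtlas hφ (φ.map_source hx)).mdifferentiableAt (by simp)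
  have h3 := mfderiv_comp x h2 h1
  have h4 : (φ.symm ∘ φ) =ᶠ[𝓝 x] id := by
    filter_upwards [φ.open_source.mem_nhds hx] with y hy using φ.left_inv hy
  rw [h4.mfderiv_eq, mfderiv_id] at h3
  intro v
  exact ⟨(mfderiv (𝓡 n) (𝓡 n) φ x : E n →L[ℝ] E n) v,
    (congrArg (fun A : E n →L[ℝ] E n => A v) h3).symm⟩

section Section

variable {s : M → CSigma n M} {x : M}

theorem dcoord_section (hφ : φ ∈ Charts n M) (hx : x ∈ φ.source)
    (hs : ContMDiffAt (𝓡 n) 𝓘(ℝ, VQ n) ∞ s x) (hb : ∀ᶠ y in 𝓝 x, (s y).base = y) :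
    DifferentiableAt ℝ (fun y => coord φ (s (φ.symm y))) (φ x) ∧ ∀ w : E n,
      dcoord φ (s x) ((mfderiv (𝓡 n) 𝓘(ℝ, VQ n) s x : E n →L[ℝ] VQ n) (ofComponents φ x w)) =
        fderiv ℝ (fun y => coord φ (s (φ.symm y))) (φ x) w := by
  have hsx : (s x).base ∈ φ.source := by rw [hb.self_of_nhds]; exact hx
  have e : φ.symm (φ x) = x := φ.left_inv hx
  have h1 := (contMDiffAt_symm_of_mem_maximalAtlas hφ (φ.map_source hx)).mdifferentiableAt (by simp)
  have h2 : MDifferentiableAt (𝓡 n) 𝓘(ℝ, VQ n) s (φ.symm (φ x)) := by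
    rw [e]; exact hs.mdifferentiableAt (by simp)
  have h3 : MDifferentiableAt 𝓘(ℝ, VQ n) 𝓘(ℝ, VQ n) (coord φ) (s (φ.symm (φ x))) := by
    rw [e]; exact (contMDiffAt_coord hφ hsx).mdifferentiableAt (by simp)
  have h4 := mfderiv_comp (φ x) h2 h1
  have h5 := mfderiv_comp (φ x) h3 (h2.comp (φ x) h1)
  refine ⟨mdifferentiableAt_iff_differentiableAt.1 (h3.comp (φ x) (h2.comp (φ x) h1)), fun w => ?_⟩
  rw [mfderiv_eq_fderiv, h4] at h5
  refine Eq.trans ?_ (congrArg (fun A : E n →L[ℝ] VQ n => A w) h5).symm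
  change _ = dcoord φ (s (φ.symm (φ x))) ((mfderiv (𝓡 n) 𝓘(ℝ, VQ n) s (φ.symm (φ x)) :
    E n →L[ℝ] VQ n) (ofComponents φ x w))
  rw [e]

/-- Being a section, s has the identity as base component, so dx pulls back to dx. -/
theorem fderiv_section_fst (hφ : φ ∈ Charts n M) (hx : x ∈ φ.source)
    (hs : ContMDiffAt (𝓡 n) 𝓘(ℝ, VQ n) ∞ s x) (hb : ∀ᶠ y in 𝓝 x, (s y).base = y) (w : E n) :
    (fderiv ℝ (fun y => coord φ (s (φ.symm y))) (φ x) w).1 = w := by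
  have hd := (dcoord_section hφ hx hs hb).1
  have h1 := (ContinuousLinearMap.fst ℝ (E n) (SymOp n × (E n →L[ℝ] L n))).hasFDerivAt.comp (φ x)
    hd.hasFDerivAt
  have h2 : (fun y => (coord φ (s (φ.symm y))).1) =ᶠ[𝓝 (φ x)] id := by
    have hc : ContinuousAt φ.symm (φ x) := φ.continuousAt_symm (φ.map_source hx)
    have hc' : Filter.Tendsto φ.symm (𝓝 (φ x)) (𝓝 x) := by
      have := hc.tendsto
      rwa [φ.left_inv hx] at this
    filter_upwards [hc'.eventually hb, φ.open_target.mem_nhds (φ.map_source hx)] with y hy hy'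
    change φ (s (φ.symm y)).base = y
    rw [hy, φ.right_inv hy']
  exact congrArg (fun A : E n →L[ℝ] E n => A w)
    (h1.unique ((hasFDerivAt_id (φ x)).congr_of_eventuallyEq h2))

theorem entry_fderiv_section (hφ : φ ∈ Charts n M) (hx : x ∈ φ.source)
    (hs : ContMDiffAt (𝓡 n) 𝓘(ℝ, VQ n) ∞ s x) (hb : ∀ᶠ y in 𝓝 x, (s y).base = y) (w : E n)
    (μ ν : Fin n) : entry μ ν (fderiv ℝ (fun y => coord φ (s (φ.symm y))) (φ x) w).2.1.op =
      fderiv ℝ (fun y => g φ μ ν (s (φ.symm y))) (φ x) w := by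
  have hd := (dcoord_section hφ hx hs hb).1
  have h1 := ((gL μ ν).hasFDerivAt.comp (φ x) hd.hasFDerivAt).fderiv
  exact (congrArg (fun A : E n →L[ℝ] ℝ => A w) h1).symm

theorem pullback_metricityForm_section (hφ : φ ∈ Charts n M) (hx : x ∈ φ.source)
    (hs : ContMDiffAt (𝓡 n) 𝓘(ℝ, VQ n) ∞ s x) (hb : ∀ᶠ y in 𝓝 x, (s y).base = y) (μ ν γ : Fin n) :
    ((metricityForm φ μ ν).pullback (V := E n) s).val x
        (fun _ => ofComponents φ x (EuclideanSpace.single γ (1 : ℝ))) =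
      fderiv ℝ (fun y => g φ μ ν (s (φ.symm y))) (φ x) (EuclideanSpace.single γ (1 : ℝ)) +
        ∑ σ, (g φ μ σ (s x) * Γ φ ν γ σ (s x) + g φ ν σ (s x) * Γ φ μ γ σ (s x)) := by
  have hsx : (s x).base ∈ φ.source := by rw [hb.self_of_nhds]; exact hx
  refine (metricityForm_apply hφ hsx μ ν rfl
    ((dcoord_section hφ hx hs hb).2 (EuclideanSpace.single γ (1 : ℝ))).symm).trans ?_
  rw [map_add, map_add, entry_fderiv_section hφ hx hs hb, fderiv_section_fst hφ hx hs hb, add_assoc,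
    entry_mul, entry_mul, ← Finset.sum_add_distrib]
  congr 1
  refine Finset.sum_congr rfl fun σ _ => ?_
  have hg : entry σ ν (coord φ (s x)).2.1.op = g φ ν σ (s x) := by
    rw [← SymOp.star_op, entry_star]; rfl
  rw [entry_star, hg, add_comm, mul_comm (entry μ σ ((coord φ (s x)).2.2 _))]
  rfl

theorem pullback_torsionForm_section (hφ : φ ∈ Charts n M) (hx : x ∈ φ.source)
    (hs : ContMDiffAt (𝓡 n) 𝓘(ℝ, VQ n) ∞ s x) (hb : ∀ᶠ y in 𝓝 x, (s y).base = y) (σ : Fin n)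
    (v w : E n) :
    ((torsionForm φ σ).pullback (V := E n) s).val x ![ofComponents φ x v, ofComponents φ x w] =
      2 * (connIn φ (s x) v w - connIn φ (s x) w v) σ := by
  have hsx : (s x).base ∈ φ.source := by rw [hb.self_of_nhds]; exact hx
  have h := torsionForm_apply hφ hsx σ rfl ((dcoord_section hφ hx hs hb).2 v).symm
    ((dcoord_section hφ hx hs hb).2 w).symm
  rw [fderiv_section_fst hφ hx hs hb, fderiv_section_fst hφ hx hs hb] at h
  refine Eq.trans ?_ h
  refine congrArg ((torsionForm φ σ : FormQ n M 2).val (s x)) (funext fun i => ?_)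
  fin_cases i <;> rfl

/-- The generators of the Levi-Civita system vanish along a section at `x` if and only if the
section satisfies the Levi-Civita equations at `x`. -/
theorem forall_pullback_eq_zero_iff (hφ : φ ∈ Charts n M) (hx : x ∈ φ.source)
    (hs : ContMDiffAt (𝓡 n) 𝓘(ℝ, VQ n) ∞ s x) (hb : ∀ᶠ y in 𝓝 x, (s y).base = y) :
    (∀ b β, LCGenerator φ b β → β.pullback (V := E n) s x = 0) ↔
      (∀ μ ν γ, fderiv ℝ (fun y => g φ μ ν (s (φ.symm y))) (φ x)
          (EuclideanSpace.single γ (1 : ℝ)) +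
        ∑ σ, (g φ μ σ (s x) * Γ φ ν γ σ (s x) + g φ ν σ (s x) * Γ φ μ γ σ (s x)) = 0) ∧
      (∀ σ μ ν, Γ φ σ μ ν (s x) - Γ φ σ ν μ (s x) = 0) := by
  constructor
  · intro h
    refine ⟨fun μ ν γ => ?_, fun σ μ ν => ?_⟩
    · rw [← pullback_metricityForm_section hφ hx hs hb]
      exact congrArg (fun a : E n [⋀^Fin 1]→L[ℝ] ℝ =>
        a fun _ => ofComponents φ x (EuclideanSpace.single γ (1 : ℝ))) (h _ _ (.metricity μ ν))
    · have h1 := pullback_torsionForm_section hφ hx hs hb σ (EuclideanSpace.single μ (1 : ℝ))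
        (EuclideanSpace.single ν (1 : ℝ))
      have h2 := congrArg (fun a : E n [⋀^Fin 2]→L[ℝ] ℝ =>
        a ![ofComponents φ x (EuclideanSpace.single μ (1 : ℝ)),
          ofComponents φ x (EuclideanSpace.single ν (1 : ℝ))]) (h _ _ (.torsion σ))
      have h3 := h1.symm.trans h2
      exact (mul_eq_zero.1 h3).resolve_left two_ne_zero
  · rintro ⟨h1, h2⟩ b β (⟨μ, ν⟩ | ⟨σ⟩)
    · refine ContinuousAlternatingMap.ext fun (v : Fin 1 → E n) => ?_
      obtain ⟨w, hw⟩ := ofComponents_surjective hφ hx (v 0)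
      have hv : v = fun _ => ofComponents φ x w := funext fun i => by
        rw [Subsingleton.elim i 0, hw]
      -- The equations give the values of this one-form on the coordinate vectors, and these
      -- determine it.
      have h0 : ((ContinuousAlternatingMap.ofSubsingleton ℝ (E n) ℝ (0 : Fin 1)).symm
          (((metricityForm φ μ ν).pullback (V := E n) s).val x)).comp (ofComponents φ x) = 0 := by
        refine ContinuousLinearMap.coe_injective
          ((EuclideanSpace.basisFun (Fin n) ℝ).toBasis.ext fun γ => ?_)
        have h3 := pullback_metricityForm_section hφ hx hs hb μ ν γ
        rw [h1] at h3
        simpa using h3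
      rw [hv]
      exact congrArg (fun A : E n →L[ℝ] ℝ => A w) h0
    · refine DForm.alt_ext_two (V := E n) fun v w => ?_
      obtain ⟨v, rfl⟩ := ofComponents_surjective hφ hx v
      obtain ⟨w, rfl⟩ := ofComponents_surjective hφ hx w
      refine (pullback_torsionForm_section hφ hx hs hb σ v w).trans ?_
      change 2 * (connIn φ (s x) v w σ - connIn φ (s x) w v σ) = 0
      -- After the dummy indices of one sum are exchanged, the symmetry of Γ cancels the two sums
      -- term by term.
      rw [apply_apply_eq_sum, apply_apply_eq_sum, Finset.sum_comm, ← Finset.sum_sub_distrib]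
      refine mul_eq_zero_of_right _ (Finset.sum_eq_zero fun ρ _ => ?_)
      rw [← Finset.sum_sub_distrib]
      refine Finset.sum_eq_zero fun j _ => ?_
      have h3 := h2 σ j ρ
      simp only [Γ] at h3
      rw [mul_comm (w ρ), ← mul_sub, h3, mul_zero]

end Section

variable [T2Space M] [SigmaCompactSpace M]

/-- Every generator of the Levi-Civita system of a chart coincides near a given point of its domain
with an element of the reduced system. -/
theorem exists_reducedEDS_eq (hφ : φ ∈ Charts n M) {x : M} (hx : x ∈ φ.source) {b : ℕ}
    {β : FormQ n M b} (hβ : LCGenerator φ b β) : ∃ α : FormQ n M b,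
      ReducedEDS J1LM.toCSigma (IPG n M) b α ∧ ∀ q : CSigma n M, q.base = x → α q = β q := by
  -- The cutoff depends on the base point only and has support inside the chart domain. The product
  -- with β is thus zero near the points outside the domain, where β has no control.
  obtain ⟨χ, -, hχ⟩ := (SmoothBumpFunction.nhds_basis_tsupport (I := 𝓡 n) x).mem_iff.1
    (φ.open_source.mem_nhds hx)
  have hsm : ContMDiff 𝓘(ℝ, VQ n) 𝓘(ℝ) ∞ fun q : CSigma n M => χ q.base :=
    χ.contMDiff.comp contMDiff_base
  have hO : IsOpen {q : CSigma n M | q.base ∉ tsupport χ} :=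
    (isClosed_tsupport χ).isOpen_compl.preimage contMDiff_base.continuous
  have hz : ∀ q : CSigma n M, q.base ∉ tsupport χ →
      DForm.fmul (fun q : CSigma n M => χ q.base) β q = 0 := fun q hq => by
    have : χ q.base = 0 := image_eq_zero_of_notMem_tsupport hq
    simp only [DForm.fmul, this]
    exact zero_smul ℝ (β q)
  refine ⟨DForm.fmul (fun q => χ q.base) β, ⟨?_, ?_⟩, fun q hq => ?_⟩
  · rw [DForm.IsSmooth, DForm.isSmoothOn_iff isOpen_univ]
    intro q _
    by_cases hq : q.base ∈ φ.source
    · exact (smoothAt_LCGenerator hφ b β hβ q hq).fmul (hsm q)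
    · exact (DForm.smoothAt_zero b q).congr (Filter.eventually_of_mem
        (hO.mem_nhds fun h => hq (hχ h)) hz)
  · refine DiffIdeal.of_local finite_PGGenerator isOpen_univ fun p _ => ?_
    by_cases hp : p.base ∈ φ.source
    · exact ⟨_, J1LM.isOpen_base_preimage hφ, hp, J1LM.diffIdeal_pullback_toCSigma hφ
        (DiffIdeal.of_fmul (isOpen_base_preimage hφ) (fun q _ => hsm q) hβ)⟩
    · refine ⟨_, hO.preimage J1LM.contMDiff_toCSigma.continuous, fun h => hp (hχ h), ?_⟩
      exact (DiffIdeal.zero b).congr fun p hp => DForm.pullback_eq_of_eq (β := 0) (hz _ hp)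
  · have : χ q.base = 1 := by rw [hq]; exact χ.eq_one
    simp only [DForm.fmul, this]
    exact one_smul ℝ (β q)

/-- The integral sections of the reduced system are the pairs of a metric and its Levi-Civita
connection. -/
theorem integral_section_iff [NeZero n] {W : Set M} {s : M → CSigma n M} (hW : IsOpen W)
    (hs : ContMDiffOn (𝓡 n) 𝓘(ℝ, VQ n) ∞ s W) (hb : ∀ x ∈ W, (s x).base = x) :
    (∀ (k : ℕ) (α : FormQ n M k), ReducedEDS J1LM.toCSigma (IPG n M) k α →
        ∀ x ∈ W, α.pullback (V := E n) s x = 0) ↔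
      ∀ φ ∈ Charts n M, ∀ x ∈ W, x ∈ φ.source →
        (∀ μ ν γ, fderiv ℝ (fun y => g φ μ ν (s (φ.symm y))) (φ x)
            (EuclideanSpace.single γ (1 : ℝ)) +
          ∑ σ, (g φ μ σ (s x) * Γ φ ν γ σ (s x) + g φ ν σ (s x) * Γ φ μ γ σ (s x)) = 0) ∧
        (∀ σ μ ν, Γ φ σ μ ν (s x) - Γ φ σ ν μ (s x) = 0) := by
  have hs' : ∀ x ∈ W, ContMDiffAt (𝓡 n) 𝓘(ℝ, VQ n) ∞ s x :=
    fun x hx => hs.contMDiffAt (hW.mem_nhds hx)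
  have hb' : ∀ x ∈ W, ∀ᶠ y in 𝓝 x, (s y).base = y :=
    fun x hx => Filter.eventually_of_mem (hW.mem_nhds hx) hb
  constructor
  · intro h φ hφ x hxW hx
    refine (forall_pullback_eq_zero_iff hφ hx (hs' x hxW) (hb' x hxW)).1 fun b β hβ => ?_
    obtain ⟨α, hα, hαβ⟩ := exists_reducedEDS_eq hφ hx hβ
    exact (DForm.pullback_eq_of_eq (hαβ _ (hb x hxW))).symm.trans (h b α hα x hxW)
  · intro h k α hα x hxW
    -- Conversely, all generators in the chart at x vanish along s, so α pulls back into the ideal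
    -- without generators.
    have hφ : chartAt (E n) x ∈ Charts n M := IsManifold.chart_mem_maximalAtlas x
    have hα' := ((J1LM.reducedEDS_iff k α).1 hα).2 _ hφ
    have hU := hW.inter (chartAt (E n) x).open_source
    refine DiffIdeal.eq_zero_of_isEmpty (G := fun _ _ => False) (fun _ _ => id)
      (hα'.pullback (V := E n) (f := s) hU (isOpen_base_preimage hφ) (fun y hy => hs' y hy.1) (fun y hy => ?_)
        (fun _ _ h => h.elim) (smoothAt_LCGenerator hφ) fun b β hβ => ?_) x
      ⟨hxW, mem_chart_source (E n) x⟩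
    · change (s y).base ∈ (chartAt (E n) x).source
      rw [hb y hy.1]; exact hy.2
    · exact FunSpan.zero.congr fun y hy => (forall_pullback_eq_zero_iff hφ hy.2 (hs' y hy.1)
        (hb' y hy.1)).2 (h _ hφ y hy.1 hy.2) b β hβ

end CSigma

/-! ### The Levi-Civita symbol -/

section LeviCivita

theorem leviCivita_comp {n : ℕ} (f : Fin n → Fin n) (π : Equiv.Perm (Fin n)) :
    leviCivita (f ∘ π) = (Equiv.Perm.sign π : ℤ) * leviCivita f :=
  Matrix.det_permute π ((1 : Matrix (Fin n) (Fin n) ℝ).submatrix f id)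

/-- The last entry is moved to the front past m + 1 others, then γ is moved to the second place past
m others. The total sign is (−1)^{2m+1}. -/
theorem leviCivita_append {m : ℕ} (μ : Fin m → Fin (m + 2)) (γ κ : Fin (m + 2)) :
    leviCivita (Fin.append μ ![γ, κ]) = -leviCivita (Matrix.vecCons κ (Matrix.vecCons γ μ)) := by
  have h1 : Fin.append μ ![γ, κ] = Fin.snoc (α := fun _ => Fin (m + 2)) (Fin.snoc μ γ) κ := by
    have : (![γ, κ] : Fin 2 → Fin (m + 2)) = Fin.snoc (α := fun _ => Fin (m + 2)) ![γ] κ := by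
      ext i; fin_cases i <;> rfl
    rw [this, Fin.append_snoc, Fin.append_right_eq_snoc]
    rfl
  have h2 : Fin.snoc (α := fun _ => Fin (m + 2)) (Fin.snoc μ γ) κ =
      (Matrix.vecCons κ (Matrix.vecCons γ μ)) ∘
        (Equiv.Perm.decomposeFin.symm (0, finRotate (m + 1)) ∘ finRotate (m + 2)) := by
    rw [Fin.snoc_eq_cons_rotate]
    funext i
    refine Eq.trans ?_ (congrArg (fun h : Fin (m + 2) → Fin (m + 2) => h (finRotate (m + 2) i))
      (show Fin.cons (α := fun _ => Fin (m + 2)) κ (Fin.snoc μ γ : Fin (m + 1) → Fin (m + 2)) =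
        (Matrix.vecCons κ (Matrix.vecCons γ μ)) ∘
          Equiv.Perm.decomposeFin.symm (0, finRotate (m + 1)) from ?_))
    · rfl
    · funext j
      refine Fin.cases ?_ (fun j => ?_) j
      · simp
      · rw [Function.comp_apply, Equiv.Perm.decomposeFin_symm_apply_succ, Fin.snoc_eq_cons_rotate]
        simp
        rfl
  rw [h1, h2, ← Function.comp_assoc, leviCivita_comp, leviCivita_comp,
    Equiv.Perm.decomposeFin.symm_sign, sign_finRotate, sign_finRotate, ← mul_assoc]
  have h3 : ((((-1) ^ (m + 2 - 1) : ℤˣ) : ℤ) : ℝ) *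
      (((if (0 : Fin (m + 1 + 1)) = 0 then 1 else -1) * (-1) ^ (m + 1 - 1) : ℤˣ) : ℤ) = -1 := by
    push_cast
    simp [pow_succ, ← mul_pow]
  rw [h3, neg_one_mul]

/-- The determinant of the product of Bᵀ with the matrix of rows f of the identity is computed
twice, by multilinearity in the rows and by multiplicativity. -/
theorem sum_leviCivita_mul_prod {n : ℕ} (B : Matrix (Fin n) (Fin n) ℝ) (f : Fin n → Fin n) :
    ∑ h : Fin n → Fin n, leviCivita h * ∏ a, B (h a) (f a) = B.det * leviCivita f := by
  have h1 : Matrix.detRowAlternating.toMultilinearMap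
      (fun a => ∑ k, B k (f a) • (1 : Matrix (Fin n) (Fin n) ℝ) k) =
        ((1 : Matrix (Fin n) (Fin n) ℝ).submatrix f id * B.transpose).det := by
    have e : (Matrix.of fun a => ∑ k, B k (f a) • (1 : Matrix (Fin n) (Fin n) ℝ) k) =
        (1 : Matrix (Fin n) (Fin n) ℝ).submatrix f id * B.transpose := by
      ext a b
      simp [Matrix.mul_apply, Matrix.one_apply, Finset.sum_apply]
    exact congrArg Matrix.det e
  rw [Matrix.det_mul, Matrix.det_transpose, mul_comm, MultilinearMap.map_sum] at h1
  refine Eq.trans (Finset.sum_congr rfl fun h _ => ?_) h1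
  rw [MultilinearMap.map_smul_univ, smul_eq_mul, mul_comm]
  rfl

theorem sum_fin_add_two {m : ℕ} {α : Type*} [Fintype α] (F : (Fin (m + 2) → α) → ℝ) :
    ∑ h, F h = ∑ k, ∑ l, ∑ i : Fin m → α, F (Matrix.vecCons k (Matrix.vecCons l i)) := by
  rw [← (Fin.consEquiv fun _ : Fin (m + 2) => α).sum_comp, Fintype.sum_prod_type]
  refine Finset.sum_congr rfl fun k _ => ?_
  refine ((Fin.consEquiv fun _ : Fin (m + 1) => α).sum_comp fun x =>
    F (Matrix.vecCons k x)).symm.trans ?_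
  rw [Fintype.sum_prod_type]
  rfl

/-- The sum lacks one factor of B. Contracting the free index k with B completes it to a
determinant, and contracting with U = B⁻¹ undoes this. It is the cofactor formula for the inverse in
the Levi-Civita notation. -/
theorem sum_leviCivita_minor {m : ℕ} {B U : Matrix (Fin (m + 2)) (Fin (m + 2)) ℝ} (h : B * U = 1)
    (k γ : Fin (m + 2)) (f : Fin m → Fin (m + 2)) :
    ∑ l, ∑ i : Fin m → Fin (m + 2), leviCivita (Matrix.vecCons k (Matrix.vecCons l i)) *
        (B l γ * ∏ b, B (i b) (f b)) =
      B.det * ∑ κ, U κ k * leviCivita (Matrix.vecCons κ (Matrix.vecCons γ f)) := by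
  set C : Fin (m + 2) → ℝ := fun k => ∑ l, ∑ i : Fin m → Fin (m + 2),
    leviCivita (Matrix.vecCons k (Matrix.vecCons l i)) * (B l γ * ∏ b, B (i b) (f b)) with hC
  have key : ∀ κ, ∑ k', B k' κ * C k' =
      B.det * leviCivita (Matrix.vecCons κ (Matrix.vecCons γ f)) := fun κ => by
    rw [← sum_leviCivita_mul_prod, sum_fin_add_two]
    refine Finset.sum_congr rfl fun k' _ => ?_
    rw [hC, Finset.mul_sum]
    refine Finset.sum_congr rfl fun l _ => ?_
    rw [Finset.mul_sum]
    refine Finset.sum_congr rfl fun i _ => ?_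
    rw [Fin.prod_univ_succ, Fin.prod_univ_succ]
    simp only [Matrix.cons_val_zero, Matrix.cons_val_succ]
    ring
  have hk : ∀ k', ∑ κ, B k' κ * U κ k = if k' = k then 1 else 0 := fun k' => by
    rw [← Matrix.mul_apply, h, Matrix.one_apply]
  calc C k = ∑ k', (∑ κ, B k' κ * U κ k) * C k' := by simp [hk]
    _ = ∑ κ, U κ k * ∑ k', B k' κ * C k' := by
        simp only [Finset.sum_mul, Finset.mul_sum]
        rw [Finset.sum_comm]
        exact Finset.sum_congr rfl fun κ _ => Finset.sum_congr rfl fun k' _ => by ring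
    _ = _ := by
        simp only [key, Finset.mul_sum]
        exact Finset.sum_congr rfl fun κ _ => by ring

end LeviCivita

/-! ### Products of one-forms -/

section WedgeProd

variable {V : Type*} [NormedAddCommGroup V] [NormedSpace ℝ V]

/-- The product `a₀ ∧ ⋯ ∧ a_{k-1}` of alternating forms of degree one. -/
def altWedgeProd : (k : ℕ) → (Fin k → V [⋀^Fin 1]→L[ℝ] ℝ) → V [⋀^Fin k]→L[ℝ] ℝ
  | 0, _ => ContinuousAlternatingMap.constOfIsEmpty ℝ V (Fin 0) 1
  | k + 1, a => altWedge (altWedgeProd k fun i => a i.castSucc) (a (Fin.last k))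

theorem altWedgeProd_sum {ι : Type*} [Fintype ι] (B : ι → ι → ℝ) (ξ : ι → V [⋀^Fin 1]→L[ℝ] ℝ) :
    ∀ (k : ℕ) (i : Fin k → ι), altWedgeProd k (fun b => ∑ μ, B (i b) μ • ξ μ) =
      ∑ f : Fin k → ι, (∏ b, B (i b) (f b)) • altWedgeProd k fun b => ξ (f b)
  | 0, i => by simp [altWedgeProd]
  | k + 1, i => by
    rw [altWedgeProd, altWedgeProd_sum B ξ k fun b => i b.castSucc,
      ← (Fin.snocEquiv fun _ : Fin (k + 1) => ι).sum_comp, Fintype.sum_prod_type, Finset.sum_comm,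
      altWedge_sum_left]
    refine Finset.sum_congr rfl fun f _ => ?_
    rw [altWedge_sum_right]
    refine Finset.sum_congr rfl fun μ _ => ?_
    rw [altWedge_smul_left, altWedge_smul_right, smul_smul, Fin.prod_univ_castSucc, altWedgeProd]
    simp [Fin.snocEquiv]

variable {X : Type*} [TopologicalSpace X] [ChartedSpace V X]
variable {W : Type*} [NormedAddCommGroup W] [NormedSpace ℝ W]
variable {Y : Type*} [TopologicalSpace Y] [ChartedSpace W Y]

theorem DForm.wedgeProd_val (x : X) : ∀ (k : ℕ) (α : Fin k → DForm V X 1),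
    (DForm.wedgeProd k α).val x = altWedgeProd k fun i => (α i).val x
  | 0, _ => rfl
  | k + 1, α => congrArg (fun a : V [⋀^Fin k]→L[ℝ] ℝ => altWedge a ((α (Fin.last k)).val x))
      (DForm.wedgeProd_val x k fun i => α i.castSucc)

theorem DForm.wedgeProd_pullback (f : X → Y) : ∀ (k : ℕ) (α : Fin k → DForm W Y 1),
    (DForm.wedgeProd k α).pullback (V := V) f =
      DForm.wedgeProd k fun i => (α i).pullback (V := V) f
  | 0, _ => rfl
  | k + 1, α => by
    rw [DForm.wedgeProd, DForm.wedge_pullback, DForm.wedgeProd_pullback f k]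
    rfl

theorem DForm.smoothAt_wedgeProd [IsManifold 𝓘(ℝ, V) ∞ X] [FiniteDimensional ℝ V] {x : X} :
    ∀ (k : ℕ) (α : Fin k → DForm V X 1), (∀ i, (α i).SmoothAt x) → (DForm.wedgeProd k α).SmoothAt x
  | 0, _, _ => DForm.smoothAt_ofFun contMDiffAt_const
  | k + 1, _, h => (DForm.smoothAt_wedgeProd k _ fun i => h i.castSucc).wedge (h (Fin.last k))

end WedgeProd

/-! ### The Lagrangian in coordinates -/

section Rearrange

theorem sum_comm_four_three {A₁ A₂ A₃ A₄ B₁ B₂ B₃ N : Type*} [Fintype A₁] [Fintype A₂] [Fintype A₃]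
    [Fintype A₄] [Fintype B₁] [Fintype B₂] [Fintype B₃] [AddCommMonoid N]
    (F : A₁ → A₂ → A₃ → A₄ → B₁ → B₂ → B₃ → N) :
    ∑ a₁, ∑ a₂, ∑ a₃, ∑ a₄, ∑ b₁, ∑ b₂, ∑ b₃, F a₁ a₂ a₃ a₄ b₁ b₂ b₃ =
      ∑ b₁, ∑ b₂, ∑ b₃, ∑ a₁, ∑ a₂, ∑ a₃, ∑ a₄, F a₁ a₂ a₃ a₄ b₁ b₂ b₃ := by
  have := Finset.sum_comm (s := (Finset.univ : Finset (A₁ × A₂ × A₃ × A₄)))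
    (t := (Finset.univ : Finset (B₁ × B₂ × B₃)))
    (f := fun a b => F a.1 a.2.1 a.2.2.1 a.2.2.2 b.1 b.2.1 b.2.2)
  simpa only [Fintype.sum_prod_type] using this

/-- The sums over l and i form the minor of `sum_leviCivita_minor`, whose factor U combines with η
and the frame factor of Ω to give g^{κτ}. The minus sign of the Lagrangian is that of
`leviCivita_append`. -/
theorem palatini_coefficient {m : ℕ} {B U η g : Matrix (Fin (m + 2)) (Fin (m + 2)) ℝ}
    (h : B * U = 1) (hg : ∀ κ τ, g κ τ = ∑ k, ∑ j, U κ k * η k j * U τ j)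
    (γ τ : Fin (m + 2)) (f : Fin m → Fin (m + 2)) :
    ∑ k, ∑ l, ∑ j, ∑ i : Fin m → Fin (m + 2), η k j *
        (leviCivita (Matrix.vecCons k (Matrix.vecCons l i)) * ((∏ b, B (i b) (f b)) *
          (B l γ * U τ j))) =
      ∑ κ, -B.det * leviCivita (Fin.append f ![γ, κ]) * g κ τ := by
  calc _ = ∑ k, ∑ j, η k j * U τ j * ∑ l, ∑ i : Fin m → Fin (m + 2),
        leviCivita (Matrix.vecCons k (Matrix.vecCons l i)) * (B l γ * ∏ b, B (i b) (f b)) := by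
        refine Finset.sum_congr rfl fun k _ => ?_
        rw [Finset.sum_comm]
        simp only [Finset.mul_sum]
        exact Finset.sum_congr rfl fun j _ => Finset.sum_congr rfl fun l _ =>
          Finset.sum_congr rfl fun i _ => by ring
    _ = ∑ k, ∑ j, ∑ κ, B.det * leviCivita (Matrix.vecCons κ (Matrix.vecCons γ f)) *
        (U κ k * η k j * U τ j) := by
        simp only [sum_leviCivita_minor h, Finset.mul_sum]
        exact Finset.sum_congr rfl fun k _ => Finset.sum_congr rfl fun j _ =>
          Finset.sum_congr rfl fun κ _ => by ring
    _ = ∑ κ, B.det * leviCivita (Matrix.vecCons κ (Matrix.vecCons γ f)) * g κ τ := by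
        simp only [hg, Finset.mul_sum]
        exact (Finset.sum_congr rfl fun k _ => Finset.sum_comm).trans Finset.sum_comm
    _ = _ := by
        refine Finset.sum_congr rfl fun κ _ => ?_
        rw [leviCivita_append]; ring

end Rearrange

/-! ### The reduced Lagrangian -/

/-- The connection −ρu⁻¹ differs from ω by the gauge transformation u, so the curvatures are
conjugate: Ω = u⁻¹Ru. -/
theorem curvature_model {n : ℕ} (z v w : VJ n) (hz : IsUnit z.2.1) {I : L n}
    (hI : I = Ring.inverse z.2.1) :
    -(I * v.2.2 w.1) + I * z.2.2 w.1 * I * v.2.1 + I * z.2.2 v.1 * I * z.2.2 w.1 -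
      (-(I * w.2.2 v.1) + I * z.2.2 v.1 * I * w.2.1 + I * z.2.2 w.1 * I * z.2.2 v.1) =
    I * ((dprojModel z v).2.2 (dprojModel z w).1 +
        (projModel z).2.2 (dprojModel z v).1 * (projModel z).2.2 (dprojModel z w).1 -
      ((dprojModel z w).2.2 (dprojModel z v).1 +
        (projModel z).2.2 (dprojModel z w).1 * (projModel z).2.2 (dprojModel z v).1)) * z.2.1 := by
  have hIu : I * z.2.1 = 1 := by rw [hI, Ring.inverse_mul_cancel _ hz]
  have e1 : ∀ v w : VJ n, (dprojModel z v).2.2 (dprojModel z w).1 =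
      -(z.2.2 w.1 * -(I * v.2.1 * I) + v.2.2 w.1 * I) := fun v w => by rw [hI]; rfl
  have e2 : ∀ v : VJ n, (projModel z).2.2 (dprojModel z v).1 = -(z.2.2 v.1 * I) :=
    fun v => by rw [hI]; rfl
  -- Both halves of the antisymmetrised expression agree separately, up to a right factor Iu = 1.
  have e3 : ∀ v w : VJ n, I * (-(z.2.2 w.1 * -(I * v.2.1 * I) + v.2.2 w.1 * I) +
      -(z.2.2 v.1 * I) * -(z.2.2 w.1 * I)) * z.2.1 =
      -(I * v.2.2 w.1) + I * z.2.2 w.1 * I * v.2.1 + I * z.2.2 v.1 * I * z.2.2 w.1 := fun v w => by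
    have : I * (-(z.2.2 w.1 * -(I * v.2.1 * I) + v.2.2 w.1 * I) +
        -(z.2.2 v.1 * I) * -(z.2.2 w.1 * I)) * z.2.1 =
        (-(I * v.2.2 w.1) + I * z.2.2 w.1 * I * v.2.1 + I * z.2.2 v.1 * I * z.2.2 w.1) *
          (I * z.2.1) := by noncomm_ring
    rw [this, hIu, mul_one]
  rw [e1, e1, e2, e2, mul_sub, sub_mul, e3, e3]

namespace J1LM

section Forms

variable {n : ℕ} {M : Type*} [TopologicalSpace M] [ChartedSpace (E n) M] [IsManifold (𝓡 n) ∞ M]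
variable {φ : OpenPartialHomeomorph M (E n)}

theorem theta_eq (hφ : φ ∈ Charts n M) {p : J1LM n M} (hp : p.base ∈ φ.source) (i : Fin n) :
    (theta i : FormJ n M 1).val p =
      ∑ μ, coframeIn φ i μ p • ((CSigma.dx φ μ).pullback (V := VJ n) toCSigma).val p := by
  have hp' : p.toCSigma.base ∈ φ.source := hp
  refine ContinuousAlternatingMap.ext fun (v : Fin 1 → VJ n) => ?_
  rw [theta_val hφ hp, ContinuousAlternatingMap.sum_apply]
  refine (apply_eq_sum (Ring.inverse (coord φ p).2.1) (dcoord φ p (v 0)).1 i).trans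
    (Finset.sum_congr rfl fun μ _ => ?_)
  refine congrArg (coframeIn φ i μ p * ·) ?_
  have h := congrArg (fun a : VQ n [⋀^Fin 1]→L[ℝ] ℝ => a fun j => p.dproj (v j))
    (CSigma.dx_val hφ hp' μ)
  refine Eq.trans ?_ h.symm
  exact congrArg (fun z : VQ n => z.1 μ) (dcoord_dproj hφ hp (v 0)).symm

theorem curvature_eq (hφ : φ ∈ Charts n M) {p : J1LM n M} (hp : p.base ∈ φ.source) (i j : Fin n) :
    (curvature i j : FormJ n M 2).val p = ∑ γ, ∑ τ, (coframeIn φ i γ p * frameIn φ τ j p) •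
      ((CSigma.curvatureForm φ γ τ).pullback (V := VJ n) toCSigma).val p := by
  have hp' : p.toCSigma.base ∈ φ.source := hp
  refine DForm.alt_ext_two (V := VJ n) fun v w => ?_
  refine (curvature_apply hφ hp i j rfl rfl rfl rfl).trans ?_
  rw [curvature_model _ _ _ (isUnit_coord hφ hp) rfl, entry_mul_mul]
  simp only [ContinuousAlternatingMap.sum_apply, ContinuousAlternatingMap.smul_apply, smul_eq_mul]
  refine Finset.sum_congr rfl fun γ _ => Finset.sum_congr rfl fun τ _ => ?_
  refine congrArg (coframeIn φ i γ p * frameIn φ τ j p * ·) ?_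
  refine (CSigma.curvatureForm_apply hφ hp' γ τ (coord_toCSigma hφ hp).symm
    (dcoord_dproj hφ hp v).symm (dcoord_dproj hφ hp w).symm).symm.trans ?_
  refine congrArg ((CSigma.curvatureForm φ γ τ : FormQ n M 2).val p.toCSigma) (funext fun i => ?_)
  fin_cases i <;> rfl

theorem metricIn_toCSigma (hφ : φ ∈ Charts n M) {p : J1LM n M} (hp : p.base ∈ φ.source) :
    CSigma.metricIn φ p.toCSigma = metricOf (coord φ p).2.1 := by
  have h := congrArg (fun z : VQ n => z.2.1.op) (coord_toCSigma hφ hp)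
  refine h.trans ?_
  change (symL n (metricOf (coord φ p).2.1)).op = _
  rw [symL_eq (star_metricOf _)]
  rfl

theorem g_toCSigma (hφ : φ ∈ Charts n M) {p : J1LM n M} (hp : p.base ∈ φ.source) (κ τ : Fin n) :
    CSigma.g φ κ τ p.toCSigma =
      ∑ k, ∑ j, frameIn φ κ k p * etaMatrix n k j * frameIn φ τ j p := by
  rw [CSigma.g, metricIn_toCSigma hφ hp, metricOf, entry_conj]
  refine Finset.sum_congr rfl fun k _ => Finset.sum_congr rfl fun j _ => ?_
  rw [entry_eta, frameIn, frameIn]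
  ring

/-- As det(g^{μν}) = −(det u)², the root is 1/|det u|, and the orientation restores the sign of det
u. -/
theorem orientIn_mul_sqrtNegDet [NeZero n] (hφ : φ ∈ Charts n M) {p : J1LM n M}
    (hp : p.base ∈ φ.source) :
    (((CSigma.orientIn φ p.toCSigma : ℤˣ) : ℤ) : ℝ) * CSigma.sqrtNegDet φ p.toCSigma =
      (det (coord φ p).2.1)⁻¹ := by
  have hd := det_ne_zero (isUnit_coord hφ hp)
  rw [orientIn_toCSigma hφ hp, CSigma.sqrtNegDet, metricIn_toCSigma hφ hp, metricOf, det_mul, det_mul,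
    det_star, det_eta]
  set d := det (coord φ p).2.1
  have h : -(d * -1 * d)⁻¹ = (d⁻¹) ^ 2 := by field_simp
  rw [h, Real.sqrt_sq_eq_abs, sgn]
  split_ifs with h0
  · rw [abs_of_pos (inv_pos.2 h0)]; simp
  · rw [abs_of_neg (inv_lt_zero.2 (lt_of_le_of_ne (not_lt.1 h0) hd))]; simp

theorem det_coframeIn (hφ : φ ∈ Charts n M) {p : J1LM n M} (hp : p.base ∈ φ.source) :
    (Matrix.of fun i μ => coframeIn φ i μ p).det = (det (coord φ p).2.1)⁻¹ := by
  have h : det (Ring.inverse (coord φ p).2.1) * det (coord φ p).2.1 = 1 := by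
    rw [← det_mul, Ring.inverse_mul_cancel _ (isUnit_coord hφ hp), det_one]
  rw [← eq_inv_of_mul_eq_one_left h, det_eq]
  rfl

theorem coframeIn_mul_frameIn (hφ : φ ∈ Charts n M) {p : J1LM n M} (hp : p.base ∈ φ.source) :
    (Matrix.of fun i μ => coframeIn φ i μ p) * (Matrix.of fun μ i => frameIn φ μ i p) = 1 := by
  ext i j
  rw [Matrix.mul_apply, Matrix.one_apply, ← entry_one, ← Ring.inverse_mul_cancel _ (isUnit_coord hφ hp),
    entry_mul]
  rfl

/-- A form on the quotient is determined by its pullback. -/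
theorem eq_of_pullback_eq {k : ℕ} {α β : FormQ n M k} {p : J1LM n M}
    (h : α.pullback (V := VJ n) toCSigma p = β.pullback (V := VJ n) toCSigma p) :
    α p.toCSigma = β p.toCSigma := by
  refine ContinuousAlternatingMap.ext fun (v : Fin k → VQ n) => ?_
  choose w hw using fun i => dproj_surjective p (v i)
  have h' := congrArg (fun a : VJ n [⋀^Fin k]→L[ℝ] ℝ => a w) h
  have e : v = fun i => p.dproj (w i) := funext fun i => (hw i).symm
  rw [e]
  exact h'

end Forms

section Lagrangian

variable {m : ℕ} {M : Type*} [TopologicalSpace M] [ChartedSpace (E (m + 2)) M]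
  [IsManifold (𝓡 (m + 2)) ∞ M] {φ : OpenPartialHomeomorph M (E (m + 2))}

/-- The pullback of `dx^{μ_1} ∧ ⋯ ∧ dx^{μ_m} ∧ R^γ_τ` at `p`. -/
def coordTerm (φ : OpenPartialHomeomorph M (E (m + 2))) (p : J1LM (m + 2) M)
    (μ : Fin m → Fin (m + 2)) (γ τ : Fin (m + 2)) : VJ (m + 2) [⋀^Fin (m + 2)]→L[ℝ] ℝ :=
  altWedge (altWedgeProd m fun a =>
      ((CSigma.dx φ (μ a)).pullback (V := VJ (m + 2)) toCSigma).val p)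
    (((CSigma.curvatureForm φ γ τ).pullback (V := VJ (m + 2)) toCSigma).val p)

theorem pullback_lagrangian_val (φ : OpenPartialHomeomorph M (E (m + 2))) (p : J1LM (m + 2) M) :
    ((CSigma.lagrangian φ).pullback (V := VJ (m + 2)) toCSigma).val p =
      ∑ μ : Fin m → Fin (m + 2), ∑ γ, ∑ κ, ∑ τ,
        (-(((CSigma.orientIn φ p.toCSigma : ℤˣ) : ℤ) : ℝ) * (m.factorial : ℝ)⁻¹ *
          leviCivita (Fin.append μ ![γ, κ]) * CSigma.sqrtNegDet φ p.toCSigma *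
            CSigma.g φ κ τ p.toCSigma) • coordTerm φ p μ γ τ := by
  rw [CSigma.lagrangian]
  simp only [DForm.pullback_sum]
  refine (DForm.val_sum _ _ _).trans (Finset.sum_congr rfl fun μ _ => ?_)
  refine (DForm.val_sum _ _ _).trans (Finset.sum_congr rfl fun γ _ => ?_)
  refine (DForm.val_sum _ _ _).trans (Finset.sum_congr rfl fun κ _ => ?_)
  refine (DForm.val_sum _ _ _).trans (Finset.sum_congr rfl fun τ _ => ?_)
  rw [DForm.pullback_fmul, DForm.wedge_pullback, DForm.wedgeProd_pullback]
  refine congrArg (_ • ·) ?_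
  exact congrArg (fun a => altWedge a _) (DForm.wedgeProd_val p m _)

theorem lambdaPG_val (hφ : φ ∈ Charts (m + 2) M) {p : J1LM (m + 2) M} (hp : p.base ∈ φ.source) :
    (lambdaPG m M).val p = ∑ k, ∑ l, ∑ j, ∑ i : Fin m → Fin (m + 2),
      ∑ μ : Fin m → Fin (m + 2), ∑ γ, ∑ τ, (etaMatrix (m + 2) k j * ((m.factorial : ℝ)⁻¹ *
        (leviCivita (Matrix.vecCons k (Matrix.vecCons l i)) *
          ((∏ b, coframeIn φ (i b) (μ b) p) * (coframeIn φ l γ p * frameIn φ τ j p))))) •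
          coordTerm φ p μ γ τ := by
  refine (DForm.val_sum _ _ _).trans (Finset.sum_congr rfl fun k _ => ?_)
  refine (DForm.val_sum _ _ _).trans (Finset.sum_congr rfl fun l _ => ?_)
  refine (DForm.val_sum _ _ _).trans (Finset.sum_congr rfl fun j _ => ?_)
  have h1 : (thetaLow k l : FormJ (m + 2) M m).val p = ((m.factorial : ℝ)⁻¹) •
      ∑ i : Fin m → Fin (m + 2), leviCivita (Matrix.vecCons k (Matrix.vecCons l i)) •
        altWedgeProd m fun a => (theta (i a) : FormJ (m + 2) M 1).val p := by
    refine congrArg (fun a : VJ (m + 2) [⋀^Fin m]→L[ℝ] ℝ => ((m.factorial : ℝ)⁻¹) • a) ?_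
    refine (DForm.val_sum _ _ _).trans (Finset.sum_congr rfl fun i _ => ?_)
    exact congrArg (fun a : VJ (m + 2) [⋀^Fin m]→L[ℝ] ℝ =>
      leviCivita (Matrix.vecCons k (Matrix.vecCons l i)) • a) (DForm.wedgeProd_val p m _)
  change etaMatrix (m + 2) k j • altWedge ((thetaLow k l : FormJ (m + 2) M m).val p)
    ((curvature l j : FormJ (m + 2) M 2).val p) = _
  rw [h1, curvature_eq hφ hp]
  simp only [theta_eq hφ hp]
  have h2 : ∀ i : Fin m → Fin (m + 2), altWedgeProd m (fun a => ∑ μ, coframeIn φ (i a) μ p •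
      ((CSigma.dx φ μ).pullback (V := VJ (m + 2)) toCSigma).val p) =
      ∑ f : Fin m → Fin (m + 2), (∏ b, coframeIn φ (i b) (f b) p) • altWedgeProd m fun b =>
        ((CSigma.dx φ (f b)).pullback (V := VJ (m + 2)) toCSigma).val p :=
    fun i => altWedgeProd_sum (fun i μ => coframeIn φ i μ p) _ m i
  simp only [h2, altWedge_smul_left, altWedge_sum_left]
  simp only [altWedge_sum_right, altWedge_smul_right, Finset.smul_sum, smul_smul]
  rfl

theorem pullback_lagrangian (hφ : φ ∈ Charts (m + 2) M) {p : J1LM (m + 2) M}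
    (hp : p.base ∈ φ.source) :
    (CSigma.lagrangian φ).pullback (V := VJ (m + 2)) toCSigma p = lambdaPG m M p := by
  refine (pullback_lagrangian_val φ p).trans (Eq.trans ?_ (lambdaPG_val hφ hp).symm)
  -- Both sides become sums over the same terms dx^μ ∧ R^γ_τ, so it suffices to compare
  -- coefficients.
  rw [sum_comm_four_three]
  refine Finset.sum_congr rfl fun μ _ => Finset.sum_congr rfl fun γ _ => ?_
  rw [Finset.sum_comm]
  refine Finset.sum_congr rfl fun τ _ => ?_
  simp only [← Finset.sum_smul]
  congr 1
  have h := palatini_coefficient (coframeIn_mul_frameIn hφ hp) (η := etaMatrix (m + 2))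
    (g := Matrix.of fun κ τ => CSigma.g φ κ τ p.toCSigma) (g_toCSigma hφ hp) γ τ μ
  rw [det_coframeIn hφ hp, ← orientIn_mul_sqrtNegDet hφ hp] at h
  have h' := congrArg ((m.factorial : ℝ)⁻¹ * ·) h
  simp only [Finset.mul_sum, Matrix.of_apply] at h'
  refine Eq.trans (Finset.sum_congr rfl fun κ _ => ?_) (h'.symm.trans ?_)
  · ring
  · exact Finset.sum_congr rfl fun k _ => Finset.sum_congr rfl fun l _ =>
      Finset.sum_congr rfl fun j _ => Finset.sum_congr rfl fun i _ => by ring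

theorem smoothAt_lambdaPG (p : J1LM (m + 2) M) : (lambdaPG m M).SmoothAt p := by
  refine DForm.SmoothAt.sum fun k _ => DForm.SmoothAt.sum fun l _ =>
    DForm.SmoothAt.sum fun j _ => DForm.SmoothAt.smul _ (DForm.SmoothAt.wedge ?_ ?_)
  · exact DForm.SmoothAt.smul _ (DForm.SmoothAt.sum fun i _ => DForm.SmoothAt.smul _
      (DForm.smoothAt_wedgeProd m _ fun a => smoothAt_theta _ p))
  · exact smoothAt_curvature _ _ p

/-- The form is defined by the coordinate expression in the preferred chart of each base point.
Independence of the chart is not computed: all expressions have the pullback λ_PG, and p_H^* is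
injective. -/
theorem exists_reduced_lagrangian : ∃ lbar : FormQ (m + 2) M (m + 2), lbar.IsSmooth ∧
    lbar.pullback J1LM.toCSigma = lambdaPG m M ∧
    (∀ l' : FormQ (m + 2) M (m + 2), l'.pullback J1LM.toCSigma = lambdaPG m M → l' = lbar) ∧
    ∀ φ ∈ Charts (m + 2) M, ∀ q : CSigma (m + 2) M, q.base ∈ φ.source →
      lbar q = CSigma.lagrangian φ q := by
  set lbar : FormQ (m + 2) M (m + 2) :=
    fun q => CSigma.lagrangian (chartAt (E (m + 2)) q.base) q with hl
  have hp : lbar.pullback J1LM.toCSigma = lambdaPG m M := by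
    funext p
    have hφ : chartAt (E (m + 2)) p.base ∈ Charts (m + 2) M :=
      IsManifold.chart_mem_maximalAtlas p.base
    rw [← pullback_lagrangian hφ (mem_chart_source (E (m + 2)) p.base)]
    exact DForm.pullback_eq_of_eq rfl
  refine ⟨lbar, ?_, hp, fun l' h' => ?_, fun φ hφ q hq => ?_⟩
  -- The preferred charts jump from point to point. Smoothness follows because near each point the
  -- form is the pullback of the smooth form λ_PG along a local section.
  · rw [DForm.IsSmooth, DForm.isSmoothOn_iff isOpen_univ]
    intro q _
    obtain ⟨p, rfl⟩ := toCSigma_surjective q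
    obtain ⟨B, s, hB, hpB, -, hs, hsec⟩ := exists_local_section contMDiff_toCSigma (dproj_surjective p)
    refine ((smoothAt_lambdaPG (s p.toCSigma)).pullback (hs _ hpB)).congr
      (Filter.eventually_of_mem (hB.mem_nhds hpB) fun y hy => ?_)
    rw [← hp]
    refine Eq.symm ((DForm.pullback_pullback lbar ((contMDiff_toCSigma (s y)).mdifferentiableAt
      (by simp)) ((hs y hy).mdifferentiableAt (by simp))).trans ?_)
    exact DForm.pullback_eq_self lbar (Filter.eventually_of_mem (hB.mem_nhds hy) hsec)
  · funext q
    obtain ⟨p, rfl⟩ := toCSigma_surjective q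
    exact eq_of_pullback_eq (by rw [h', hp])
  · obtain ⟨p, rfl⟩ := toCSigma_surjective q
    exact eq_of_pullback_eq (by rw [hp, pullback_lagrangian hφ hq])

end Lagrangian

end J1LM

end PalatiniGravity

end

/-! ### The corollary, with n = m + 2. -/

theorem mainTheorem1 (m : ℕ) {M : Type*} [TopologicalSpace M]
    [ChartedSpace (EuclideanSpace ℝ (Fin (m + 2))) M] [IsManifold (𝓡 (m + 2)) ∞ M]
    [T2Space M] [SigmaCompactSpace M] :
    -- the action of `H = SO(1,n-1)` on `J¹LM` (`n = m + 2`) is free and proper, its orbits are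
    -- vertical, and it is a symmetry group of the differential system `I_PG`
    ((∀ A ∈ lorentzGroup (m + 2), ∀ p : J1LM (m + 2) M, p.rmul A = p → A = 1) ∧
      IsProperMap (fun z : lorentzGroup (m + 2) × J1LM (m + 2) M => (z.2.rmul z.1, z.2)) ∧
      (∀ A ∈ lorentzGroup (m + 2), ∀ p : J1LM (m + 2) M, (p.rmul A).base = p.base) ∧
      (∀ A ∈ lorentzGroup (m + 2), ∀ (k : ℕ) (ξ : FormJ (m + 2) M k), IPG (m + 2) M k ξ →
        IPG (m + 2) M k (ξ.pullback fun p : J1LM (m + 2) M => p.rmul A))) ∧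
    -- `C(LM) ×_M Σ` is the quotient manifold `J¹LM/H`
    (ContMDiff 𝓘(ℝ, VJ (m + 2)) 𝓘(ℝ, VQ (m + 2)) ∞
        (J1LM.toCSigma : J1LM (m + 2) M → CSigma (m + 2) M) ∧
      Function.Surjective (J1LM.toCSigma : J1LM (m + 2) M → CSigma (m + 2) M) ∧
      (∀ p : J1LM (m + 2) M, Function.Surjective
        (mfderiv 𝓘(ℝ, VJ (m + 2)) 𝓘(ℝ, VQ (m + 2)) J1LM.toCSigma p)) ∧
      (∀ p p' : J1LM (m + 2) M,
        p.toCSigma = p'.toCSigma ↔ ∃ A ∈ lorentzGroup (m + 2), p' = p.rmul A)) ∧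
    -- the reduced Lagrangian
    (∃ lbar : FormQ (m + 2) M (m + 2), lbar.IsSmooth ∧
      lbar.pullback J1LM.toCSigma = lambdaPG m M ∧
      (∀ l' : FormQ (m + 2) M (m + 2), l'.pullback J1LM.toCSigma = lambdaPG m M → l' = lbar) ∧
      ∀ φ ∈ Charts (m + 2) M, ∀ q : CSigma (m + 2) M, q.base ∈ φ.source →
        lbar q = CSigma.lagrangian φ q) ∧
    -- the reduced differential system
    (∀ (k : ℕ) (α : FormQ (m + 2) M k),
      ReducedEDS J1LM.toCSigma (IPG (m + 2) M) k α ↔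
        α.IsSmooth ∧ ∀ φ ∈ Charts (m + 2) M,
          DiffIdeal {q : CSigma (m + 2) M | q.base ∈ φ.source} (CSigma.LCGenerator φ) k α) ∧
    -- its integral sections over an open set `W` are the pairs of a metric and its Levi-Civita
    -- connection
    (∀ (W : Set M) (s : M → CSigma (m + 2) M), IsOpen W →
      ContMDiffOn (𝓡 (m + 2)) 𝓘(ℝ, VQ (m + 2)) ∞ s W → (∀ x ∈ W, (s x).base = x) →
      ((∀ (k : ℕ) (α : FormQ (m + 2) M k), ReducedEDS J1LM.toCSigma (IPG (m + 2) M) k α →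
          ∀ x ∈ W, α.pullback (V := EuclideanSpace ℝ (Fin (m + 2))) s x = 0) ↔
        ∀ φ ∈ Charts (m + 2) M, ∀ x ∈ W, x ∈ φ.source →
          (∀ μ ν γ, fderiv ℝ (fun y => CSigma.g φ μ ν (s (φ.symm y))) (φ x)
              (EuclideanSpace.single γ (1 : ℝ)) +
            ∑ σ, (CSigma.g φ μ σ (s x) * CSigma.Γ φ ν γ σ (s x) +
              CSigma.g φ ν σ (s x) * CSigma.Γ φ μ γ σ (s x)) = 0) ∧
          (∀ σ μ ν, CSigma.Γ φ σ μ ν (s x) - CSigma.Γ φ σ ν μ (s x) = 0))) := by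
  refine ⟨⟨fun A _ p h => J1LM.eq_one_of_rmul_eq h, J1LM.isProperMap_rmul, fun A _ p => rfl,
    fun A hA k ξ hξ => J1LM.IPG_pullback_rmul hA hξ⟩, ⟨J1LM.contMDiff_toCSigma,
    J1LM.toCSigma_surjective, J1LM.dproj_surjective, J1LM.toCSigma_eq_iff⟩,
    J1LM.exists_reduced_lagrangian, J1LM.reducedEDS_iff,
    fun W s hW hs hb => CSigma.integral_section_iff hW hs hb⟩
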